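/- **Setting.** Let $d\ge 0$, $\eta\in[0,1]$ and $\theta=1-2\eta$. Let $\mathbb N^*$ be the set of finite strings of natural numbers, with root $\rho=\emptyset$. Attach to the strings $v\in\mathbb N^*$ independent $\mathrm{Poisson}(d)$ variables $D_v$; the children of $v$ are its first $D_v$ one-letter extensions $vi$, and $T$ is the tree of descendants of $\rho$ (a Galton–Watson tree), $T_u$ the tree of descendants of $u$, $L_k(u)$ the set of descendants of $u$ in the $k$-th generation below $u$, and $\mathbb C(u)$ the set of $i$ such that $ui$ is a child of $u$. Independently of the $D_v$, let $\sigma$ be the broadcast process with parameter $\eta$: $\sigma_\rho=\pm1$ with probability $\tfrac12$ each and, independently for all $u,i$, $\sigma_{ui}=\sigma_u$ with probability $1-\eta$ and $\sigma_{ui}=-\sigma_u$ with probability $\eta$. Finally let $(\xi_v)_v$ be i.i.d. random elements of an arbitrary measurable space, independent of everything else. Put $$X_{u,k}=\Pr(\sigma_u=+\mid T_u,\sigma_{L_k(u)})-\Pr(\sigma_u=-\mid T_u,\sigma_{L_k(u)}).$$ **Assumption** (with constants $c>0$, $C_0>0$). $(Y_{u,k})$ is a family of random variables for which there is a $K$ such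 that for all $k\ge K$ and all $u$: $Y_{u,k}$ is a (possibly randomized) estimator of $\sigma_u$ with values in $[-1,1]$, that is, a measurable function of $T_u$, $\sigma_{L_k(u)}$ and $(\xi_{uw})_{w\in\mathbb N^*}$ with $|Y_{u,k}|\le1$ almost surely, and 1. almost surely (with the convention $0/0=0$, relevant only for $\eta\in\{0,1\}$) $$Y_{u,k+1}=\frac{\prod_{i\in\mathbb C(u)}(1+\theta Y_{ui,k})-\prod_{i\in\mathbb C(u)}(1-\theta Y_{ui,k})}{\prod_{i\in\mathbb C(u)}(1+\theta Y_{ui,k})+\prod_{i\in\mathbb C(u)}(1-\theta Y_{ui,k})};$$ 2. the distribution of $Y_{u,k}$ given $\sigma_u=+$ equals the distribution of $-Y_{u,k}$ given $\sigma_u=-$; 3. with probability at least $1-e^{-cd}$ over the tree, $$\mathbb E(Y_{u,k}\mid\sigma_u=+,T_u)\ \ge\ 1-\frac{C_0\min(\eta,1-\eta)}{\theta^2d}$$ (for $\eta\le\tfrac12$ the minimum is $\eta$). **Theorem.** For all $c,C_0>0$ there is a constant $C>0$, depending only on $c$ and $C_0$, such that for all $d,\eta$ with $\theta^2d\ge C$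 and every family $Y$ satisfying the assumption with the constants $c,C_0$, both limits below exist and $$\lim_{k\to\infty}\mathbb E|X_{\rho,k}|=\lim_{k\to\infty}\mathbb E|Y_{\rho,k}|.$$ -/

import Mathlib

open MeasureTheory ProbabilityTheory Filter Topology
open scoped unitInterval NNReal

noncomputable section

namespace GWBroadcast

/-- A configuration attaches to every finite string `v` of natural numbers the number of children
of `v`, the indicator that the label is flipped on the edge leading to `v` (at the root, the
empty string: that the label of the root is `-`), and a piece of extra randomness in `E`. -/
abbrev Config (E : Type*) := List ℕ → ℕ × Bool × E

section

variable {E : Type*}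

/-- The number `D_v` of children of `v`. -/
def offspring (ω : Config E) (v : List ℕ) : ℕ := (ω v).1

/-- Whether the label is flipped when it is passed to `v` from its parent. -/
def flipped (ω : Config E) (v : List ℕ) : Bool := (ω v).2.1

/-- The extra randomness attached to `v`. -/
def noise (ω : Config E) (v : List ℕ) : E := (ω v).2.2

/-- The label `σ_v ∈ {1, -1}` : one sign for every prefix of `v` (the root and `v` included),
multiplied along the path from the root to `v`. -/
def label (ω : Config E) (v : List ℕ) : ℝ :=
  (v.inits.map fun p => if flipped ω p then (-1 : ℝ) else 1).prod

/-- `InTree D u w` says that `uw` belongs to the tree of descendants of `u`, when every string `v`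
has the children `v0, …, v(D v - 1)`. -/
def InTree (D : List ℕ → ℕ) : List ℕ → List ℕ → Prop
  | _, [] => True
  | u, i :: w => i < D u ∧ InTree D (u ++ [i]) w

open Classical in
/-- The labels at `L_k(u) = {uw : |w| = k, uw a descendant of u}`, as a function of `w`;
the value `0` marks the strings `uw` outside `L_k(u)`. -/
def levelLabels (u : List ℕ) (k : ℕ) (ω : Config E) (w : List ℕ) : ℝ :=
  if w.length = k ∧ InTree (offspring ω) u w then label ω (u ++ w) else 0

/-- The σ-algebra generated by the random tree below `u`. -/
@[reducible] def treeAlg (u : List ℕ) : MeasurableSpace (Config E) :=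
  MeasurableSpace.comap (fun ω w => InTree (offspring ω) u w) inferInstance

/-- The σ-algebra generated by the tree below `u` and the labels at `L_k(u)`. -/
@[reducible] def obsAlg (u : List ℕ) (k : ℕ) : MeasurableSpace (Config E) :=
  treeAlg u ⊔ MeasurableSpace.comap (levelLabels u k) inferInstance

end

section

variable {E : Type*} [MeasurableSpace E]

/-- The σ-algebra generated by the extra randomness attached to `u` and to the strings below. -/
@[reducible] def noiseAlg (u : List ℕ) : MeasurableSpace (Config E) :=
  MeasurableSpace.comap (fun ω w => noise ω (u ++ w)) inferInstance

/-- The law of the flip indicator: fair at the root, `true` with probability `η` elsewhere. -/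
def flipLaw (η : I) (v : List ℕ) : Measure Bool :=
  bernoulliMeasure true false (if v = [] then ⟨1 / 2, by norm_num, by norm_num⟩ else η)

/-- The broadcast process with flip probability `η` on the Galton–Watson tree with `Poisson(d)`
offspring distribution, with independent extra randomness of law `ν` at every vertex: offspring
numbers, flips and noises are all independent. -/
def law (d : ℝ≥0) (η : I) (ν : Measure E) : Measure (Config E) :=
  Measure.infinitePi fun v => (poissonMeasure d).prod ((flipLaw η v).prod ν)

/-- The law of the process conditioned on `σ_u = s`. -/
def condLaw (d : ℝ≥0) (η : I) (ν : Measure E) (u : List ℕ) (s : ℝ) : Measure (Config E) :=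
  (law d η ν)[|{ω | label ω u = s}]

/-- The magnetization
`X_{u,k} = P(σ_u = + | T, σ_{L_k(u)}) - P(σ_u = - | T, σ_{L_k(u)})`. -/
def magnetization (d : ℝ≥0) (η : I) (ν : Measure E) (u : List ℕ) (k : ℕ) : Config E → ℝ :=
  (law d η ν)⟦{ω | label ω u = 1} | obsAlg u k⟧ - (law d η ν)⟦{ω | label ω u = -1} | obsAlg u k⟧

/-- `θ = 1 - 2η`. -/
def theta (η : I) : ℝ := 1 - 2 * (η : ℝ)

/-- The assumptions on the estimators `Y_{u,k}`: from some level `K` on, each `Y_{u,k}` is a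
(possibly randomized) estimator of `σ_u` with values in `[-1, 1]` based on the tree below `u`
and the labels at `L_k(u)`, and the family satisfies the recursion, the sign symmetry and the lower
bound on the conditional expectation given the tree (with constants `c` and `C₀`). For `η ≤ 1/2`
the minimum in the last condition is `η`. -/
def Admissible (d : ℝ≥0) (η : I) (ν : Measure E) (c C₀ : ℝ)
    (Y : List ℕ → ℕ → Config E → ℝ) : Prop :=
  ∃ K : ℕ, ∀ k ≥ K, ∀ u : List ℕ,
    Measurable[obsAlg u k ⊔ noiseAlg u] (Y u k) ∧
    (∀ᵐ ω ∂law d η ν, |Y u k ω| ≤ 1) ∧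
    (∀ᵐ ω ∂law d η ν, Y u (k + 1) ω =
      (∏ i ∈ Finset.range (offspring ω u), (1 + theta η * Y (u ++ [i]) k ω) -
        ∏ i ∈ Finset.range (offspring ω u), (1 - theta η * Y (u ++ [i]) k ω)) /
      (∏ i ∈ Finset.range (offspring ω u), (1 + theta η * Y (u ++ [i]) k ω) +
        ∏ i ∈ Finset.range (offspring ω u), (1 - theta η * Y (u ++ [i]) k ω))) ∧
    (condLaw d η ν u 1).map (Y u k) = (condLaw d η ν u (-1)).map (fun ω => -Y u k ω) ∧
    1 - Real.exp (-c * d) ≤ (law d η ν).real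
      {ω | 1 - C₀ * min (η : ℝ) (1 - η) / (theta η ^ 2 * d) ≤
        ((condLaw d η ν u 1)[Y u k | treeAlg u]) ω}

end

end GWBroadcast

end

/-! Bayes' rule shows that the magnetization satisfies the same recursion as `Y`: it is the belief
propagation iterate `bp`, and the map at a vertex is `gmap`. So `X` and `Y` come from one map with
different initial data. `E|X_k|` decreases in `k`, because deeper labels tell less about the root
(`integral_abs_bp_succ_le`), and hence converges. It remains to prove that `E|X_k - Y_k|` tends to
0, by a contraction from one level to the next.

Given the root label `σ`, the configurations seen from the children are independent with law
`childLaw` (`map_sub_restrict`). On functions of what is visible from level `k` on, that law has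
density `1 + σθX_k` relative to the unconditioned one (`posterior_view`, `map_view_childLaw`). The
difference of two values of `gmap` is bounded by a sum over children `i` of a discrepancy at `i`
times damping factors of the other children. If each damping factor has mean at most `q < 1`,
averaging `n q^(n-1)` over the Poisson number of children gives `d e^(-d(1-q))`, which is small.
Damping is available because `Y` is close to the true label by assumption, and then so is the
optimal `X` (`law_real_bp_le`). As `Y` may depend on the vertex, every estimate is uniform in the
vertex.

Write `s = min(η, 1-η)`. No single distance serves all noise levels, so there are three regimes.

If `s = 0`, only the values `1` and `-1` of the messages matter. The contraction concerns the
probabilities that `Y` is certain of the wrong label and that `X ≠ Y` (`law_real_wrong_le`,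
`law_real_ne_le`).

If `0 < s ≤ 1/1024`, a wrong message of `Y` may be very confident and its odds as large as `1/s`.
The contraction is for `E √|X - Y|`; the density `1 + θX` cancels the singular denominators, and a
small power of the odds controls the children where `Y` is far below `X` (`sqrt_abs_gmap_sub_le`,
`lintegral_sqrt_abs_sub_le`).

If `s ≥ 1/1024`, messages stay away from `±1`, but `θ` may be small and `d` is only known to be
large compared with `θ^(-2)`. The contraction is for `E (X - Y)^2`, through fourth roots of the
odds. Squares of products of these factorize over the children, and first-order terms cancel because
`X` and `Y` have mean zero. This leaves a factor of order `(w + w^2) e^(-w/4)` with `w = θ^2 d`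
(`setIntegral_sq_sub_succ_le`). -/

noncomputable section

namespace GWBroadcast

/-! ### Signs, and the configuration seen from a vertex. -/

section

variable {E : Type*}

/-- The sign `1` or `-1` encoded by a flip indicator. -/
def sgn (b : Bool) : ℝ := if b then -1 else 1

@[simp] lemma sgn_true : sgn true = -1 := rfl

@[simp] lemma sgn_false : sgn false = 1 := rfl

lemma sgn_xor (a b : Bool) : sgn (xor a b) = sgn a * sgn b := by
  cases a <;> cases b <;> simp

lemma sgn_mul_self (b : Bool) : sgn b * sgn b = 1 := by
  cases b <;> simp

lemma abs_sgn (b : Bool) : |sgn b| = 1 := by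
  cases b <;> simp

lemma sgn_not (b : Bool) : sgn (!b) = -sgn b := by
  cases b <;> simp

/-- The configuration seen from the child `i` of the root, the indicator at its root recording the
label of that child. -/
def sub (i : ℕ) (ω : Config E) : Config E
  | [] => ((ω [i]).1, xor (ω []).2.1 (ω [i]).2.1, (ω [i]).2.2)
  | j :: w => ω (i :: j :: w)

/-- The configuration seen from `u`, the indicator at its root recording the label of `u`. -/
def sh : List ℕ → Config E → Config E
  | [], ω => ω
  | i :: u, ω => sh u (sub i ω)

lemma sh_append_singleton (u : List ℕ) (i : ℕ) (ω : Config E) :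
    sh (u ++ [i]) ω = sub i (sh u ω) := by
  induction u generalizing ω with
  | nil => rfl
  | cons j u ih => exact ih _

lemma label_eq_prod (ω : Config E) (v : List ℕ) :
    label ω v = (v.inits.map fun p => sgn (ω p).2.1).prod := rfl

lemma label_nil (ω : Config E) : label ω [] = sgn (ω []).2.1 := by
  simp [label_eq_prod]

lemma label_sub (i : ℕ) (ω : Config E) (w : List ℕ) : label (sub i ω) w = label ω (i :: w) := by
  rw [label_eq_prod, label_eq_prod]
  cases w with
  | nil => simp [sub, sgn_xor]
  | cons j w =>
    simp only [List.inits_cons, List.map_cons, List.map_map, List.prod_cons]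
    rw [← mul_assoc, sub, sgn_xor]
    rfl

lemma label_sh (u : List ℕ) (ω : Config E) (w : List ℕ) : label (sh u ω) w = label ω (u ++ w) := by
  induction u generalizing ω with
  | nil => rfl
  | cons i u ih => rw [sh, ih, label_sub]; rfl

lemma offspring_sub (i : ℕ) (ω : Config E) (w : List ℕ) :
    offspring (sub i ω) w = offspring ω (i :: w) := by
  cases w <;> rfl

lemma offspring_sh (u : List ℕ) (ω : Config E) (w : List ℕ) :
    offspring (sh u ω) w = offspring ω (u ++ w) := by
  induction u generalizing ω with
  | nil => rfl
  | cons i u ih => rw [sh, ih, offspring_sub]; rfl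

lemma noise_sub (i : ℕ) (ω : Config E) (w : List ℕ) :
    noise (sub i ω) w = noise ω (i :: w) := by
  cases w <;> rfl

lemma noise_sh (u : List ℕ) (ω : Config E) (w : List ℕ) :
    noise (sh u ω) w = noise ω (u ++ w) := by
  induction u generalizing ω with
  | nil => rfl
  | cons i u ih => rw [sh, ih, noise_sub]; rfl

lemma inTree_congr_shift {D D' : List ℕ → ℕ} (u u' w : List ℕ)
    (h : ∀ v, D (u ++ v) = D' (u' ++ v)) : InTree D u w ↔ InTree D' u' w := by
  induction w generalizing u u' with
  | nil => simp [InTree]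
  | cons i w ih =>
    simp only [InTree]
    have h0 := h []
    simp only [List.append_nil] at h0
    rw [h0, ih (u ++ [i]) (u' ++ [i])]
    intro v
    simpa using h (i :: v)

lemma inTree_sh (u : List ℕ) (ω : Config E) (w : List ℕ) :
    InTree (offspring (sh u ω)) [] w ↔ InTree (offspring ω) u w :=
  inTree_congr_shift _ _ _ fun v => by simpa using offspring_sh u ω v

lemma inTree_cons (ω : Config E) (i : ℕ) (w : List ℕ) :
    InTree (offspring ω) [] (i :: w) ↔
      i < offspring ω [] ∧ InTree (offspring (sub i ω)) [] w := by
  simp only [InTree, List.nil_append]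
  rw [← inTree_sh [i] ω w]
  rfl

lemma levelLabels_sh (u : List ℕ) (k : ℕ) (ω : Config E) :
    levelLabels [] k (sh u ω) = levelLabels u k ω := by
  ext w
  unfold levelLabels
  congr 1
  · rw [inTree_sh]
  · simp [label_sh]

/-- Statements about the vertex `u` become statements about the root once `sh u` is known to
preserve the law; this and the next two lemmas carry the information available at `u` across. -/
lemma treeAlg_eq_comap_sh (u : List ℕ) :
    (treeAlg u : MeasurableSpace (Config E)) = (treeAlg []).comap (sh u) := by
  simp only [treeAlg, MeasurableSpace.comap_comp]
  congr 1
  ext ω w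
  simp [inTree_sh]

lemma obsAlg_eq_comap_sh (u : List ℕ) (k : ℕ) :
    (obsAlg u k : MeasurableSpace (Config E)) = (obsAlg [] k).comap (sh u) := by
  rw [obsAlg, obsAlg, MeasurableSpace.comap_sup, ← treeAlg_eq_comap_sh,
    MeasurableSpace.comap_comp]
  congr 2
  ext ω w
  simp [levelLabels_sh]

lemma noiseAlg_eq_comap_sh [MeasurableSpace E] (u : List ℕ) :
    (noiseAlg u : MeasurableSpace (Config E)) = (noiseAlg []).comap (sh u) := by
  simp only [noiseAlg, MeasurableSpace.comap_comp]
  congr 1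
  ext ω w
  simp [noise_sh]

end

/-! ### Measurability of the shifts and of the observation σ-algebras. -/

section

variable {E : Type*} [MeasurableSpace E]

lemma measurable_sub (i : ℕ) : Measurable (sub i : Config E → Config E) := by
  rw [measurable_pi_iff]
  rintro (_ | ⟨j, w⟩)
  · simp only [sub]
    have h : Measurable fun p : Bool × Bool => xor p.1 p.2 := measurable_of_countable _
    refine Measurable.prodMk (by fun_prop) (Measurable.prodMk ?_ (by fun_prop))
    exact h.comp (Measurable.prodMk (by fun_prop) (by fun_prop))
  · exact measurable_pi_apply _

lemma measurable_sh (u : List ℕ) : Measurable (sh u : Config E → Config E) := by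
  induction u with
  | nil => exact measurable_id
  | cons i u ih => exact ih.comp (measurable_sub i)

lemma measurable_sgn : Measurable sgn := measurable_of_countable _

lemma measurable_label (w : List ℕ) : Measurable fun ω : Config E => label ω w := by
  have : (fun ω : Config E => label ω w) = fun ω => label (sh w ω) [] := by
    ext ω; simp [label_sh]
  rw [this]
  simp only [label_nil]
  exact measurable_sgn.comp ((measurable_snd.comp
    ((measurable_pi_apply ([] : List ℕ)).comp (measurable_sh w))).fst)

lemma measurable_offspring (w : List ℕ) : Measurable fun ω : Config E => offspring ω w :=
  (measurable_pi_apply w).fst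

lemma measurableSet_inTree (u w : List ℕ) :
    MeasurableSet {ω : Config E | InTree (offspring ω) u w} := by
  induction w generalizing u with
  | nil => simp [InTree]
  | cons i w ih =>
    simp only [InTree, Set.ofPred_and]
    exact (measurableSet_lt measurable_const (measurable_offspring u)).inter (ih _)

lemma treeAlg_le (u : List ℕ) : treeAlg u ≤ (inferInstance : MeasurableSpace (Config E)) := by
  rw [treeAlg, ← measurable_iff_comap_le, measurable_pi_iff]
  exact fun w => measurable_to_prop (by simpa [Set.preimage] using measurableSet_inTree u w)

lemma measurable_levelLabels (u : List ℕ) (k : ℕ) :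
    Measurable (levelLabels u k : Config E → List ℕ → ℝ) := by
  rw [measurable_pi_iff]
  intro w
  refine Measurable.ite ?_ (measurable_label _) measurable_const
  exact (MeasurableSet.const _).inter (measurableSet_inTree u w)

lemma obsAlg_le (u : List ℕ) (k : ℕ) :
    obsAlg u k ≤ (inferInstance : MeasurableSpace (Config E)) :=
  sup_le (treeAlg_le u) (measurable_levelLabels u k).comap_le

lemma noiseAlg_le (u : List ℕ) : noiseAlg u ≤ (inferInstance : MeasurableSpace (Config E)) := by
  rw [noiseAlg, ← measurable_iff_comap_le, measurable_pi_iff]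
  exact fun w => (measurable_pi_apply _).snd.snd

end

/-! ### Product measures on strings, split into the root and the subtrees of its children. -/

section

open Measure

variable {X : Type*} [MeasurableSpace X]

/-- The family of measures on strings that is `ρ` at the root and `κ` elsewhere. -/
def siteFamily (ρ κ : Measure X) : List ℕ → Measure X
  | [] => ρ
  | _ :: _ => κ

instance (ρ κ : Measure X) [IsProbabilityMeasure ρ] [IsProbabilityMeasure κ] (v : List ℕ) :
    IsProbabilityMeasure (siteFamily ρ κ v) := by
  cases v <;> simp only [siteFamily] <;> infer_instance

/-- The configuration with the given root and the given configurations below the children. -/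
def graft (p : X × (ℕ → List ℕ → X)) : List ℕ → X
  | [] => p.1
  | i :: w => p.2 i w

lemma measurable_graft : Measurable (graft : X × (ℕ → List ℕ → X) → List ℕ → X) := by
  rw [measurable_pi_iff]
  rintro (_ | ⟨i, w⟩)
  · exact measurable_fst
  · exact (measurable_pi_apply w).comp ((measurable_pi_apply i).comp measurable_snd)

/-- A nonempty string is a pair of a first letter and a string, so both sides give a cylinder the
same finite product of masses; equality on cylinders is enough. -/
lemma map_graft (ρ κ : Measure X) [IsProbabilityMeasure ρ] [IsProbabilityMeasure κ] :
    (ρ.prod (infinitePi fun _ : ℕ => infinitePi fun _ : List ℕ => κ)).map graft =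
      infinitePi (siteFamily ρ κ) := by
  classical
  refine eq_infinitePi _ fun s t ht => ?_
  let e : ℕ × List ℕ → List ℕ := fun p => p.1 :: p.2
  have he : Function.Injective e := by
    rintro ⟨i, w⟩ ⟨j, v⟩ h
    simpa [e] using h
  let s' : Finset (ℕ × List ℕ) := s.preimage e he.injOn
  let A : Set X := if [] ∈ s then t [] else Set.univ
  let B : Set (ℕ → List ℕ → X) := {c | ∀ p ∈ s', c p.1 p.2 ∈ t (e p)}
  have hB : MeasurableSet B := by
    have : B = ⋂ p ∈ s', (fun c : ℕ → List ℕ → X => c p.1 p.2) ⁻¹' t (e p) := by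
      ext c; simp [B]
    rw [this]
    refine Finset.measurableSet_biInter _ fun p _ => ?_
    exact ((measurable_pi_apply p.2).comp (measurable_pi_apply p.1)) (ht _)
  have hpre : graft ⁻¹' (Set.pi s t) = A ×ˢ B := by
    ext ⟨r, c⟩
    simp only [Set.mem_preimage, Set.mem_pi, Finset.mem_coe, Set.mem_prod]
    constructor
    · intro h
      refine ⟨?_, fun p hp => ?_⟩
      · by_cases h0 : [] ∈ s
        · simpa [A, h0, graft] using h [] h0
        · simp [A, h0]
      · exact h (e p) (by simpa [s'] using hp)
    · rintro ⟨h1, h2⟩ (_ | ⟨i, w⟩) hv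
      · simpa [A, hv, graft] using h1
      · exact h2 (i, w) (by simpa [s', e] using hv)
  rw [map_apply measurable_graft (MeasurableSet.pi (Finset.countable_toSet _) fun i _ => ht i),
    hpre, prod_prod, ← infinitePi_map_curry (fun (_ : ℕ) (_ : List ℕ) => κ),
    map_apply (MeasurableEquiv.measurable _) hB]
  have hcur : (MeasurableEquiv.curry ℕ (List ℕ) X) ⁻¹' B = Set.pi s' fun p => t (e p) := by
    ext c
    simp [B, Set.mem_pi]
  rw [hcur, infinitePi_pi _ fun p _ => ht _]
  have himg : s.erase [] = s'.image e := by
    ext v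
    cases v with
    | nil => simp [e]
    | cons i w => simp [s', e]
  have h2 : ∏ p ∈ s', κ (t (e p)) = ∏ v ∈ s.erase [], siteFamily ρ κ v (t v) := by
    rw [himg, Finset.prod_image fun p _ q _ h => he h]
    rfl
  rw [h2]
  by_cases h0 : [] ∈ s
  · rw [← Finset.mul_prod_erase s _ h0]
    simp [A, h0, siteFamily]
  · simp [A, h0]

lemma infinitePi_siteFamily_self (κ : Measure X) [IsProbabilityMeasure κ] :
    infinitePi (siteFamily κ κ) = infinitePi fun _ : List ℕ => κ := by
  congr 1
  ext v : 1
  cases v <;> rfl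

lemma map_withDensity_comp {α β : Type*} [MeasurableSpace α] [MeasurableSpace β] (μ : Measure α)
    {T : α → β} (hT : Measurable T) {f : β → ENNReal} (hf : Measurable f) :
    (μ.withDensity (f ∘ T)).map T = (μ.map T).withDensity f := by
  ext A hA
  rw [map_apply hT hA, withDensity_apply _ (hT hA), withDensity_apply _ hA,
    setLIntegral_map hA hf hT]
  rfl

lemma infinitePi_siteFamily_withDensity (ρ κ : Measure X) [IsProbabilityMeasure ρ]
    [IsProbabilityMeasure κ] {f : X → ENNReal} (hf : Measurable f)
    [IsProbabilityMeasure (ρ.withDensity f)] :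
    infinitePi (siteFamily (ρ.withDensity f) κ) =
      (infinitePi (siteFamily ρ κ)).withDensity fun ω => f (ω []) := by
  rw [← map_graft, ← map_graft, prod_withDensity_left hf]
  have hf' : Measurable fun ω : List ℕ → X => f (ω []) := by fun_prop
  rw [← map_withDensity_comp _ measurable_graft hf']
  congr 1

lemma infinitePi_siteFamily_map_root (ρ κ : Measure X) [IsProbabilityMeasure ρ]
    [IsProbabilityMeasure κ] {f : X → X} (hf : Measurable f)
    [IsProbabilityMeasure (ρ.map f)] :
    (infinitePi (siteFamily ρ κ)).map (fun ω v => if v = [] then f (ω v) else ω v) =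
      infinitePi (siteFamily (ρ.map f) κ) := by
  have h := infinitePi_map_pi (μ := siteFamily ρ κ)
    (f := fun (v : List ℕ) (x : X) => if v = [] then f x else x)
    (fun v => by split_ifs <;> fun_prop)
  rw [h]
  congr 1
  ext v : 1
  cases v <;> simp [siteFamily]

end

/-! ### The Markov property of the broadcast process. -/

section

open Measure

variable {E : Type*} [MeasurableSpace E]

instance (η : I) (v : List ℕ) : IsProbabilityMeasure (flipLaw η v) := by
  unfold flipLaw; infer_instance

instance (d : ℝ≥0) (η : I) (ν : Measure E) [IsProbabilityMeasure ν] :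
    IsProbabilityMeasure (law d η ν) := by
  unfold law; infer_instance

/-- The law of the data at a vertex whose flip indicator has law `β`. -/
def siteLaw (d : ℝ≥0) (ν : Measure E) (β : Measure Bool) : Measure (ℕ × Bool × E) :=
  (poissonMeasure d).prod (β.prod ν)

instance (d : ℝ≥0) (ν : Measure E) [IsProbabilityMeasure ν] (β : Measure Bool)
    [IsProbabilityMeasure β] : IsProbabilityMeasure (siteLaw d ν β) := by
  unfold siteLaw; infer_instance

/-- The law of a fair flip indicator. -/
def fairLaw : Measure Bool := bernoulliMeasure true false ⟨1 / 2, by norm_num, by norm_num⟩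

instance : IsProbabilityMeasure fairLaw := by
  unfold fairLaw; infer_instance

lemma law_eq_siteFamily (d : ℝ≥0) (η : I) (ν : Measure E) [IsProbabilityMeasure ν] :
    law d η ν = infinitePi
      (siteFamily (siteLaw d ν fairLaw) (siteLaw d ν (bernoulliMeasure true false η))) := by
  unfold law
  congr 1
  ext v : 1
  cases v <;> simp [siteFamily, siteLaw, flipLaw, fairLaw]

lemma bernoulliMeasure_true_false_singleton (η : I) (b : Bool) :
    bernoulliMeasure true false η {b} = ENNReal.ofReal (if b then (η : ℝ) else 1 - η) := by
  rw [← ofReal_measureReal (by finiteness)]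
  cases b
  · rw [bernoulliMeasure_real_apply_of_notMem_of_mem _ (by simp) (by simp) (by simp)]
    simp
  · rw [bernoulliMeasure_real_apply_of_mem_of_notMem _ (by simp) (by simp) (by simp)]
    simp

lemma fairLaw_singleton (b : Bool) : fairLaw {b} = ENNReal.ofReal (1 / 2) := by
  rw [fairLaw, bernoulliMeasure_true_false_singleton]
  congr 1
  cases b <;> norm_num

/-- Given the parent label, a child has label `sgn c` with probability `(1 + sgn b * θ * sgn c) /
2`, which is the fair weight times the stated density. -/
lemma map_xor_bernoulliMeasure (η : I) (b : Bool) :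
    (bernoulliMeasure true false η).map (xor b) =
      fairLaw.withDensity fun c => ENNReal.ofReal (1 + sgn b * theta η * sgn c) := by
  have h0 := η.2.1
  have h1 := η.2.2
  refine Measure.ext_of_singleton fun c => ?_
  rw [withDensity_apply _ (by simp), lintegral_singleton, fairLaw_singleton,
    map_apply (measurable_of_countable _) (by simp),
    ← ENNReal.ofReal_mul (by cases b <;> cases c <;> simp [theta] <;> linarith)]
  have hpre : (xor b) ⁻¹' {c} = {xor b c} := by
    ext x; cases b <;> cases c <;> cases x <;> simp
  rw [hpre, bernoulliMeasure_true_false_singleton]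
  congr 1
  cases b <;> cases c <;> simp [theta] <;> ring

lemma siteLaw_map_xor (d : ℝ≥0) (η : I) (ν : Measure E) [IsProbabilityMeasure ν] (b : Bool) :
    (siteLaw d ν (bernoulliMeasure true false η)).map (fun x => (x.1, xor b x.2.1, x.2.2)) =
      (siteLaw d ν fairLaw).withDensity
        fun x => ENNReal.ofReal (1 + sgn b * theta η * sgn x.2.1) := by
  have hx : Measurable (xor b) := measurable_of_countable _
  have hf : Measurable fun c => ENNReal.ofReal (1 + sgn b * theta η * sgn c) :=
    measurable_of_countable _
  have := isProbabilityMeasure_map (μ := bernoulliMeasure true false η) hx.aemeasurable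
  have h1 : (siteLaw d ν (bernoulliMeasure true false η)).map
      (fun x => (x.1, xor b x.2.1, x.2.2)) =
      siteLaw d ν ((bernoulliMeasure true false η).map (xor b)) := by
    have h2 := map_prod_map (poissonMeasure d) ((bernoulliMeasure true false η).prod ν)
      measurable_id (hx.prodMap measurable_id)
    rw [← map_prod_map _ _ hx measurable_id, Measure.map_id, Measure.map_id] at h2
    rw [siteLaw, siteLaw, h2]
    rfl
  rw [h1, map_xor_bernoulliMeasure] at *
  rw [siteLaw, siteLaw, prod_withDensity_left hf, prod_withDensity_right (by fun_prop)]

/-- The law of the configuration seen from a child of the root, given the label of the root. -/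
def childLaw (d : ℝ≥0) (η : I) (ν : Measure E) (b : Bool) : Measure (Config E) :=
  (law d η ν).withDensity fun ω => ENNReal.ofReal (1 + sgn b * theta η * label ω [])

/-- The configuration whose root label is flipped if `b` is true. -/
def twist (b : Bool) (ω : Config E) : Config E :=
  fun v => if v = [] then ((ω v).1, xor b (ω v).2.1, (ω v).2.2) else ω v

lemma measurable_twist (b : Bool) : Measurable (twist b : Config E → Config E) := by
  have hx : Measurable (xor b) := measurable_of_countable _
  rw [measurable_pi_iff]
  intro v
  unfold twist
  split_ifs
  · exact Measurable.prodMk (by fun_prop) (Measurable.prodMk (hx.comp (by fun_prop)) (by fun_prop))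
  · fun_prop

lemma measurable_xor_site (b : Bool) :
    Measurable fun x : ℕ × Bool × E => (x.1, xor b x.2.1, x.2.2) := by
  have hx : Measurable (xor b) := measurable_of_countable _
  exact Measurable.prodMk (by fun_prop) (Measurable.prodMk (hx.comp (by fun_prop)) (by fun_prop))

/-- Below a child all sites, its own included, carry `η`-flips. Multiplying the flip at the child by
the label of its parent turns it into the label of the child, and only the root site acquires a
density. -/
lemma map_twist_site (d : ℝ≥0) (η : I) (ν : Measure E) [IsProbabilityMeasure ν] (b : Bool) :
    (infinitePi fun _ : List ℕ => siteLaw d ν (bernoulliMeasure true false η)).map (twist b) =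
      childLaw d η ν b := by
  have := isProbabilityMeasure_map
    (μ := siteLaw d ν (bernoulliMeasure true false η)) (measurable_xor_site (E := E) b).aemeasurable
  have h := infinitePi_siteFamily_map_root (siteLaw d ν (bernoulliMeasure true false η))
    (siteLaw d ν (bernoulliMeasure true false η)) (measurable_xor_site b)
  rw [infinitePi_siteFamily_self] at h
  rw [siteLaw_map_xor] at this
  unfold twist
  rw [h, childLaw, law_eq_siteFamily]
  simp only [siteLaw_map_xor, label_nil]
  exact infinitePi_siteFamily_withDensity _ _ (by
    have := measurable_sgn
    fun_prop)

instance (d : ℝ≥0) (η : I) (ν : Measure E) [IsProbabilityMeasure ν] (b : Bool) :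
    IsProbabilityMeasure (childLaw d η ν b) := by
  rw [← map_twist_site]
  exact isProbabilityMeasure_map (measurable_twist b).aemeasurable

/-- Given the data at the root, the configurations seen from its children are independent. -/
lemma map_sub_restrict (d : ℝ≥0) (η : I) (ν : Measure E) [IsProbabilityMeasure ν] (b : Bool)
    (N : Set ℕ) {B : Set E} (hB : MeasurableSet B) :
    ((law d η ν).restrict
        {ω | flipped ω [] = b ∧ offspring ω [] ∈ N ∧ noise ω [] ∈ B}).map (fun ω i => sub i ω) =
      (ENNReal.ofReal (1 / 2) * poissonMeasure d N * ν B) •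
        infinitePi fun _ : ℕ => childLaw d η ν b := by
  have hsub : Measurable fun (ω : Config E) (i : ℕ) => sub i ω :=
    measurable_pi_iff.2 fun i => measurable_sub i
  have htw : Measurable fun (c : ℕ → Config E) (i : ℕ) => twist b (c i) :=
    measurable_pi_iff.2 fun i => (measurable_twist b).comp (measurable_pi_apply i)
  ext A hA
  have hS : MeasurableSet (N ×ˢ ({b} ×ˢ B) : Set (ℕ × Bool × E)) := by measurability
  have hset : {ω : Config E | flipped ω [] = b ∧ offspring ω [] ∈ N ∧ noise ω [] ∈ B} =
      (fun ω : Config E => ω []) ⁻¹' (N ×ˢ ({b} ×ˢ B)) := by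
    ext ω
    simp [flipped, offspring, noise]
    tauto
  rw [map_apply hsub hA, restrict_apply (hsub hA), hset, law_eq_siteFamily, ← map_graft,
    map_apply measurable_graft ((hsub hA).inter ((measurable_pi_apply _) hS))]
  have hpre : graft ⁻¹' ((fun (ω : Config E) (i : ℕ) => sub i ω) ⁻¹' A ∩
      (fun ω : Config E => ω []) ⁻¹' (N ×ˢ ({b} ×ˢ B))) =
      (N ×ˢ ({b} ×ˢ B)) ×ˢ ((fun (c : ℕ → Config E) (i : ℕ) => twist b (c i)) ⁻¹' A) := by
    ext ⟨⟨n', b', e⟩, c⟩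
    simp only [Set.mem_preimage, Set.mem_inter_iff, graft, Set.mem_prod, Set.mem_singleton_iff]
    rw [and_comm]
    refine and_congr_right fun h => ?_
    -- When the root indicator is `b`, looking from child `i` amounts to twisting the `i`-th grafted
    -- subtree by `b`.
    have : (fun i : ℕ => sub i (graft (((n', b', e) : ℕ × Bool × E), c))) =
        fun i => twist b (c i) := by
      ext1 i
      ext1 w
      cases w <;> simp [sub, graft, twist, h.2.1]
    rw [this]
  rw [hpre, prod_prod, Measure.smul_apply, ← map_apply htw hA,
    infinitePi_map_pi _ (f := fun (_ : ℕ) => twist b) (fun _ : ℕ => measurable_twist b)]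
  simp only [map_twist_site]
  simp only [siteLaw, prod_prod, fairLaw_singleton, smul_eq_mul]
  ring

lemma map_sub_restrict_flipped (d : ℝ≥0) (η : I) (ν : Measure E) [IsProbabilityMeasure ν]
    (b : Bool) (i : ℕ) :
    ((law d η ν).restrict {ω | flipped ω [] = b}).map (sub i) =
      ENNReal.ofReal (1 / 2) • childLaw d η ν b := by
  have h := map_sub_restrict d η ν b Set.univ (B := Set.univ) .univ
  have hsub : Measurable fun (ω : Config E) (i : ℕ) => sub i ω :=
    measurable_pi_iff.2 fun i => measurable_sub i
  have h2 := congrArg (fun m => m.map (fun c : ℕ → Config E => c i)) h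
  simp only [Measure.map_smul, infinitePi_map_eval] at h2
  rw [map_map (measurable_pi_apply i) hsub] at h2
  simpa [Function.comp_def] using h2

lemma measurableSet_flipped (b : Bool) : MeasurableSet {ω : Config E | flipped ω [] = b} :=
  (measurable_pi_apply (X := fun _ : List ℕ => ℕ × Bool × E) []).snd.fst (measurableSet_singleton b)

/-- The densities `1 ± θσ` average to 1. Hence the unconditioned law seen from a child is again
`law`, which is what makes all shifts measure preserving. -/
lemma childLaw_add (d : ℝ≥0) (η : I) (ν : Measure E) [IsProbabilityMeasure ν] :
    ENNReal.ofReal (1 / 2) • childLaw d η ν true + ENNReal.ofReal (1 / 2) • childLaw d η ν false =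
      law d η ν := by
  have hm : ∀ b, Measurable fun ω : Config E =>
      ENNReal.ofReal (1 + sgn b * theta η * label ω []) := fun b =>
    (((measurable_label []).const_mul _).const_add _).ennreal_ofReal
  have h0 := η.2.1
  have h1 := η.2.2
  rw [childLaw, childLaw, ← withDensity_smul _ (hm _), ← withDensity_smul _ (hm _),
    ← withDensity_add_left ((hm _).const_smul _)]
  convert withDensity_one using 2
  ext ω
  simp only [Pi.add_apply, Pi.smul_apply, smul_eq_mul, Pi.one_apply, label_nil]
  rw [← ENNReal.ofReal_mul (by norm_num), ← ENNReal.ofReal_mul (by norm_num),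
    ← ENNReal.ofReal_add]
  · rw [← ENNReal.ofReal_one]
    congr 1
    simp
    ring
  all_goals cases (ω []).2.1 <;> simp [theta] <;> linarith

lemma measurePreserving_sub (d : ℝ≥0) (η : I) (ν : Measure E) [IsProbabilityMeasure ν] (i : ℕ) :
    MeasurePreserving (sub i) (law d η ν) (law d η ν) := by
  refine ⟨measurable_sub i, ?_⟩
  have hc : {ω : Config E | flipped ω [] = true}ᶜ = {ω | flipped ω [] = false} := by
    ext; simp
  conv_lhs => rw [← restrict_add_restrict_compl (μ := law d η ν)
    (measurableSet_flipped (E := E) true), hc]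
  rw [Measure.map_add _ _ (measurable_sub i), map_sub_restrict_flipped,
    map_sub_restrict_flipped, childLaw_add]

lemma measurePreserving_sh (d : ℝ≥0) (η : I) (ν : Measure E) [IsProbabilityMeasure ν]
    (u : List ℕ) : MeasurePreserving (sh u) (law d η ν) (law d η ν) := by
  induction u with
  | nil => exact MeasurePreserving.id _
  | cons i u ih => exact ih.comp (measurePreserving_sub d η ν i)

/-- Reversing all labels preserves the law of the process. -/
lemma measurePreserving_twist (d : ℝ≥0) (η : I) (ν : Measure E) [IsProbabilityMeasure ν]
    (b : Bool) : MeasurePreserving (twist b) (law d η ν) (law d η ν) := by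
  refine ⟨measurable_twist b, ?_⟩
  have hx : Measurable (xor b) := measurable_of_countable _
  have hfair : fairLaw.map (xor b) = fairLaw := by
    refine Measure.ext_of_singleton fun c => ?_
    rw [map_apply hx (by simp)]
    have hpre : (xor b) ⁻¹' {c} = {xor b c} := by
      ext x; cases b <;> cases c <;> cases x <;> simp
    rw [hpre, fairLaw_singleton, fairLaw_singleton]
  have hs : (siteLaw d ν fairLaw).map (fun x => (x.1, xor b x.2.1, x.2.2)) =
      siteLaw d ν fairLaw := by
    have h2 := map_prod_map (poissonMeasure d) (fairLaw.prod ν)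
      measurable_id (hx.prodMap measurable_id)
    rw [← map_prod_map _ _ hx measurable_id, Measure.map_id, Measure.map_id, hfair] at h2
    exact h2.symm
  have := isProbabilityMeasure_map
    (μ := siteLaw d ν fairLaw) (measurable_xor_site (E := E) b).aemeasurable
  have h := infinitePi_siteFamily_map_root (siteLaw d ν fairLaw)
    (siteLaw d ν (bernoulliMeasure true false η)) (measurable_xor_site b)
  unfold twist
  rw [law_eq_siteFamily, h]
  simp only [hs]

end

/-! ### Product densities, and the subtrees given the root label and the number of children. -/

section

open Measure

lemma measurable_nat_comp {Ω β : Type*} [MeasurableSpace Ω] [MeasurableSpace β] {D : Ω → ℕ}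
    (hD : Measurable D) {F : ℕ → Ω → β} (hF : ∀ n, Measurable (F n)) :
    Measurable fun ω => F (D ω) ω :=
  (measurable_from_prod_countable_right (f := fun p : ℕ × Ω => F p.1 p.2) hF).comp
    (hD.prodMk measurable_id)

/-- On a cylinder, the indicator times the density is a finite product of functions of separate
coordinates; independence factorizes its integral, and coordinates outside the cylinder contribute
total mass 1. -/
lemma infinitePi_withDensity {X : Type*} [MeasurableSpace X] (s : Finset ℕ) (ρ : ℕ → Measure X)
    [∀ i, IsProbabilityMeasure (ρ i)] (f : ℕ → X → ENNReal) (hf : ∀ i, Measurable (f i))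
    (h1 : ∀ i ∉ s, f i = 1) [∀ i, IsProbabilityMeasure ((ρ i).withDensity (f i))] :
    infinitePi (fun i => (ρ i).withDensity (f i)) =
      (infinitePi ρ).withDensity fun c => ∏ i ∈ s, f i (c i) := by
  classical
  symm
  refine eq_infinitePi _ fun u t ht => ?_
  have hA : MeasurableSet (Set.pi (u : Set ℕ) t) :=
    MeasurableSet.pi (Finset.countable_toSet _) fun i _ => ht i
  let h : ℕ → X → ENNReal := fun i x => if i ∈ u then (t i).indicator (f i) x else f i x
  have hh : ∀ i, Measurable (h i) := by
    intro i
    by_cases hi : i ∈ u <;> simp only [h, hi, if_true, if_false]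
    · exact (hf i).indicator (ht i)
    · exact hf i
  have hX : iIndepFun (fun (i : ℕ) (c : ℕ → X) => h i (c i)) (infinitePi ρ) :=
    iIndepFun_infinitePi hh
  have hprod : ∀ c : ℕ → X, (Set.pi (u : Set ℕ) t).indicator (fun c => ∏ i ∈ s, f i (c i)) c =
      ∏ i ∈ s ∪ u, h i (c i) := by
    intro c
    by_cases hc : c ∈ Set.pi (u : Set ℕ) t
    · rw [Set.indicator_of_mem hc]
      have : ∀ i, h i (c i) = f i (c i) := by
        intro i
        by_cases hi : i ∈ u
        · simp only [h, hi, if_true]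
          exact Set.indicator_of_mem (hc i hi) _
        · simp [h, hi]
      simp only [this]
      refine Finset.prod_subset Finset.subset_union_left fun i _ hi => ?_
      simp [h1 i hi]
    · rw [Set.indicator_of_notMem hc]
      simp only [Set.mem_pi, Finset.mem_coe, not_forall] at hc
      obtain ⟨i, hi, hci⟩ := hc
      symm
      refine Finset.prod_eq_zero (i := i) (by simp [hi]) ?_
      simp only [h, hi, if_true]
      exact Set.indicator_of_notMem hci _
  rw [withDensity_apply _ hA, ← lintegral_indicator hA]
  simp only [hprod]
  rw [lintegral_prod_eq_prod_lintegral_of_indepFun _ _ hX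
    fun i => (hh i).comp (measurable_pi_apply i)]
  have hint : ∀ i, ∫⁻ c, h i (c i) ∂infinitePi ρ = ∫⁻ x, h i x ∂ρ i := by
    intro i
    rw [← infinitePi_map_eval ρ i, lintegral_map (hh i) (measurable_pi_apply i)]
  simp only [hint]
  have hmain : ∀ i, ∫⁻ x, h i x ∂ρ i =
      if i ∈ u then (ρ i).withDensity (f i) (t i) else 1 := by
    intro i
    by_cases hi : i ∈ u
    · simp only [h, hi, if_true]
      rw [lintegral_indicator (ht i), withDensity_apply _ (ht i)]
    · simp only [h, hi, if_false]
      have := measure_univ (μ := (ρ i).withDensity (f i))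
      rwa [withDensity_apply _ .univ, restrict_univ] at this
  simp only [hmain]
  symm
  rw [Finset.prod_ite, Finset.prod_const_one, mul_one]
  congr 1
  ext i
  simp +contextual

variable {E : Type*} [MeasurableSpace E]

/-- The event that the root has flip indicator `b` and `n` children. -/
def rootEvent (b : Bool) (n : ℕ) : Set (Config E) :=
  {ω | flipped ω [] = b ∧ offspring ω [] = n}

lemma measurableSet_rootEvent (b : Bool) (n : ℕ) :
    MeasurableSet (rootEvent b n : Set (Config E)) :=
  (measurableSet_flipped b).inter (measurable_offspring [] (measurableSet_singleton n))

/-- The noise at the root is carried along because the estimators may use it, so the posterior of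
the root label must not change when it is observed. -/
lemma map_noise_sub_restrict (d : ℝ≥0) (η : I) (ν : Measure E) [IsProbabilityMeasure ν]
    (b : Bool) (n : ℕ) :
    ((law d η ν).restrict (rootEvent b n)).map (fun ω => (noise ω [], fun i => sub i ω)) =
      (ENNReal.ofReal (1 / 2) * poissonMeasure d {n}) •
        ν.prod (infinitePi fun _ : ℕ => childLaw d η ν b) := by
  have hsub : Measurable fun (ω : Config E) (i : ℕ) => sub i ω :=
    measurable_pi_iff.2 fun i => measurable_sub i
  have hnoise : Measurable fun ω : Config E => noise ω [] := (measurable_pi_apply _).snd.snd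
  refine Measure.ext_prod fun {B A} hB hA => ?_
  have h := congrArg (fun m => m A) (map_sub_restrict d η ν b {n} hB)
  rw [map_apply hsub hA, restrict_apply (hsub hA)] at h
  rw [map_apply (hnoise.prodMk hsub) (hB.prod hA),
    restrict_apply ((hnoise.prodMk hsub) (hB.prod hA)), Measure.smul_apply, prod_prod]
  rw [Measure.smul_apply] at h
  simp only [smul_eq_mul] at h ⊢
  rw [← mul_assoc, ← h]
  congr 1
  ext ω
  simp [rootEvent]
  tauto

lemma map_sub_restrict_rootEvent (d : ℝ≥0) (η : I) (ν : Measure E) [IsProbabilityMeasure ν]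
    (b : Bool) (n : ℕ) :
    ((law d η ν).restrict (rootEvent b n)).map (fun ω i => sub i ω) =
      (ENNReal.ofReal (1 / 2) * poissonMeasure d {n}) •
        infinitePi fun _ : ℕ => childLaw d η ν b := by
  have h := map_sub_restrict d η ν b {n} (B := Set.univ) .univ
  simpa [rootEvent] using h

lemma setLIntegral_rootEvent_prod (d : ℝ≥0) (η : I) (ν : Measure E) [IsProbabilityMeasure ν]
    (b : Bool) (n : ℕ) (s : Finset ℕ) (h : ℕ → Config E → ENNReal) (hh : ∀ i, Measurable (h i)) :
    ∫⁻ ω in rootEvent b n, ∏ i ∈ s, h i (sub i ω) ∂law d η ν =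
      ENNReal.ofReal (1 / 2) * poissonMeasure d {n} *
        ∏ i ∈ s, ∫⁻ ω, h i ω ∂childLaw d η ν b := by
  have hsub : Measurable fun (ω : Config E) (i : ℕ) => sub i ω :=
    measurable_pi_iff.2 fun i => measurable_sub i
  rw [← lintegral_map (f := fun c : ℕ → Config E => ∏ i ∈ s, h i (c i)) (by fun_prop) hsub,
    map_sub_restrict_rootEvent, lintegral_smul_measure,
    lintegral_prod_eq_prod_lintegral_of_indepFun s (fun i (c : ℕ → Config E) => h i (c i))
      (iIndepFun_infinitePi hh) fun i => (hh i).comp (measurable_pi_apply i), smul_eq_mul]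
  congr 1
  refine Finset.prod_congr rfl fun i _ => ?_
  rw [← lintegral_map (f := h i) (hh i) (measurable_pi_apply i)]
  congr 1
  exact infinitePi_map_eval _ i

lemma setIntegral_rootEvent_prod (d : ℝ≥0) (η : I) (ν : Measure E) [IsProbabilityMeasure ν]
    (b : Bool) (n : ℕ) (h : ℕ → Config E → ℝ) (hh : ∀ i, Measurable (h i)) :
    ∫ ω in rootEvent b n, ∏ i ∈ Finset.range n, h i (sub i ω) ∂law d η ν =
      1 / 2 * (poissonMeasure d).real {n} *
        ∏ i ∈ Finset.range n, ∫ ω, h i ω ∂childLaw d η ν b := by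
  have hsub : Measurable fun (ω : Config E) (i : ℕ) => sub i ω :=
    measurable_pi_iff.2 fun i => measurable_sub i
  rw [← integral_map (f := fun c : ℕ → Config E => ∏ i ∈ Finset.range n, h i (c i))
      hsub.aemeasurable (by
        refine Measurable.aestronglyMeasurable ?_
        fun_prop),
    map_sub_restrict_rootEvent, integral_smul_measure]
  have h1 := integral_restrict_infinitePi (μ := fun _ : ℕ => childLaw d η ν b)
    (s := Finset.range n) (f := fun y => ∏ i : Finset.range n, h i (y i)) (by
        refine Measurable.aestronglyMeasurable ?_
        exact Finset.measurable_prod _ fun i _ => (hh i).comp (measurable_pi_apply i))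
  simp only [Finset.restrict] at h1
  rw [integral_fintype_prod_eq_prod (fun (i : Finset.range n) => h i)] at h1
  have h2 : ∀ c : ℕ → Config E, ∏ i ∈ Finset.range n, h i (c i) =
      ∏ i : Finset.range n, h i (c i) := fun c => (Finset.prod_coe_sort _ fun i => h i (c i)).symm
  simp only [h2]
  rw [h1, Finset.prod_coe_sort _ fun i => ∫ ω, h i ω ∂childLaw d η ν b]
  simp [measureReal_def]

end

/-! ### Belief propagation, and the view that forgets the labels above level `k`. -/

section

/-- The belief propagation map, in terms of the messages `t i = θ x_i`. -/
def gmap (n : ℕ) (t : ℕ → ℝ) : ℝ :=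
  (∏ i ∈ Finset.range n, (1 + t i) - ∏ i ∈ Finset.range n, (1 - t i)) /
    (∏ i ∈ Finset.range n, (1 + t i) + ∏ i ∈ Finset.range n, (1 - t i))

lemma gmap_congr {n : ℕ} {t t' : ℕ → ℝ} (h : ∀ i < n, t i = t' i) : gmap n t = gmap n t' := by
  have h1 : ∏ i ∈ Finset.range n, (1 + t i) = ∏ i ∈ Finset.range n, (1 + t' i) :=
    Finset.prod_congr rfl fun i hi => by rw [h i (Finset.mem_range.1 hi)]
  have h2 : ∏ i ∈ Finset.range n, (1 - t i) = ∏ i ∈ Finset.range n, (1 - t' i) :=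
    Finset.prod_congr rfl fun i hi => by rw [h i (Finset.mem_range.1 hi)]
  rw [gmap, gmap, h1, h2]

lemma gmap_neg (n : ℕ) (t : ℕ → ℝ) : gmap n (fun i => -t i) = -gmap n t := by
  unfold gmap
  simp only [sub_neg_eq_add, ← sub_eq_add_neg]
  rw [← neg_div, neg_sub, add_comm]

lemma gmap_sgn (b : Bool) (n : ℕ) (t : ℕ → ℝ) :
    gmap n (fun i => sgn b * t i) = sgn b * gmap n t := by
  cases b <;> simp [gmap_neg]

lemma gmap_prod_nonneg {n : ℕ} {t : ℕ → ℝ} (h : ∀ i < n, |t i| ≤ 1) :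
    0 ≤ ∏ i ∈ Finset.range n, (1 + t i) ∧ 0 ≤ ∏ i ∈ Finset.range n, (1 - t i) :=
  ⟨Finset.prod_nonneg fun i hi => by linarith [(abs_le.1 (h i (Finset.mem_range.1 hi))).1],
    Finset.prod_nonneg fun i hi => by linarith [(abs_le.1 (h i (Finset.mem_range.1 hi))).2]⟩

lemma abs_gmap_le {n : ℕ} {t : ℕ → ℝ} (h : ∀ i < n, |t i| ≤ 1) : |gmap n t| ≤ 1 := by
  obtain ⟨hA, hB⟩ := gmap_prod_nonneg h
  unfold gmap
  rw [abs_div, abs_of_nonneg (add_nonneg hA hB)]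
  refine div_le_one_of_le₀ ?_ (add_nonneg hA hB)
  rw [abs_le]
  constructor <;> linarith

/-- This is Bayes' rule: the products are the likelihoods of the two labels, and `(1 ± gmap) / 2`
their normalized weights. It survives the convention `0/0 = 0`: a vanishing sum of nonnegative
products makes both vanish. -/
lemma one_add_sgn_mul_gmap {n : ℕ} {t : ℕ → ℝ} (h : ∀ i < n, |t i| ≤ 1) (b : Bool) :
    (1 + sgn b * gmap n t) / 2 *
      (∏ i ∈ Finset.range n, (1 + t i) + ∏ i ∈ Finset.range n, (1 - t i)) =
      ∏ i ∈ Finset.range n, (1 + sgn b * t i) := by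
  obtain ⟨hA, hB⟩ := gmap_prod_nonneg h
  have key : gmap n t *
      (∏ i ∈ Finset.range n, (1 + t i) + ∏ i ∈ Finset.range n, (1 - t i)) =
      ∏ i ∈ Finset.range n, (1 + t i) - ∏ i ∈ Finset.range n, (1 - t i) := by
    unfold gmap
    rcases eq_or_ne (∏ i ∈ Finset.range n, (1 + t i) + ∏ i ∈ Finset.range n, (1 - t i)) 0
      with h0 | h0
    · have h1 : ∏ i ∈ Finset.range n, (1 + t i) = 0 := by linarith
      have h2 : ∏ i ∈ Finset.range n, (1 - t i) = 0 := by linarith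
      simp [h1, h2]
    · exact div_mul_cancel₀ _ h0
  cases b
  · simp only [sgn_false, one_mul]
    linear_combination key / 2
  · simp only [sgn_true, neg_mul, one_mul, ← sub_eq_add_neg]
    linear_combination -key / 2

variable {E : Type*}

/-- The magnetization at the root computed by belief propagation from the labels at level `k`. -/
def bp (θ : ℝ) : ℕ → Config E → ℝ
  | 0, ω => label ω []
  | k + 1, ω => gmap (offspring ω []) fun i => θ * bp θ k (sub i ω)

lemma abs_label (ω : Config E) : |label ω []| = 1 := by
  rw [label_nil, abs_sgn]

lemma abs_bp_le {θ : ℝ} (hθ : |θ| ≤ 1) (k : ℕ) (ω : Config E) : |bp θ k ω| ≤ 1 := by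
  induction k generalizing ω with
  | zero => exact (abs_label ω).le
  | succ k ih =>
    refine abs_gmap_le fun i _ => ?_
    rw [abs_mul]
    exact mul_le_one₀ hθ (abs_nonneg _) (ih _)

lemma bp_twist (θ : ℝ) (b : Bool) (k : ℕ) (ω : Config E) :
    bp θ k (twist b ω) = sgn b * bp θ k ω := by
  induction k generalizing ω with
  | zero => simp [bp, label_nil, twist, sgn_xor]
  | succ k ih =>
    simp only [bp]
    have hsub : ∀ i, sub i (twist b ω) = twist b (sub i ω) := by
      intro i
      ext1 v
      cases v <;> simp [sub, twist]
    have hoff : offspring (twist b ω) [] = offspring ω [] := by simp [offspring, twist]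
    rw [hoff, ← gmap_sgn]
    refine gmap_congr fun i _ => ?_
    rw [hsub, ih]
    ring

lemma compl_flipped_true : {ω : Config E | flipped ω [] = true}ᶜ = {ω | flipped ω [] = false} := by
  ext; simp

/-- The configuration with all flip indicators reset. -/
def eraseFlags (ω : Config E) : Config E := fun v => ((ω v).1, false, (ω v).2.2)

/-- The information about `ω` that is left when the labels above level `k` are forgotten. -/
def view : ℕ → Config E → Config E
  | 0, ω => ω
  | k + 1, ω => graft (((ω []).1, false, (ω []).2.2), fun i =>
      -- The indicator at the root of `sub i ω` is the label of string `i`, which depends on the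
      -- label of the root even when `i` is not a child, so it has to be hidden outside the tree.
      if i < offspring ω [] then view k (sub i ω) else eraseFlags (sub i ω))

lemma sub_view_succ (k i : ℕ) (ω : Config E) :
    sub i (view (k + 1) ω) =
      if i < offspring ω [] then view k (sub i ω) else eraseFlags (sub i ω) := by
  ext1 v
  cases v <;> simp [sub, view, graft]

lemma offspring_view (k : ℕ) (ω : Config E) : offspring (view k ω) [] = offspring ω [] := by
  cases k <;> simp [offspring, view, graft]

lemma bp_view (θ : ℝ) {k m : ℕ} (h : k ≤ m) (ω : Config E) : bp θ m (view k ω) = bp θ m ω := by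
  induction k generalizing m ω with
  | zero => rfl
  | succ k ih =>
    obtain ⟨m, rfl⟩ := Nat.exists_eq_succ_of_ne_zero (by omega : m ≠ 0)
    simp only [bp]
    rw [offspring_view]
    refine gmap_congr fun i hi => ?_
    rw [sub_view_succ, if_pos hi, ih (by omega)]

lemma eraseFlags_twist (b : Bool) (ω : Config E) :
    eraseFlags (twist b ω) = eraseFlags ω := by
  ext1 v
  cases v <;> simp [eraseFlags, twist]

end

/-! ### Measurability of belief propagation, and Bayes' rule across one edge. -/

section

open Measure

variable {E : Type*} [MeasurableSpace E]

lemma measurable_gmap (n : ℕ) : Measurable (gmap n) := by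
  unfold gmap
  fun_prop

lemma measurable_bp (θ : ℝ) (k : ℕ) : Measurable (bp θ k : Config E → ℝ) := by
  induction k with
  | zero => exact measurable_label []
  | succ k ih =>
    refine measurable_nat_comp (measurable_offspring [])
      (F := fun n ω => gmap n fun i => θ * bp θ k (sub i ω)) fun n => ?_
    exact (measurable_gmap n).comp
      (measurable_pi_iff.2 fun i => (ih.comp (measurable_sub i)).const_mul θ)

lemma measurable_eraseFlags : Measurable (eraseFlags : Config E → Config E) := by
  rw [measurable_pi_iff]
  intro v
  unfold eraseFlags
  fun_prop

lemma measurable_view (k : ℕ) : Measurable (view k : Config E → Config E) := by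
  induction k with
  | zero => exact measurable_id
  | succ k ih =>
    simp only [view]
    refine measurable_graft.comp (Measurable.prodMk (by fun_prop) ?_)
    refine measurable_pi_iff.2 fun i => ?_
    exact Measurable.ite (measurableSet_lt measurable_const (measurable_offspring []))
      (ih.comp (measurable_sub i)) (measurable_eraseFlags.comp (measurable_sub i))

lemma abs_theta_le (η : I) : |theta η| ≤ 1 := by
  have h0 := η.2.1
  have h1 := η.2.2
  rw [theta, abs_le]
  constructor <;> linarith

lemma sgn_mul_le {b : Bool} {x : ℝ} (hx : |x| ≤ 1) : 0 ≤ 1 + sgn b * x := by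
  have := abs_le.1 hx
  cases b <;> simp <;> linarith

lemma lintegral_eq_add_flipped (μ : Measure (Config E)) (f : Config E → ENNReal) :
    ∫⁻ ω, f ω ∂μ = ∫⁻ ω in {ω | flipped ω [] = true}, f ω ∂μ +
      ∫⁻ ω in {ω | flipped ω [] = false}, f ω ∂μ := by
  rw [← compl_flipped_true, lintegral_add_compl _ (measurableSet_flipped true)]

/-- Split by the label `σ'` of the child: its weight `1 + σθσ'` times its posterior `(1 + σ'x)/2`,
summed over `σ' = ±1`, is `1 + σθx`. A posterior mean `x` at the child thus becomes the message `θx`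
to the parent. -/
lemma childLaw_apply_of_posterior (d : ℝ≥0) (η : I) (ν : Measure E) [IsProbabilityMeasure ν]
    {V : Config E → Config E} (hV : Measurable V) {x : Config E → ℝ} (hx : Measurable x)
    (hx1 : ∀ ω, |x ω| ≤ 1)
    (h : ∀ b A, MeasurableSet A → law d η ν ({ω | flipped ω [] = b} ∩ V ⁻¹' A) =
      ∫⁻ ω in V ⁻¹' A, ENNReal.ofReal ((1 + sgn b * x ω) / 2) ∂law d η ν)
    (b : Bool) {A : Set (Config E)} (hA : MeasurableSet A) :
    childLaw d η ν b (V ⁻¹' A) =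
      ∫⁻ ω in V ⁻¹' A, ENNReal.ofReal (1 + sgn b * (theta η * x ω)) ∂law d η ν := by
  have hθ := abs_theta_le η
  rw [childLaw, withDensity_apply _ (hV hA), lintegral_eq_add_flipped]
  have h1 : ∀ b', ∫⁻ ω in {ω | flipped ω [] = b'},
      ENNReal.ofReal (1 + sgn b * theta η * label ω []) ∂(law d η ν).restrict (V ⁻¹' A) =
      ∫⁻ ω in V ⁻¹' A, ENNReal.ofReal
        ((1 + sgn b * theta η * sgn b') * ((1 + sgn b' * x ω) / 2)) ∂law d η ν := by
    intro b'
    have h2 : ∀ ω ∈ {ω : Config E | flipped ω [] = b'},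
        ENNReal.ofReal (1 + sgn b * theta η * label ω []) =
          ENNReal.ofReal (1 + sgn b * theta η * sgn b') := by
      intro ω hω
      rw [label_nil]
      simp only [Set.mem_ofPred_eq, flipped] at hω
      rw [hω]
    have h0 : 0 ≤ 1 + sgn b * theta η * sgn b' := by
      rw [mul_assoc]
      exact sgn_mul_le (by rwa [abs_mul, abs_sgn, mul_one])
    rw [setLIntegral_congr_fun (measurableSet_flipped b') h2, lintegral_const, restrict_apply .univ,
      Set.univ_inter, restrict_apply (measurableSet_flipped b'), h b' A hA]
    simp only [ENNReal.ofReal_mul h0]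
    rw [lintegral_const_mul]
    exact (((hx.const_mul _).const_add _).div_const _).ennreal_ofReal
  rw [h1, h1, ← lintegral_add_left]
  · refine lintegral_congr fun ω => ?_
    have := hx1 ω
    rw [← ENNReal.ofReal_add]
    · congr 1
      simp
      ring
    · refine mul_nonneg ?_ (div_nonneg (sgn_mul_le this) zero_le_two)
      rw [mul_assoc]
      exact sgn_mul_le (by rwa [abs_mul, abs_sgn, mul_one])
    · refine mul_nonneg ?_ (div_nonneg (sgn_mul_le this) zero_le_two)
      rw [mul_assoc]
      exact sgn_mul_le (by rwa [abs_mul, abs_sgn, mul_one])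
  · exact ((((hx.const_mul _).const_add _).div_const _).const_mul _).ennreal_ofReal

/-- Reversing the root label preserves both the law and the erased configuration, so the two labels
are equally likely given the latter. -/
lemma posterior_eraseFlags (d : ℝ≥0) (η : I) (ν : Measure E) [IsProbabilityMeasure ν]
    (b : Bool) {A : Set (Config E)} (hA : MeasurableSet A) :
    law d η ν ({ω | flipped ω [] = b} ∩ eraseFlags ⁻¹' A) =
      ∫⁻ _ in eraseFlags ⁻¹' A, ENNReal.ofReal (1 / 2) ∂law d η ν := by
  have hA' := measurable_eraseFlags hA
  have key : ∀ b, law d η ν ({ω | flipped ω [] = b} ∩ eraseFlags ⁻¹' A) =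
      law d η ν ({ω | flipped ω [] = !b} ∩ eraseFlags ⁻¹' A) := by
    intro b
    rw [← (measurePreserving_twist d η ν true).measure_preimage
      ((measurableSet_flipped b).inter hA').nullMeasurableSet]
    congr 1
    ext ω
    simp only [Set.mem_preimage, Set.mem_inter_iff, eraseFlags_twist,
      Set.mem_ofPred_eq, flipped, twist]
    cases (ω []).2.1 <;> cases b <;> simp
  have hsum : law d η ν (eraseFlags ⁻¹' A) =
      law d η ν ({ω | flipped ω [] = b} ∩ eraseFlags ⁻¹' A) +
      law d η ν ({ω | flipped ω [] = !b} ∩ eraseFlags ⁻¹' A) := by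
    rw [← measure_inter_add_sdiff _ (measurableSet_flipped b), Set.inter_comm]
    congr 2
    ext ω
    simp only [Set.mem_sdiff, Set.mem_inter_iff, Set.mem_ofPred_eq, flipped]
    rw [and_comm]
    cases (ω []).2.1 <;> cases b <;> simp
  rw [← key, ← two_mul] at hsum
  rw [lintegral_const, restrict_apply .univ, Set.univ_inter, hsum, ← mul_assoc]
  rw [show ENNReal.ofReal (1 / 2) * 2 = 1 by
    rw [← ENNReal.ofReal_ofNat 2, ← ENNReal.ofReal_mul (by norm_num)]; norm_num, one_mul]

end

/-! ### Belief propagation as the exact posterior. -/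

section

open Measure

variable {E : Type*} [MeasurableSpace E]

/-- Belief propagation computes the posterior law of the root label, even when the labels at all
levels below level `k` are observed along with those at level `k`. -/
theorem posterior_view (d : ℝ≥0) (η : I) (ν : Measure E) [IsProbabilityMeasure ν] (k : ℕ)
    (b : Bool) {A : Set (Config E)} (hA : MeasurableSet A) :
    law d η ν ({ω | flipped ω [] = b} ∩ view k ⁻¹' A) =
      ∫⁻ ω in view k ⁻¹' A, ENNReal.ofReal ((1 + sgn b * bp (theta η) k ω) / 2) ∂law d η ν := by
  have hθ := abs_theta_le η
  induction k generalizing b A with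
  | zero =>
    have h1 : ∀ ω : Config E, ENNReal.ofReal ((1 + sgn b * bp (theta η) 0 ω) / 2) =
        {ω : Config E | flipped ω [] = b}.indicator 1 ω := by
      intro ω
      simp only [bp, label_nil, Set.indicator_apply, Set.mem_ofPred_eq, flipped,
        Pi.one_apply]
      cases (ω []).2.1 <;> cases b <;> simp
    simp only [h1]
    rw [lintegral_indicator_one (measurableSet_flipped b), restrict_apply (measurableSet_flipped b)]
  | succ k ih =>
    set P := law d η ν with hP
    set θ := theta η with hθ'
    have hVA := measurable_view (E := E) (k + 1) hA
    have hbp := measurable_bp (E := E) θ (k + 1)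
    -- it is enough to look at a fixed number of children
    suffices hn : ∀ n : ℕ, P ({ω | flipped ω [] = b} ∩ view (k + 1) ⁻¹' A ∩
        {ω | offspring ω [] = n}) =
        ∫⁻ ω in {ω | offspring ω [] = n} ∩ view (k + 1) ⁻¹' A,
          ENNReal.ofReal ((1 + sgn b * bp θ (k + 1) ω) / 2) ∂P by
      have hD : ∀ n : ℕ, MeasurableSet {ω : Config E | offspring ω [] = n} := fun n =>
        measurable_offspring [] (measurableSet_singleton n)
      have hU : ⋃ n : ℕ, {ω : Config E | offspring ω [] = n} = Set.univ := by
        ext ω; simp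
      have hdisj : Pairwise (Function.onFun Disjoint
          fun n : ℕ => {ω : Config E | offspring ω [] = n}) := by
        intro m n hmn
        rw [Function.onFun, Set.disjoint_left]
        intro ω h1 h2
        exact hmn (h1.symm.trans h2)
      rw [← Set.inter_univ ({ω | flipped ω [] = b} ∩ view (k + 1) ⁻¹' A), ← hU,
        Set.inter_iUnion, measure_iUnion]
      · rw [← restrict_univ (μ := P.restrict _), ← hU, lintegral_iUnion hD hdisj]
        refine tsum_congr fun n => ?_
        rw [hn n, restrict_restrict (hD n)]
      · intro m n hmn
        exact (hdisj hmn).mono Set.inter_subset_right Set.inter_subset_right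
      · exact fun n => ((measurableSet_flipped b).inter hVA).inter (hD n)
    intro n
    -- What is seen of string `i`, and the resulting posterior mean `x i` of its label, namely 0
    -- outside the tree.
    let W : ℕ → Config E → Config E := fun i => if i < n then view k else eraseFlags
    let x : ℕ → Config E → ℝ := fun i => if i < n then bp θ k else 0
    have hW : ∀ i, Measurable (W i) := by
      intro i
      by_cases hi : i < n <;> simp only [W, hi, if_true, if_false]
      exacts [measurable_view k, measurable_eraseFlags]
    have hx : ∀ i, Measurable (x i) := by
      intro i
      by_cases hi : i < n <;> simp only [x, hi, if_true, if_false]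
      exacts [measurable_bp θ k, measurable_zero]
    have hx1 : ∀ i ω, |x i ω| ≤ 1 := by
      intro i ω
      by_cases hi : i < n <;> simp only [x, hi, if_true, if_false]
      exacts [abs_bp_le hθ k ω, by simp]
    have hxW : ∀ i ω, x i (W i ω) = x i ω := by
      intro i ω
      by_cases hi : i < n <;> simp only [W, x, hi, if_true, if_false]
      exacts [bp_view θ le_rfl ω, rfl]
    let f : Bool → ℕ → Config E → ENNReal := fun b' i ω =>
      ENNReal.ofReal (1 + sgn b' * (θ * x i ω))
    have hf : ∀ b' i, Measurable (f b' i) := fun b' i =>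
      ((((hx i).const_mul _).const_mul _).const_add _).ennreal_ofReal
    have hfW : ∀ b' i, f b' i = f b' i ∘ W i := by
      intro b' i
      ext ω
      simp [f, hxW]
    have hpost : ∀ b' i, (childLaw d η ν b').map (W i) =
        (P.map (W i)).withDensity (f b' i) := by
      intro b' i
      rw [← map_withDensity_comp _ (hW i) (hf b' i), ← hfW]
      ext S hS
      rw [map_apply (hW i) hS, map_apply (hW i) hS, withDensity_apply _ (hW i hS)]
      refine childLaw_apply_of_posterior d η ν (hW i) (hx i) (hx1 i) (fun b S hS => ?_) b' hS
      by_cases hi : i < n <;> simp only [W, x, hi, if_true, if_false]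
      · exact ih b hS
      · simpa using posterior_eraseFlags d η ν b hS
    have hprobW : ∀ i, IsProbabilityMeasure (P.map (W i)) := fun i =>
      isProbabilityMeasure_map (hW i).aemeasurable
    have hprobd : ∀ b' i, IsProbabilityMeasure ((P.map (W i)).withDensity (f b' i)) := by
      intro b' i
      rw [← hpost]
      exact isProbabilityMeasure_map (hW i).aemeasurable
    let κ : Measure (E × (ℕ → Config E)) := ν.prod (infinitePi fun i => P.map (W i))
    let F : Bool → E × (ℕ → Config E) → ENNReal := fun b' p =>
      ∏ i ∈ Finset.range n, f b' i (p.2 i)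
    have hF : ∀ b', Measurable (F b') := by
      intro b'
      exact Finset.measurable_prod _ fun i _ =>
        (hf b' i).comp ((measurable_pi_apply i).comp measurable_snd)
    let Z : Config E → E × (ℕ → Config E) := fun ω => (noise ω [], fun i => W i (sub i ω))
    have hZ : Measurable Z := by
      refine Measurable.prodMk (measurable_pi_apply _).snd.snd ?_
      exact measurable_pi_iff.2 fun i => (hW i).comp (measurable_sub i)
    set c : ENNReal := ENNReal.ofReal (1 / 2) * poissonMeasure d {n} with hc
    -- Given `n` children, changing the root label changes the law of the observation `Z` only
    -- through the likelihood `F b'`; the reference measure `κ` and the constant `c` are the same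
    -- for both labels.
    have hmap : ∀ b', (P.restrict (rootEvent b' n)).map Z = c • κ.withDensity (F b') := by
      intro b'
      have hpi : Measurable fun (c : ℕ → Config E) (i : ℕ) => W i (c i) :=
        measurable_pi_iff.2 fun i => (hW i).comp (measurable_pi_apply i)
      have hsub : Measurable fun (ω : Config E) (i : ℕ) => sub i ω :=
        measurable_pi_iff.2 fun i => measurable_sub i
      have hnoise : Measurable fun ω : Config E => noise ω [] := (measurable_pi_apply _).snd.snd
      have h1 : Z = Prod.map id (fun (c : ℕ → Config E) (i : ℕ) => W i (c i)) ∘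
          fun ω => (noise ω [], fun i => sub i ω) := rfl
      rw [h1, ← map_map (measurable_id.prodMap hpi) (hnoise.prodMk hsub), map_noise_sub_restrict,
        Measure.map_smul, ← map_prod_map _ _ measurable_id hpi, Measure.map_id,
        infinitePi_map_pi _ hW]
      congr 1
      simp only [hpost]
      rw [infinitePi_withDensity (Finset.range n) (fun i => P.map (W i)) (f b') (hf b')]
      · rw [prod_withDensity_right]
        exact Finset.measurable_prod _ fun i _ => (hf b' i).comp (measurable_pi_apply i)
      · intro i hi
        have hi' : ¬ i < n := by simpa using hi
        ext ω
        simp [f, x, hi']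
    let J : E × (ℕ → Config E) → Config E := fun p => graft ((n, false, p.1), p.2)
    have hJ : Measurable J := measurable_graft.comp (by fun_prop)
    have hview : ∀ ω : Config E, offspring ω [] = n → view (k + 1) ω = J (Z ω) := by
      intro ω hω
      simp only [view, J, Z, W, hω]
      congr 2
      · rw [← hω]; rfl
      · ext i : 1
        split_ifs <;> rfl
    let G : E × (ℕ → Config E) → ENNReal := fun p =>
      ENNReal.ofReal ((1 + sgn b * gmap n fun i => θ * x i (p.2 i)) / 2)
    have hG : Measurable G := by
      refine (Measurable.div_const (Measurable.const_add (Measurable.const_mul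
        ((measurable_gmap n).comp (measurable_pi_iff.2 fun i => ?_)) _) _) _).ennreal_ofReal
      exact ((hx i).comp ((measurable_pi_apply i).comp measurable_snd)).const_mul θ
    have hbpG : ∀ ω : Config E, offspring ω [] = n →
        ENNReal.ofReal ((1 + sgn b * bp θ (k + 1) ω) / 2) = G (Z ω) := by
      intro ω hω
      simp only [bp, hω, G, Z, hxW]
      congr 4
      refine gmap_congr fun i hi => ?_
      simp [x, hi]
    -- The claimed posterior `G` is the likelihood of `b` divided by the sum of the two likelihoods.
    have hFG : ∀ p, G p * F true p + G p * F false p = F b p := by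
      intro p
      have ht : ∀ i < n, |θ * x i (p.2 i)| ≤ 1 := fun i _ => by
        rw [abs_mul]
        exact mul_le_one₀ hθ (abs_nonneg _) (hx1 _ _)
      have hFb : ∀ b', F b' p =
          ENNReal.ofReal (∏ i ∈ Finset.range n, (1 + sgn b' * (θ * x i (p.2 i)))) := by
        intro b'
        rw [ENNReal.ofReal_prod_of_nonneg]
        intro i hi
        exact sgn_mul_le (ht i (Finset.mem_range.1 hi))
      have h := one_add_sgn_mul_gmap ht b
      have hG0 := sgn_mul_le (b := b) (abs_gmap_le ht)
      obtain ⟨hA0, hB0⟩ := gmap_prod_nonneg ht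
      rw [hFb, hFb, hFb, ← mul_add, ← h]
      simp only [G]
      rw [← ENNReal.ofReal_add, ← ENNReal.ofReal_mul (by linarith)]
      · congr 2
        simp only [sgn_true, sgn_false, one_mul, neg_mul, ← sub_eq_add_neg]
        ring
      · simpa [← sub_eq_add_neg] using hB0
      · simpa using hA0
    have hlhs : P ({ω | flipped ω [] = b} ∩ view (k + 1) ⁻¹' A ∩ {ω | offspring ω [] = n}) =
        c * ∫⁻ p in J ⁻¹' A, F b p ∂κ := by
      rw [← withDensity_apply _ (hJ hA), ← smul_eq_mul, ← Measure.smul_apply, ← hmap,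
        map_apply hZ (hJ hA), restrict_apply (hZ (hJ hA))]
      congr 1
      ext ω
      simp only [rootEvent, Set.mem_inter_iff, Set.mem_ofPred_eq, Set.mem_preimage]
      constructor
      · rintro ⟨⟨h1, h2⟩, h3⟩
        exact ⟨by rwa [← hview ω h3], h1, h3⟩
      · rintro ⟨h1, h2, h3⟩
        exact ⟨⟨h2, by rwa [hview ω h3]⟩, h3⟩
    have hD : MeasurableSet {ω : Config E | offspring ω [] = n} :=
      measurable_offspring [] (measurableSet_singleton n)
    have hrhs : ∫⁻ ω in {ω | offspring ω [] = n} ∩ view (k + 1) ⁻¹' A,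
          ENNReal.ofReal ((1 + sgn b * bp θ (k + 1) ω) / 2) ∂P =
        ∫⁻ ω in {ω | offspring ω [] = n}, (J ⁻¹' A).indicator G (Z ω) ∂P := by
      rw [Set.inter_comm, ← restrict_restrict hVA, ← lintegral_indicator hVA]
      refine setLIntegral_congr_fun hD fun ω hω => ?_
      by_cases hm : J (Z ω) ∈ A
      · rw [Set.indicator_of_mem (by rwa [Set.mem_preimage, hview ω hω]),
          Set.indicator_of_mem (by exact hm), hbpG ω hω]
      · rw [Set.indicator_of_notMem (by rwa [Set.mem_preimage, hview ω hω]),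
          Set.indicator_of_notMem (by exact hm)]
    have hpart : ∀ b', ∫⁻ ω in {ω | flipped ω [] = b'}, (J ⁻¹' A).indicator G (Z ω)
        ∂P.restrict {ω | offspring ω [] = n} = c * ∫⁻ p in J ⁻¹' A, G p * F b' p ∂κ := by
      intro b'
      rw [restrict_restrict (measurableSet_flipped b')]
      change ∫⁻ ω in rootEvent b' n, _ ∂P = _
      rw [← lintegral_map (hG.indicator (hJ hA)) hZ, hmap, lintegral_smul_measure,
        lintegral_withDensity_eq_lintegral_mul _ (hF b') (hG.indicator (hJ hA)), smul_eq_mul,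
        ← lintegral_indicator (hJ hA)]
      congr 1
      refine lintegral_congr fun p => ?_
      by_cases hp : p ∈ J ⁻¹' A
      · simp [hp, mul_comm]
      · simp [hp]
    rw [hlhs, hrhs, lintegral_eq_add_flipped, hpart, hpart, ← mul_add,
      ← lintegral_add_left (f := fun p => G p * F true p) (hG.mul (hF true))]
    simp only [hFG]

end

/-! ### What the view retains, and changes of measure on functions of it. -/

section

variable {E : Type*}

lemma inTree_view (k : ℕ) (ω : Config E) (w : List ℕ) :
    InTree (offspring (view k ω)) [] w ↔ InTree (offspring ω) [] w := by
  induction k generalizing ω w with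
  | zero => rfl
  | succ k ih =>
    cases w with
    | nil => simp [InTree]
    | cons i w =>
      rw [inTree_cons, inTree_cons, offspring_view, sub_view_succ]
      refine and_congr_right fun hi => ?_
      rw [if_pos hi, ih]

lemma label_view {k : ℕ} (ω : Config E) {w : List ℕ} (hk : k ≤ w.length)
    (hw : InTree (offspring ω) [] w) : label (view k ω) w = label ω w := by
  induction k generalizing ω w with
  | zero => rfl
  | succ k ih =>
    cases w with
    | nil => simp at hk
    | cons i w =>
      rw [inTree_cons] at hw
      rw [← label_sub, ← label_sub, sub_view_succ, if_pos hw.1,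
        ih _ (by simpa using hk) hw.2]

lemma levelLabels_view {k m : ℕ} (h : k ≤ m) (ω : Config E) :
    levelLabels [] m (view k ω) = levelLabels [] m ω := by
  ext w
  by_cases hw : w.length = m ∧ InTree (offspring ω) [] w
  · rw [levelLabels, if_pos (by rwa [inTree_view]), levelLabels, if_pos hw]
    exact label_view ω (by rw [List.nil_append, hw.1]; exact h) hw.2
  · rw [levelLabels, if_neg (by rwa [inTree_view]), levelLabels, if_neg hw]

lemma noise_view (k : ℕ) (ω : Config E) (w : List ℕ) : noise (view k ω) w = noise ω w := by
  induction k generalizing ω w with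
  | zero => rfl
  | succ k ih =>
    cases w with
    | nil => rfl
    | cons i w =>
      rw [← noise_sub, ← noise_sub, sub_view_succ]
      split_ifs
      · exact ih _ _
      · rfl

lemma posterior_nonneg (η : I) (k : ℕ) (b : Bool) (ω : Config E) :
    0 ≤ (1 + sgn b * bp (theta η) k ω) / 2 :=
  div_nonneg (sgn_mul_le (abs_bp_le (abs_theta_le η) k ω)) zero_le_two

lemma abs_theta_mul_bp_le (η : I) (k : ℕ) (ω : Config E) : |theta η * bp (theta η) k ω| ≤ 1 := by
  rw [abs_mul]
  exact mul_le_one₀ (abs_theta_le η) (abs_nonneg _) (abs_bp_le (abs_theta_le η) k ω)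

lemma childDensity_nonneg (η : I) (k : ℕ) (b : Bool) (ω : Config E) :
    0 ≤ 1 + sgn b * (theta η * bp (theta η) k ω) :=
  sgn_mul_le (abs_theta_mul_bp_le η k ω)

end

section

open Measure

variable {E : Type*} [MeasurableSpace E]

/-- Such a function factors through the tree, the labels at level `m ≥ k` and the noise, none of
which changes when the labels above level `k` are forgotten. So `posterior_view` at level `k`
applies to observables of every deeper level. -/
lemma eq_comp_view_of_measurable {k m : ℕ} (h : k ≤ m) {f : Config E → ℝ}
    (hf : Measurable[obsAlg [] m ⊔ noiseAlg []] f) (ω : Config E) : f (view k ω) = f ω := by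
  let J : Config E → ((List ℕ → Prop) × (List ℕ → ℝ)) × (List ℕ → E) := fun ω =>
    ((fun w => InTree (offspring ω) [] w, levelLabels [] m ω), fun w => noise ω ([] ++ w))
  have hJ : (obsAlg [] m ⊔ noiseAlg [] : MeasurableSpace (Config E)) =
      MeasurableSpace.comap J inferInstance := by
    simp only [obsAlg, treeAlg, noiseAlg]
    rw [← MeasurableSpace.comap_prodMk, ← MeasurableSpace.comap_prodMk]
    rfl
  rw [hJ] at hf
  obtain ⟨g, -, rfl⟩ := hf.exists_eq_measurable_comp
  have : J (view k ω) = J ω := by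
    simp only [J, inTree_view, levelLabels_view h, noise_view]
  simp only [Function.comp_apply, this]

lemma view_preimage_of_measurableSet {k m : ℕ} (h : k ≤ m) {A : Set (Config E)}
    (hA : MeasurableSet[obsAlg [] m ⊔ noiseAlg []] A) : view k ⁻¹' A = A := by
  ext ω
  have h1 : Measurable[obsAlg [] m ⊔ noiseAlg []] (A.indicator (fun _ => (1 : ℝ))) :=
    (@measurable_const _ _ _ (obsAlg [] m ⊔ noiseAlg []) (1 : ℝ)).indicator hA
  have h2 := eq_comp_view_of_measurable h h1 ω
  by_cases h3 : ω ∈ A <;> by_cases h4 : view k ω ∈ A <;> simp_all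

lemma obsAlg_sup_noiseAlg_le (u : List ℕ) (k : ℕ) :
    obsAlg u k ⊔ noiseAlg u ≤ (inferInstance : MeasurableSpace (Config E)) :=
  sup_le (obsAlg_le u k) (noiseAlg_le u)

variable (d : ℝ≥0) (η : I) (ν : Measure E) [IsProbabilityMeasure ν]

lemma measurable_ofReal_posterior (k : ℕ) (b : Bool) : Measurable fun ω : Config E =>
    ENNReal.ofReal ((1 + sgn b * bp (theta η) k ω) / 2) :=
  ((((measurable_bp _ k).const_mul _).const_add _).div_const _).ennreal_ofReal

lemma measurable_ofReal_childDensity (k : ℕ) (b : Bool) : Measurable fun ω : Config E =>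
    ENNReal.ofReal (1 + sgn b * (theta η * bp (theta η) k ω)) :=
  ((((measurable_bp _ k).const_mul _).const_mul _).const_add _).ennreal_ofReal

lemma map_view_restrict (k : ℕ) (b : Bool) :
    ((law d η ν).restrict {ω | flipped ω [] = b}).map (view k) =
      ((law d η ν).withDensity fun ω =>
        ENNReal.ofReal ((1 + sgn b * bp (theta η) k ω) / 2)).map (view k) := by
  ext A hA
  have hA' := measurable_view (E := E) k hA
  rw [map_apply (measurable_view k) hA, map_apply (measurable_view k) hA, restrict_apply hA',
    withDensity_apply _ hA', ← posterior_view d η ν k b hA, Set.inter_comm]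

/-- The main change of measure: expectations under `childLaw` of anything determined at level `k`
become expectations under `law` with weight `1 + σθX_k`, where the contraction hypothesis lives. -/
lemma map_view_childLaw (k : ℕ) (b : Bool) :
    (childLaw d η ν b).map (view k) =
      ((law d η ν).withDensity fun ω =>
        ENNReal.ofReal (1 + sgn b * (theta η * bp (theta η) k ω))).map (view k) := by
  ext A hA
  have hA' := measurable_view (E := E) k hA
  rw [map_apply (measurable_view k) hA, map_apply (measurable_view k) hA,
    withDensity_apply _ hA']
  exact childLaw_apply_of_posterior d η ν (measurable_view k) (measurable_bp _ k)
    (abs_bp_le (abs_theta_le η) k) (fun b A hA => posterior_view d η ν k b hA) b hA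

lemma lintegral_childLaw_eq {k : ℕ} (b : Bool) {f : Config E → ENNReal} (hf : Measurable f)
    (hv : ∀ ω, f (view k ω) = f ω) :
    ∫⁻ ω, f ω ∂childLaw d η ν b =
      ∫⁻ ω, ENNReal.ofReal (1 + sgn b * (theta η * bp (theta η) k ω)) * f ω ∂law d η ν := by
  have h := congrArg (fun m => ∫⁻ ω, f ω ∂m) (map_view_childLaw d η ν k b)
  simp only [lintegral_map hf (measurable_view k), hv] at h
  rw [h, lintegral_withDensity_eq_lintegral_mul _ (measurable_ofReal_childDensity η k b) hf]
  rfl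

lemma setIntegral_flipped_eq {k : ℕ} (b : Bool) {f : Config E → ℝ} (hf : Measurable f)
    (hv : ∀ ω, f (view k ω) = f ω) :
    ∫ ω in {ω | flipped ω [] = b}, f ω ∂law d η ν =
      ∫ ω, (1 + sgn b * bp (theta η) k ω) / 2 * f ω ∂law d η ν := by
  have h := congrArg (fun m => ∫ ω, f ω ∂m) (map_view_restrict d η ν k b)
  rw [integral_map (measurable_view k).aemeasurable hf.aestronglyMeasurable,
    integral_map (measurable_view k).aemeasurable hf.aestronglyMeasurable] at h
  simp only [hv] at h
  rw [h, integral_withDensity_eq_integral_toReal_smul (measurable_ofReal_posterior η k b)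
    (ae_of_all _ fun _ => ENNReal.ofReal_lt_top)]
  refine integral_congr_ae (ae_of_all _ fun ω => ?_)
  simp only [smul_eq_mul]
  rw [ENNReal.toReal_ofReal (posterior_nonneg η k b ω)]

lemma integral_childLaw_eq {k : ℕ} (b : Bool) {f : Config E → ℝ} (hf : Measurable f)
    (hv : ∀ ω, f (view k ω) = f ω) :
    ∫ ω, f ω ∂childLaw d η ν b =
      ∫ ω, (1 + sgn b * (theta η * bp (theta η) k ω)) * f ω ∂law d η ν := by
  have h := congrArg (fun m => ∫ ω, f ω ∂m) (map_view_childLaw d η ν k b)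
  rw [integral_map (measurable_view k).aemeasurable hf.aestronglyMeasurable,
    integral_map (measurable_view k).aemeasurable hf.aestronglyMeasurable] at h
  simp only [hv] at h
  rw [h, integral_withDensity_eq_integral_toReal_smul (measurable_ofReal_childDensity η k b)
    (ae_of_all _ fun _ => ENNReal.ofReal_lt_top)]
  refine integral_congr_ae (ae_of_all _ fun ω => ?_)
  simp only [smul_eq_mul]
  rw [ENNReal.toReal_ofReal (childDensity_nonneg η k b ω)]

end

/-! ### Belief propagation is a function of the observation. -/

section

variable {E : Type*}

lemma tendsto_prod_range_ite (n : ℕ) (a : ℕ → ℝ) :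
    Tendsto (fun m => ∏ i ∈ Finset.range m, if i < n then a i else 1) atTop
      (𝓝 (∏ i ∈ Finset.range n, a i)) := by
  refine tendsto_const_nhds.congr' ?_
  filter_upwards [eventually_ge_atTop n] with m hm
  rw [← Finset.prod_subset (Finset.range_mono hm) fun i _ hi => by simp_all]
  exact Finset.prod_congr rfl fun i hi => by simp_all

lemma measurable_obsAlg_bp (θ : ℝ) (k : ℕ) :
    Measurable[obsAlg [] k] (bp θ k : Config E → ℝ) := by
  let J : ℕ → Config E → (List ℕ → Prop) × (List ℕ → ℝ) := fun k ω =>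
    (fun w => InTree (offspring ω) [] w, levelLabels [] k ω)
  have hJ : ∀ k, (obsAlg [] k : MeasurableSpace (Config E)) =
      MeasurableSpace.comap (J k) inferInstance := by
    intro k
    simp only [obsAlg, treeAlg]
    rw [← MeasurableSpace.comap_prodMk]
    rfl
  induction k with
  | zero =>
    rw [hJ]
    have : (bp θ 0 : Config E → ℝ) = (fun p : (List ℕ → Prop) × (List ℕ → ℝ) => p.2 []) ∘ J 0 := by
      ext ω
      simp [bp, J, levelLabels, InTree]
    rw [this]
    exact Measurable.comp (by fun_prop) (comap_measurable (J 0))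
  | succ k ih =>
    rw [hJ] at ih
    obtain ⟨g, hg, hbp⟩ := ih.exists_eq_measurable_comp
    have hlt : ∀ i, MeasurableSet[obsAlg [] (k + 1)] {ω : Config E | i < offspring ω []} := by
      intro i
      have h1 : Measurable[treeAlg []] fun (ω : Config E) => InTree (offspring ω) [] [i] :=
        (measurable_pi_apply [i]).comp (comap_measurable
          (fun (ω : Config E) (w : List ℕ) => InTree (offspring ω) [] w))
      have h2 : MeasurableSet[treeAlg []] {ω : Config E | InTree (offspring ω) [] [i]} := by
        simpa [Set.preimage] using h1 (measurableSet_singleton True)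
      have h3 : {ω : Config E | i < offspring ω []} =
          {ω : Config E | InTree (offspring ω) [] [i]} := by
        ext ω; simp [InTree]
      rw [h3]
      exact (le_sup_left : treeAlg [] ≤ obsAlg [] (k + 1)) _ h2
    -- `S i` restricts the root observation to the subtree of string `i`. The result is what child
    -- `i` observes only if `i` is a child, so `hsub` assumes `i < offspring ω []`.
    let S : ℕ → (List ℕ → Prop) × (List ℕ → ℝ) → (List ℕ → Prop) × (List ℕ → ℝ) := fun i p =>
      (fun w => p.1 (i :: w), fun w => p.2 (i :: w))
    have hS : ∀ i, Measurable (S i) := fun i => by fun_prop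
    have hsub : ∀ i, ∀ ω : Config E, i < offspring ω [] →
        bp θ k (sub i ω) = g (S i (J (k + 1) ω)) := by
      intro i ω hi
      rw [hbp, Function.comp_apply]
      congr 1
      simp only [J, S, inTree_cons, hi, true_and]
      congr 1
      ext w
      by_cases hw : w.length = k ∧ InTree (offspring (sub i ω)) [] w
      · rw [levelLabels, if_pos hw, levelLabels,
          if_pos ⟨by simp [hw.1], (inTree_cons ω i w).2 ⟨hi, hw.2⟩⟩]
        exact label_sub i ω w
      · rw [levelLabels, if_neg hw, levelLabels, if_neg]
        rw [inTree_cons, List.length_cons, Nat.add_right_cancel_iff]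
        tauto
    have hm : ∀ i, Measurable[obsAlg [] (k + 1)] fun ω : Config E => g (S i (J (k + 1) ω)) := by
      intro i
      rw [hJ]
      exact (hg.comp (hS i)).comp (comap_measurable (J (k + 1)))
    have hprod : ∀ s : ℝ, Measurable[obsAlg [] (k + 1)] fun ω : Config E =>
        ∏ i ∈ Finset.range (offspring ω []), (1 + s * (θ * bp θ k (sub i ω))) := by
      intro s
      -- The number of factors is random, so the product is written as the limit of products over
      -- fixed ranges in which missing children contribute 1.
      refine @measurable_of_tendsto_metrizable _ _ (obsAlg [] (k + 1)) _ _ _ _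
        (fun m ω => ∏ i ∈ Finset.range m,
          if i < offspring ω [] then 1 + s * (θ * g (S i (J (k + 1) ω))) else 1) _ ?_ ?_
      · intro m
        refine Finset.measurable_prod _ fun i _ => ?_
        exact Measurable.ite (hlt i) ((((hm i).const_mul _).const_mul _).const_add _)
          measurable_const
      · rw [tendsto_pi_nhds]
        intro ω
        have h1 := tendsto_prod_range_ite (offspring ω [])
          fun i => 1 + s * (θ * g (S i (J (k + 1) ω)))
        rwa [Finset.prod_congr rfl fun i hi => by
          rw [← hsub i ω (Finset.mem_range.1 hi)]] at h1
    have h1 := hprod 1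
    have h2 := hprod (-1)
    simp only [one_mul, neg_mul, ← sub_eq_add_neg] at h1 h2
    exact (h1.sub h2).div (h1.add h2)

end

/-! ### The magnetization is belief propagation; monotonicity in the level; estimators at the root.
-/

section

lemma setOf_label_eq_sgn {E : Type*} (b : Bool) :
    {ω : Config E | label ω [] = sgn b} = {ω | flipped ω [] = b} := by
  ext ω
  simp only [Set.mem_ofPred_eq, label_nil, flipped]
  cases (ω []).2.1 <;> cases b <;> simp <;> norm_num

variable {E : Type*} [MeasurableSpace E]

lemma integrable_of_abs_le {μ : Measure (Config E)} [IsFiniteMeasure μ] {f : Config E → ℝ}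
    (hf : Measurable f) {M : ℝ} (h : ∀ ω, |f ω| ≤ M) : Integrable f μ :=
  Integrable.of_bound hf.aestronglyMeasurable M (ae_of_all _ h)

variable (d : ℝ≥0) (η : I) (ν : Measure E) [IsProbabilityMeasure ν]

lemma law_flipped (b : Bool) : law d η ν {ω | flipped ω [] = b} = ENNReal.ofReal (1 / 2) := by
  have h := congrArg (fun m => m Set.univ) (map_sub_restrict_flipped d η ν b 0)
  simpa [Measure.map_apply (measurable_sub (E := E) 0) .univ] using h

lemma law_real_flipped (b : Bool) : (law d η ν).real {ω | flipped ω [] = b} = 1 / 2 := by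
  rw [measureReal_def, law_flipped, ENNReal.toReal_ofReal (by norm_num)]

lemma integrable_bp (k : ℕ) {μ : Measure (Config E)} [IsFiniteMeasure μ] :
    Integrable (bp (theta η) k) μ :=
  integrable_of_abs_le (measurable_bp _ k) (abs_bp_le (abs_theta_le η) k)

/-- The right side is `E[σ f]`, and `bp` is the conditional mean of `σ` given the view, of which `f`
is a function. -/
lemma integral_bp_mul {k : ℕ} {f : Config E → ℝ} (hf : Measurable f) {M : ℝ}
    (hM : ∀ ω, |f ω| ≤ M) (hv : ∀ ω, f (view k ω) = f ω) :
    ∫ ω, bp (theta η) k ω * f ω ∂law d η ν =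
      ∫ ω in {ω | flipped ω [] = false}, f ω ∂law d η ν -
        ∫ ω in {ω | flipped ω [] = true}, f ω ∂law d η ν := by
  have hint : ∀ b, Integrable (fun ω => (1 + sgn b * bp (theta η) k ω) / 2 * f ω)
      (law d η ν) := fun b => by
    refine Integrable.bdd_mul (c := 1) (integrable_of_abs_le hf hM)
      ((((measurable_bp _ k).const_mul _).const_add _).div_const _).aestronglyMeasurable
      (ae_of_all _ fun ω => ?_)
    have h1 := abs_le.1 (abs_bp_le (abs_theta_le η) k ω)
    rw [Real.norm_eq_abs, abs_le]
    cases b <;> simp only [sgn_true, sgn_false] <;> constructor <;> linarith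
  rw [setIntegral_flipped_eq d η ν false hf hv, setIntegral_flipped_eq d η ν true hf hv,
    ← integral_sub (hint _) (hint _)]
  refine integral_congr_ae (ae_of_all _ fun ω => ?_)
  simp only [sgn_true, sgn_false]
  ring

lemma magnetization_ae_eq (k : ℕ) :
    magnetization d η ν [] k =ᵐ[law d η ν] bp (theta η) k := by
  have key : ∀ b : Bool, (fun ω => (1 + sgn b * bp (theta η) k ω) / 2) =ᵐ[law d η ν]
      (law d η ν)⟦{ω | label ω [] = sgn b} | obsAlg [] k⟧ := by
    intro b
    have hm : Measurable[obsAlg [] k] fun ω : Config E => (1 + sgn b * bp (theta η) k ω) / 2 :=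
      (((measurable_obsAlg_bp _ k).const_mul _).const_add _).div_const _
    have hint : Integrable (fun ω => (1 + sgn b * bp (theta η) k ω) / 2) (law d η ν) :=
      ((integrable_const 1).add ((integrable_bp η k).const_mul _)).div_const _
    rw [setOf_label_eq_sgn]
    refine ae_eq_condExp_of_forall_setIntegral_eq (obsAlg_le [] k) ?_ ?_ ?_ ?_
    · exact (integrable_const 1).indicator (measurableSet_flipped b)
    · exact fun s _ _ => hint.integrableOn
    · intro A hA _
      have hA' := obsAlg_le _ _ _ hA
      have hv : view k ⁻¹' A = A := view_preimage_of_measurableSet le_rfl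
        ((le_sup_left : obsAlg [] k ≤ obsAlg [] k ⊔ noiseAlg []) _ hA)
      have h := posterior_view d η ν k b hA'
      rw [hv] at h
      rw [integral_eq_lintegral_of_nonneg_ae
        (ae_of_all _ fun ω => posterior_nonneg η k b ω) hint.integrableOn.aestronglyMeasurable, ← h,
        setIntegral_indicator (measurableSet_flipped b), Set.inter_comm]
      simp [measureReal_def]
    · exact hm.aestronglyMeasurable
  have h1 := key false
  have h2 := key true
  simp only [sgn_true, sgn_false] at h1 h2
  unfold magnetization
  filter_upwards [h1, h2] with ω h1 h2
  rw [Pi.sub_apply, ← h1, ← h2]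
  ring

/-- Let `f` be the sign of `X_{k+1}`. It is visible from level `k + 1` and so from level `k` too,
whence `E|X_{k+1}| = E[σ f] = E[X_k f] ≤ E|X_k|`. -/
lemma integral_abs_bp_succ_le (k : ℕ) :
    ∫ ω, |bp (theta η) (k + 1) ω| ∂law d η ν ≤ ∫ ω, |bp (theta η) k ω| ∂law d η ν := by
  let f : Config E → ℝ := fun ω => if 0 ≤ bp (theta η) (k + 1) ω then 1 else -1
  have hf' : Measurable[obsAlg [] (k + 1) ⊔ noiseAlg []] f := by
    refine Measurable.mono ?_ (le_sup_left : obsAlg [] (k + 1) ≤ _) le_rfl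
    exact Measurable.ite ((measurable_obsAlg_bp _ (k + 1)) measurableSet_Ici)
      measurable_const measurable_const
  have hf : Measurable f := hf'.mono (obsAlg_sup_noiseAlg_le _ _) le_rfl
  have hf1 : ∀ ω, |f ω| ≤ 1 := by
    intro ω
    simp only [f]
    split_ifs <;> simp
  have h1 : ∀ ω, |bp (theta η) (k + 1) ω| = bp (theta η) (k + 1) ω * f ω := by
    intro ω
    simp only [f]
    split_ifs with h
    · rw [abs_of_nonneg h, mul_one]
    · rw [abs_of_neg (not_le.1 h)]; ring
  simp only [h1]
  rw [integral_bp_mul d η ν hf hf1 (fun ω => eq_comp_view_of_measurable le_rfl hf' ω),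
    ← integral_bp_mul d η ν hf hf1 (fun ω => eq_comp_view_of_measurable (Nat.le_succ k) hf' ω)]
  refine integral_mono ?_ (integrable_bp η k).abs fun ω => ?_
  · refine integrable_of_abs_le (M := 1) ((measurable_bp _ k).mul hf) fun ω => ?_
    rw [abs_mul]
    exact mul_le_one₀ (abs_bp_le (abs_theta_le η) k ω) (abs_nonneg _) (hf1 ω)
  · calc bp (theta η) k ω * f ω ≤ |bp (theta η) k ω * f ω| := le_abs_self _
      _ = |bp (theta η) k ω| * |f ω| := abs_mul _ _
      _ ≤ |bp (theta η) k ω| := mul_le_of_le_one_right (abs_nonneg _) (hf1 ω)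

lemma exists_tendsto_integral_abs_magnetization :
    ∃ L : ℝ, Tendsto (fun k => ∫ ω, |bp (theta η) k ω| ∂law d η ν) atTop (𝓝 L) :=
  ⟨_, tendsto_atTop_ciInf (antitone_nat_of_succ_le (integral_abs_bp_succ_le d η ν))
    ⟨0, by rintro _ ⟨k, rfl⟩; exact integral_nonneg fun ω => abs_nonneg _⟩⟩

/-- Estimators of the root label that are attached to the vertices of the tree: the properties of
an admissible family, seen from the vertices. -/
structure IsEstimator (c ε : ℝ) (K : ℕ) (y : List ℕ → ℕ → Config E → ℝ) : Prop where
  measurable_alg : ∀ u, ∀ k ≥ K, Measurable[obsAlg [] k ⊔ noiseAlg []] (y u k)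
  abs_le : ∀ u, ∀ k ≥ K, ∀ ω, |y u k ω| ≤ 1
  recursion : ∀ u, ∀ k ≥ K, ∀ᵐ ω ∂law d η ν, y u (k + 1) ω =
    gmap (offspring ω []) fun i => theta η * y (u ++ [i]) k (sub i ω)
  map_eq : ∀ u, ∀ k ≥ K, ((law d η ν).restrict {ω | flipped ω [] = false}).map (y u k) =
    ((law d η ν).restrict {ω | flipped ω [] = true}).map fun ω => -y u k ω
  exists_good : ∀ u, ∀ k ≥ K, ∃ G, MeasurableSet[obsAlg [] k ⊔ noiseAlg []] G ∧
    (law d η ν).real Gᶜ ≤ Real.exp (-c * d) ∧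
    ∫ ω in {ω | flipped ω [] = false} ∩ G, (1 - y u k ω) ∂law d η ν ≤ ε / 2

end

/-! ### From an admissible family to estimators seen from the root. -/

section

lemma setOf_label_sh {E : Type*} (u : List ℕ) (b : Bool) :
    {ω : Config E | label ω u = sgn b} = sh u ⁻¹' {ω | flipped ω [] = b} := by
  rw [← setOf_label_eq_sgn]
  ext ω
  simp [label_sh]

variable {E : Type*} [MeasurableSpace E] (d : ℝ≥0) (η : I) (ν : Measure E)
  [IsProbabilityMeasure ν]

lemma ae_of_ae_sh (u : List ℕ) {p : Config E → Prop} (hp : MeasurableSet {ω | p ω})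
    (h : ∀ᵐ ω ∂law d η ν, p (sh u ω)) : ∀ᵐ ω ∂law d η ν, p ω := by
  rw [← (measurePreserving_sh d η ν u).map_eq]
  exact (ae_map_iff (measurable_sh u).aemeasurable hp).2 h

lemma condLaw_eq (u : List ℕ) (b : Bool) :
    condLaw d η ν u (sgn b) = (2 : ENNReal) • (law d η ν).restrict
      (sh u ⁻¹' {ω | flipped ω [] = b}) := by
  rw [condLaw, ProbabilityTheory.cond, setOf_label_sh,
    (measurePreserving_sh d η ν u).measure_preimage (measurableSet_flipped b).nullMeasurableSet,
    law_flipped]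
  congr 1
  rw [ENNReal.ofReal_div_of_pos two_pos]
  simp

lemma map_sh_restrict (u : List ℕ) (b : Bool) :
    ((law d η ν).restrict (sh u ⁻¹' {ω | flipped ω [] = b})).map (sh u) =
      (law d η ν).restrict {ω | flipped ω [] = b} :=
  ((measurePreserving_sh d η ν u).restrict_preimage (measurableSet_flipped b)).map_eq

lemma map_comp_sh_condLaw (u : List ℕ) (b : Bool) {y : Config E → ℝ} (hy : Measurable y) :
    (condLaw d η ν u (sgn b)).map (fun ω => y (sh u ω)) =
      (2 : ENNReal) • ((law d η ν).restrict {ω | flipped ω [] = b}).map y := by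
  rw [condLaw_eq, Measure.map_smul, ← map_sh_restrict d η ν u b,
    Measure.map_map hy (measurable_sh u)]
  rfl

/-- `Y u k` factors as `z u k ∘ sh u` because its σ-algebra is a pullback under `sh u`, and all
almost sure and distributional statements descend since `sh u` preserves the law. Truncation makes
the bound by 1 hold everywhere. -/
lemma exists_isEstimator {c C₀ : ℝ} (hC₀ : 0 < C₀) {Y : List ℕ → ℕ → Config E → ℝ}
    (hY : Admissible d η ν c C₀ Y) (hθ : 0 < theta η ^ 2 * d) :
    ∃ K y, IsEstimator d η ν c (C₀ * min (η : ℝ) (1 - η) / (theta η ^ 2 * d)) K y ∧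
      ∀ k ≥ K, Y [] k =ᵐ[law d η ν] y [] k := by
  obtain ⟨K, hK⟩ := hY
  have hex : ∀ u k, ∃ z : Config E → ℝ, k ≥ K →
      (Measurable[obsAlg [] k ⊔ noiseAlg []] z ∧ Y u k = z ∘ sh u) := by
    intro u k
    by_cases hk : k ≥ K
    · have h := (hK k hk u).1
      rw [obsAlg_eq_comap_sh, noiseAlg_eq_comap_sh, ← MeasurableSpace.comap_sup] at h
      obtain ⟨z, hz, hYz⟩ := @Measurable.exists_eq_measurable_comp _ _ _
        (obsAlg [] k ⊔ noiseAlg []) _ _ _ _ _ h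
      exact ⟨z, fun _ => ⟨hz, hYz⟩⟩
    -- Nothing is known below level `K`, so a dummy estimator is used there.
    · exact ⟨0, fun h => absurd h hk⟩
  choose z hz using hex
  have hzm : ∀ u, ∀ k ≥ K, Measurable (z u k) := fun u k hk =>
    (hz u k hk).1.mono (obsAlg_sup_noiseAlg_le _ _) le_rfl
  have hYz : ∀ u, ∀ k ≥ K, ∀ ω, Y u k ω = z u k (sh u ω) := fun u k hk ω =>
    congrFun (hz u k hk).2 ω
  let y : List ℕ → ℕ → Config E → ℝ := fun u k ω => max (-1) (min 1 (z u k ω))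
  have hyz : ∀ u, ∀ k ≥ K, ∀ᵐ ω ∂law d η ν, y u k ω = z u k ω := by
    intro u k hk
    have h1 : ∀ᵐ ω ∂law d η ν, |z u k ω| ≤ 1 := by
      refine ae_of_ae_sh d η ν u (measurableSet_le (hzm u k hk).abs measurable_const) ?_
      filter_upwards [(hK k hk u).2.1] with ω hω
      rwa [← hYz u k hk]
    filter_upwards [h1] with ω hω
    have := abs_le.1 hω
    simp only [y]
    rw [min_eq_right this.2, max_eq_right this.1]
  have hyalg : ∀ u, ∀ k ≥ K, Measurable[obsAlg [] k ⊔ noiseAlg []] (y u k) := fun u k hk =>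
    (measurable_const.max (measurable_const.min measurable_id) :
      Measurable fun x : ℝ => max (-1) (min 1 x)).comp (hz u k hk).1
  have hym : ∀ u, ∀ k ≥ K, Measurable (y u k) := fun u k hk =>
    (hyalg u k hk).mono (obsAlg_sup_noiseAlg_le _ _) le_rfl
  refine ⟨K, y, ⟨hyalg, ?_, ?_, ?_, ?_⟩, ?_⟩
  · intro u k hk ω
    exact abs_le.2 ⟨le_max_left _ _, max_le (by norm_num) (min_le_left _ _)⟩
  · intro u k hk
    have h1 : ∀ᵐ ω ∂law d η ν, z u (k + 1) ω =
        gmap (offspring ω []) fun i => theta η * z (u ++ [i]) k (sub i ω) := by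
      refine ae_of_ae_sh d η ν u ?_ ?_
      · refine measurableSet_eq_fun (hzm u _ (by omega)) ?_
        refine measurable_nat_comp (measurable_offspring [])
          (F := fun n ω => gmap n fun i => theta η * z (u ++ [i]) k (sub i ω)) fun n => ?_
        exact (measurable_gmap n).comp (measurable_pi_iff.2 fun i =>
          ((hzm _ k hk).comp (measurable_sub i)).const_mul _)
      · filter_upwards [(hK k hk u).2.2.1] with ω hω
        rw [hYz u (k + 1) (by omega)] at hω
        simp only [hYz _ k hk, sh_append_singleton] at hω
        rw [hω, offspring_sh, List.append_nil]
        rfl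
    have h2 : ∀ᵐ ω ∂law d η ν, ∀ i : ℕ, y (u ++ [i]) k (sub i ω) = z (u ++ [i]) k (sub i ω) :=
      ae_all_iff.2 fun i =>
        (measurePreserving_sub d η ν i).quasiMeasurePreserving.ae (hyz _ k hk)
    filter_upwards [h1, h2, hyz u (k + 1) (by omega)] with ω h1 h2 h3
    rw [h3, h1]
    simp only [h2]
  · intro u k hk
    have h1 := (hK k hk u).2.2.2.1
    have hfun : Y u k = fun ω => z u k (sh u ω) := (hz u k hk).2
    have e1 := map_comp_sh_condLaw d η ν u false (hzm u k hk)
    have e2 := map_comp_sh_condLaw d η ν u true (hzm u k hk).neg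
    simp only [sgn_false, sgn_true, Pi.neg_apply] at e1 e2
    rw [hfun, e1] at h1
    simp only at h1
    rw [e2] at h1
    have h2 : ((law d η ν).restrict {ω | flipped ω [] = false}).map (z u k) =
        ((law d η ν).restrict {ω | flipped ω [] = true}).map (-z u k) := by
      ext A hA
      have h3 := congrArg (fun m => m A) h1
      simp only [Measure.smul_apply, smul_eq_mul] at h3
      exact (ENNReal.mul_right_inj two_ne_zero ENNReal.ofNat_ne_top).1 h3
    rw [Measure.map_congr (ae_restrict_of_ae (hyz u k hk)), h2]
    refine Measure.map_congr (ae_restrict_of_ae ?_)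
    filter_upwards [hyz u k hk] with ω hω
    rw [hω]; rfl
  · intro u k hk
    have h1 := (hK k hk u).2.2.2.2
    set ε := C₀ * min (η : ℝ) (1 - η) / (theta η ^ 2 * d) with hε
    have hε0 : 0 ≤ ε := by
      have h0 := η.2.1
      have h1 := η.2.2
      exact div_nonneg (mul_nonneg hC₀.le (le_min h0 (by linarith))) hθ.le
    have hcl := condLaw_eq d η ν u false
    rw [sgn_false] at hcl
    have hfin : IsFiniteMeasure (condLaw d η ν u 1) := by
      unfold condLaw; infer_instance
    set S := {ω | 1 - ε ≤ ((condLaw d η ν u 1)[Y u k | treeAlg u]) ω} with hS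
    have hSm : MeasurableSet[treeAlg u] S :=
      stronglyMeasurable_condExp.measurable measurableSet_Ici
    have hSm' := hSm
    rw [treeAlg_eq_comap_sh] at hSm'
    obtain ⟨G, hG, hGS⟩ := hSm'
    have hG' := treeAlg_le _ _ hG
    have hYint : Integrable (Y u k) (condLaw d η ν u 1) := by
      refine Integrable.of_bound (C := 1) ?_ ?_
      · rw [(hz u k hk).2]
        exact ((hzm u k hk).comp (measurable_sh u)).aestronglyMeasurable
      · refine (cond_absolutelyContinuous (μ := law d η ν)).ae_le ?_
        filter_upwards [(hK k hk u).2.1] with ω hω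
        rwa [Real.norm_eq_abs]
    have hint := setIntegral_condExp (treeAlg_le u) hYint hSm
    -- The set `S` of good trees is tree measurable, so the bound on the conditional expectation
    -- integrates over it.
    have hle : (1 - ε) * (condLaw d η ν u 1).real S ≤ ∫ ω in S, Y u k ω ∂condLaw d η ν u 1 := by
      rw [← hint]
      have h2 := setIntegral_mono_on (μ := condLaw d η ν u 1) (s := S)
        (f := fun _ => 1 - ε) (integrable_const _).integrableOn
        (integrable_condExp (m := treeAlg u) (f := Y u k)).integrableOn
        (treeAlg_le u _ hSm) fun ω hω => hω
      simpa [mul_comm] using h2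
    refine ⟨G, (le_sup_left.trans le_sup_left : treeAlg [] ≤ _) _ hG, ?_, ?_⟩
    · rw [probReal_compl_eq_one_sub hG']
      have h3 : (law d η ν).real S = (law d η ν).real G := by
        rw [← hGS, measureReal_def,
          (measurePreserving_sh d η ν u).measure_preimage hG'.nullMeasurableSet, measureReal_def]
      linarith
    · have hyint : Integrable (fun ω => 1 - z u k ω)
          ((law d η ν).restrict {ω | flipped ω [] = false}) := by
        refine ((integrable_const 1).sub ?_).restrict
        refine Integrable.of_bound (C := 1) (hzm u k hk).aestronglyMeasurable ?_
        filter_upwards [hyz u k hk] with ω hω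
        rw [← hω, Real.norm_eq_abs]
        exact abs_le.2 ⟨le_max_left _ _, max_le (by norm_num) (min_le_left _ _)⟩
      have h4 : ∫ ω in {ω | flipped ω [] = false} ∩ G, (1 - y u k ω) ∂law d η ν =
          ∫ ω in G, (1 - z u k ω) ∂(law d η ν).restrict {ω | flipped ω [] = false} := by
        rw [Measure.restrict_restrict hG', Set.inter_comm]
        refine integral_congr_ae (ae_restrict_of_ae ?_)
        filter_upwards [hyz u k hk] with ω hω
        rw [hω]
      have h5 : ∫ ω in G, (1 - z u k ω) ∂(law d η ν).restrict {ω | flipped ω [] = false} =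
          ∫ ω in S, (1 - Y u k ω) ∂(law d η ν).restrict (sh u ⁻¹' {ω | flipped ω [] = false}) := by
        rw [← map_sh_restrict d η ν u false, setIntegral_map hG' _ (measurable_sh u).aemeasurable,
          hGS]
        · simp only [hYz u k hk]
        · rw [map_sh_restrict]
          exact hyint.aestronglyMeasurable
      -- Conditioning on a label of probability 1/2 doubles the measure, hence `ε / 2` in
      -- `IsEstimator.exists_good`.
      have h6 : ∫ ω in S, (1 - Y u k ω) ∂condLaw d η ν u 1 =
          2 * ∫ ω in S, (1 - Y u k ω)
            ∂(law d η ν).restrict (sh u ⁻¹' {ω | flipped ω [] = false}) := by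
        rw [hcl, Measure.restrict_smul, integral_smul_measure]
        simp
      have h7 : ∫ ω in S, (1 - Y u k ω) ∂condLaw d η ν u 1 ≤ ε := by
        rw [integral_sub (integrable_const _).integrableOn hYint.integrableOn]
        have hS1 : (condLaw d η ν u 1).real S ≤ 1 := by
          have : (condLaw d η ν u 1) S ≤ 1 := by
            unfold condLaw
            exact prob_le_one
          exact ENNReal.toReal_le_of_le_ofReal zero_le_one (by simpa using this)
        have h8 : ∫ _ in S, (1 : ℝ) ∂condLaw d η ν u 1 = (condLaw d η ν u 1).real S := by simp
        rw [h8]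
        nlinarith
      rw [h4, h5]
      linarith
  · intro k hk
    filter_upwards [hyz [] k hk] with ω hω
    rw [hω, hYz [] k hk]
    rfl

end

/-! ### Both the estimator and belief propagation are confident and correct. -/

section

/-- Markov's inequality. The strict inequality lets `t = 0` in, where the integral vanishes and so
does `f` almost everywhere; the noiseless regime needs that case. -/
lemma measureReal_lt_le_of_integral_le {Ω : Type*} [MeasurableSpace Ω] {μ : Measure Ω}
    [IsFiniteMeasure μ] {f : Ω → ℝ} (hf : Integrable f μ) (hf0 : 0 ≤ᵐ[μ] f) {t r : ℝ} (ht : 0 ≤ t)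
    (hr : 0 ≤ r) (h : ∫ ω, f ω ∂μ ≤ r * t) : μ.real {ω | t < f ω} ≤ r := by
  rcases ht.eq_or_lt with rfl | ht
  · rw [mul_zero] at h
    have h1 : f =ᵐ[μ] 0 := (integral_eq_zero_iff_of_nonneg_ae hf0 hf).1
      (le_antisymm h (integral_nonneg_of_ae hf0))
    have h2 : μ {ω | 0 < f ω} = 0 := by
      rw [← nonpos_iff_eq_zero, ← ae_iff.1 h1]
      exact measure_mono fun ω hω => ne_of_gt hω
    simp [measureReal_def, h2, hr]
  · have h1 := mul_meas_ge_le_integral_of_nonneg hf0 hf t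
    have h2 : μ.real {ω | t < f ω} ≤ μ.real {ω | t ≤ f ω} :=
      measureReal_mono fun ω (hω : t < f ω) => hω.le
    nlinarith

variable {E : Type*} [MeasurableSpace E] {d : ℝ≥0} {η : I} {ν : Measure E}
  {c ε : ℝ} {K : ℕ} {y : List ℕ → ℕ → Config E → ℝ}

lemma IsEstimator.measurable (hy : IsEstimator d η ν c ε K y) (u : List ℕ) {k : ℕ} (hk : K ≤ k) :
    Measurable (y u k) :=
  (hy.measurable_alg u k hk).mono (obsAlg_sup_noiseAlg_le _ _) le_rfl

lemma IsEstimator.comp_view (hy : IsEstimator d η ν c ε K y) (u : List ℕ) {k : ℕ} (hk : K ≤ k)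
    (ω : Config E) : y u k (view k ω) = y u k ω :=
  eq_comp_view_of_measurable le_rfl (hy.measurable_alg u k hk) ω

lemma IsEstimator.integrable (hy : IsEstimator d η ν c ε K y) (u : List ℕ) {k : ℕ} (hk : K ≤ k)
    {μ : Measure (Config E)} [IsFiniteMeasure μ] : Integrable (y u k) μ :=
  integrable_of_abs_le (hy.measurable u hk) (hy.abs_le u k hk)

namespace IsEstimator

variable (hy : IsEstimator d η ν c ε K y) (u : List ℕ) {k : ℕ} (hk : K ≤ k)

include hy u hk

lemma setIntegral_flipped_true {h : ℝ → ℝ} (hh : Measurable h) :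
    ∫ ω in {ω | flipped ω [] = true}, h (y u k ω) ∂law d η ν =
      ∫ ω in {ω | flipped ω [] = false}, h (-y u k ω) ∂law d η ν := by
  have hm := hy.measurable u hk
  have h1 := congrArg (fun m => ∫ t, h (-t) ∂m) (hy.map_eq u k hk)
  beta_reduce at h1
  have hh' : Measurable fun t => h (-t) := hh.comp measurable_neg
  rw [integral_map hm.aemeasurable hh'.aestronglyMeasurable,
    integral_map (φ := fun ω => -y u k ω) hm.neg.aemeasurable hh'.aestronglyMeasurable] at h1
  simpa using h1.symm

lemma law_real_flipped_true {A : Set ℝ} (hA : MeasurableSet A) :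
    (law d η ν).real ({ω | flipped ω [] = true} ∩ y u k ⁻¹' A) =
      (law d η ν).real ({ω | flipped ω [] = false} ∩ {ω | -y u k ω ∈ A}) := by
  have h := hy.setIntegral_flipped_true u hk (h := A.indicator 1)
    (measurable_one.indicator hA)
  have hm := hy.measurable u hk
  have h1 : ∀ b, ∀ f : Config E → ℝ, Measurable f →
      ∫ ω in {ω | flipped ω [] = b}, A.indicator (1 : ℝ → ℝ) (f ω) ∂law d η ν =
      (law d η ν).real ({ω | flipped ω [] = b} ∩ f ⁻¹' A) := by
    intro b f hf
    have h2 : ∀ ω, A.indicator (1 : ℝ → ℝ) (f ω) = (f ⁻¹' A).indicator 1 ω := fun ω => by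
      by_cases hω : f ω ∈ A <;> simp [hω]
    rw [integral_congr_ae (ae_of_all _ h2), integral_indicator_one (hf hA),
      measureReal_restrict_apply (hf hA), Set.inter_comm]
  rw [h1 _ _ hm, h1 _ (fun ω => -y u k ω) hm.neg] at h
  exact h

variable [IsProbabilityMeasure ν]

lemma integral_eq_zero : ∫ ω, y u k ω ∂law d η ν = 0 := by
  have h := hy.setIntegral_flipped_true u hk measurable_id
  simp only [id, integral_neg] at h
  rw [← integral_add_compl (measurableSet_flipped true) (hy.integrable u hk),
    compl_flipped_true, h]
  ring

lemma setIntegral_one_sub_le :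
    ∫ ω in {ω | flipped ω [] = false}, (1 - y u k ω) ∂law d η ν ≤
      ε / 2 + 2 * Real.exp (-c * d) := by
  obtain ⟨G, hG, hGc, hGi⟩ := hy.exists_good u k hk
  have hG' := obsAlg_sup_noiseAlg_le _ _ _ hG
  have hint : Integrable (fun ω => 1 - y u k ω)
      ((law d η ν).restrict {ω | flipped ω [] = false}) :=
    (integrable_const 1).sub (hy.integrable u hk)
  rw [← integral_add_compl hG' hint, Measure.restrict_restrict hG', Set.inter_comm]
  refine add_le_add hGi ?_
  calc ∫ ω in Gᶜ, (1 - y u k ω) ∂(law d η ν).restrict {ω | flipped ω [] = false}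
      ≤ ∫ ω in Gᶜ, 2 ∂(law d η ν).restrict {ω | flipped ω [] = false} := by
        refine integral_mono hint.restrict (integrable_const _) fun ω => ?_
        have := (_root_.abs_le.1 (hy.abs_le u k hk ω)).1
        linarith
    _ = 2 * ((law d η ν).restrict {ω | flipped ω [] = false}).real Gᶜ := by
        simp [mul_comm]
    _ ≤ 2 * Real.exp (-c * d) := by
        refine mul_le_mul_of_nonneg_left (le_trans ?_ hGc) zero_le_two
        rw [measureReal_restrict_apply hG'.compl]
        exact measureReal_mono Set.inter_subset_left

lemma law_real_estimator_le {t r : ℝ} (ht : 0 ≤ t) (hr : 0 ≤ r) (hε : ε = r * t) (b : Bool) :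
    (law d η ν).real ({ω | flipped ω [] = b} ∩ {ω | t < 1 - sgn b * y u k ω}) ≤
      r + Real.exp (-c * d) := by
  have hm := hy.measurable u hk
  have key : (law d η ν).real ({ω | flipped ω [] = false} ∩ {ω | t < 1 - y u k ω}) ≤
      r + Real.exp (-c * d) := by
    obtain ⟨G, hG, hGc, hGi⟩ := hy.exists_good u k hk
    have hG' := obsAlg_sup_noiseAlg_le _ _ _ hG
    have hS : MeasurableSet {ω | t < 1 - y u k ω} :=
      measurableSet_lt measurable_const (measurable_const.sub hm)
    have h1 : ((law d η ν).restrict ({ω | flipped ω [] = false} ∩ G)).real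
        {ω | t < 1 - y u k ω} ≤ r := by
      refine measureReal_lt_le_of_integral_le (f := fun ω => 1 - y u k ω)
        ((integrable_const 1).sub (hy.integrable u hk))
        (ae_of_all _ fun ω => ?_) ht hr ?_
      · have := (_root_.abs_le.1 (hy.abs_le u k hk ω)).2
        simp only [Pi.zero_apply]
        linarith
      · have := mul_nonneg hr ht
        linarith
    rw [measureReal_restrict_apply hS] at h1
    calc _ ≤ (law d η ν).real
          (({ω | t < 1 - y u k ω} ∩ ({ω | flipped ω [] = false} ∩ G)) ∪ Gᶜ) := by
          refine measureReal_mono fun ω hω => ?_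
          by_cases hωG : ω ∈ G
          · exact Or.inl ⟨hω.2, hω.1, hωG⟩
          · exact Or.inr hωG
      _ ≤ _ := (measureReal_union_le _ _).trans (add_le_add h1 hGc)
  cases b
  · simpa using key
  · have h2 := hy.law_real_flipped_true u hk (A := {z | t < 1 + z})
      (measurableSet_lt measurable_const (measurable_const.add measurable_id))
    have h3 : {ω | t < 1 - sgn true * y u k ω} = y u k ⁻¹' {z | t < 1 + z} := by
      ext ω; simp
    rw [h3, h2]
    simpa [← sub_eq_add_neg] using key

/-- Confidence passes from `y` to the posterior without comparing them. On `B = {y ≤ 0} ∩ G` the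
label `+` has probability at most `ε/2`, and this probability is `∫_B (1 + X)/2`; Markov's
inequality then bounds the part of `B` with `1 + X > t` by `r`. The label `-` together with `y > 0`,
or a bad tree, accounts for the rest, and reversing all labels handles the label `+`. -/
lemma law_real_bp_le {t r : ℝ} (ht : 0 ≤ t) (hr : 0 ≤ r) (hε : ε = r * t) (b : Bool) :
    (law d η ν).real ({ω | flipped ω [] = b} ∩ {ω | t < 1 - sgn b * bp (theta η) k ω}) ≤
      r + ε / 2 + 3 * Real.exp (-c * d) := by
  have hm := hy.measurable u hk
  have hx := measurable_bp (E := E) (theta η) k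
  have hx1 := abs_bp_le (E := E) (abs_theta_le η) k
  have key : (law d η ν).real ({ω | flipped ω [] = true} ∩ {ω | t < 1 + bp (theta η) k ω}) ≤
      r + ε / 2 + 3 * Real.exp (-c * d) := by
    obtain ⟨G, hG, hGc, hGi⟩ := hy.exists_good u k hk
    have hG' := obsAlg_sup_noiseAlg_le _ _ _ hG
    set B := {ω | y u k ω ≤ 0} ∩ G with hB
    have hBa : MeasurableSet[obsAlg [] k ⊔ noiseAlg []] B :=
      MeasurableSet.inter ((hy.measurable_alg u k hk) measurableSet_Iic) hG
    have hB' := obsAlg_sup_noiseAlg_le _ _ _ hBa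
    have hBv := view_preimage_of_measurableSet le_rfl hBa
    have h1 := posterior_view d η ν k false hB'
    rw [hBv, ← ofReal_integral_eq_lintegral_ofReal] at h1
    rotate_left
    · exact (((integrable_const 1).add ((integrable_bp η k).const_mul _)).div_const _)
    · exact ae_of_all _ fun ω => posterior_nonneg η k false ω
    have h2 : (law d η ν).real ({ω | flipped ω [] = false} ∩ B) =
        ∫ ω in B, (1 + bp (theta η) k ω) / 2 ∂law d η ν := by
      rw [measureReal_def, h1, ENNReal.toReal_ofReal]
      · simp
      · exact integral_nonneg fun ω => posterior_nonneg η k false ω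
    have h3 : (law d η ν).real ({ω | flipped ω [] = false} ∩ B) ≤ ε / 2 := by
      refine le_trans ?_ hGi
      have h4 : (law d η ν).real ({ω | flipped ω [] = false} ∩ B) =
          ∫ ω in {ω | flipped ω [] = false} ∩ G, B.indicator 1 ω ∂law d η ν := by
        rw [integral_indicator_one hB', measureReal_restrict_apply hB']
        congr 1
        ext ω
        simp only [hB, Set.mem_inter_iff]
        tauto
      rw [h4]
      refine integral_mono ((integrable_const 1).indicator hB')
        ((integrable_const 1).sub (hy.integrable u hk)) fun ω => ?_
      have := (_root_.abs_le.1 (hy.abs_le u k hk ω)).2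
      by_cases hω : ω ∈ B
      · have h5 : y u k ω ≤ 0 := hω.1
        simp only [Set.indicator_of_mem hω, Pi.one_apply]
        linarith
      · simp only [Set.indicator_of_notMem hω]
        linarith
    have hS : MeasurableSet {ω : Config E | t < 1 + bp (theta η) k ω} :=
      measurableSet_lt measurable_const (measurable_const.add hx)
    have h5 : ((law d η ν).restrict B).real {ω | t < 1 + bp (theta η) k ω} ≤ r := by
      refine measureReal_lt_le_of_integral_le (f := fun ω => 1 + bp (theta η) k ω)
        ((integrable_const 1).add (integrable_bp η k))
        (ae_of_all _ fun ω => ?_) ht hr ?_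
      · have := (_root_.abs_le.1 (hx1 ω)).1
        simp only [Pi.zero_apply]
        linarith
      · rw [h2, integral_div] at h3
        linarith
    rw [measureReal_restrict_apply hS] at h5
    have h6 : (law d η ν).real ({ω | flipped ω [] = true} ∩ {ω | 0 < y u k ω}) ≤
        ε / 2 + 2 * Real.exp (-c * d) := by
      have h7 := hy.law_real_flipped_true u hk (A := Set.Ioi 0) measurableSet_Ioi
      have h8 : {ω | 0 < y u k ω} = y u k ⁻¹' Set.Ioi 0 := rfl
      rw [h8, h7]
      refine le_trans ?_ (hy.setIntegral_one_sub_le u hk)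
      have hN : MeasurableSet {ω | -y u k ω ∈ Set.Ioi (0 : ℝ)} := hm.neg measurableSet_Ioi
      rw [Set.inter_comm, ← measureReal_restrict_apply hN, ← integral_indicator_one hN]
      refine integral_mono ((integrable_const 1).indicator hN)
        ((integrable_const 1).sub (hy.integrable u hk)) fun ω => ?_
      have := (_root_.abs_le.1 (hy.abs_le u k hk ω)).2
      by_cases hω : ω ∈ {ω | -y u k ω ∈ Set.Ioi (0 : ℝ)}
      · have h9 : 0 < -y u k ω := hω
        simp only [Set.indicator_of_mem hω, Pi.one_apply]
        linarith
      · simp only [Set.indicator_of_notMem hω]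
        linarith
    calc _ ≤ (law d η ν).real (({ω | t < 1 + bp (theta η) k ω} ∩ B) ∪
          (({ω | flipped ω [] = true} ∩ {ω | 0 < y u k ω}) ∪ Gᶜ)) := by
          refine measureReal_mono fun ω hω => ?_
          by_cases hωG : ω ∈ G
          · by_cases h0 : y u k ω ≤ 0
            · exact Or.inl ⟨hω.2, h0, hωG⟩
            · exact Or.inr (Or.inl ⟨hω.1, not_le.1 h0⟩)
          · exact Or.inr (Or.inr hωG)
      _ ≤ r + (ε / 2 + 2 * Real.exp (-c * d) + Real.exp (-c * d)) :=
          (measureReal_union_le _ _).trans (add_le_add h5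
            ((measureReal_union_le _ _).trans (add_le_add h6 hGc)))
      _ = _ := by ring
  have hcongr : ∀ b, (law d η ν).real
      ({ω | flipped ω [] = b} ∩ {ω | t < 1 - sgn b * bp (theta η) k ω}) =
      (law d η ν).real ({ω | flipped ω [] = !b} ∩ {ω | t < 1 - sgn (!b) * bp (theta η) k ω}) := by
    intro b
    have hS : MeasurableSet ({ω : Config E | flipped ω [] = b} ∩
        {ω | t < 1 - sgn b * bp (theta η) k ω}) :=
      (measurableSet_flipped b).inter
        (measurableSet_lt measurable_const (measurable_const.sub (hx.const_mul _)))
    rw [measureReal_def, ← (measurePreserving_twist d η ν true).measure_preimage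
      hS.nullMeasurableSet, measureReal_def]
    congr 2
    ext ω
    simp only [Set.mem_preimage, Set.mem_inter_iff, Set.mem_ofPred_eq, bp_twist, flipped, twist]
    cases (ω []).2.1 <;> cases b <;> simp
  have key' : (law d η ν).real
      ({ω | flipped ω [] = true} ∩ {ω | t < 1 - sgn true * bp (theta η) k ω}) ≤
      r + ε / 2 + 3 * Real.exp (-c * d) := by simpa using key
  cases b
  · rw [hcongr]; exact key'
  · exact key'

end IsEstimator

end

/-! ### Poisson averages of sums over children, and tail bounds for messages. -/

section

lemma hasSum_exp (x : ℝ) : HasSum (fun n : ℕ => x ^ n / n.factorial) (Real.exp x) := by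
  rw [Real.exp_eq_exp_ℝ]
  exact NormedSpace.expSeries_div_hasSum_exp x

/-- This and the next sum are the first two derivatives in `q` of the generating function
`e^(-d(1-q))`. The truncated subtraction in the exponents is harmless because the coefficients
vanish there. -/
lemma hasSum_poisson_mul_pow (d : ℝ≥0) (q : ℝ) :
    HasSum (fun n : ℕ => (poissonMeasure d).real {n} * (n * q ^ (n - 1)))
      (d * Real.exp (-d * (1 - q))) := by
  have h := (hasSum_exp (d * q)).mul_left (d * Real.exp (-d))
  have h1 : (fun n : ℕ => (poissonMeasure d).real {n + 1} *
      (((n + 1 : ℕ) : ℝ) * q ^ (n + 1 - 1))) =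
      fun n : ℕ => d * Real.exp (-d) * ((d * q) ^ n / n.factorial) := by
    ext n
    rw [poissonMeasure_real_singleton, Nat.factorial_succ, add_tsub_cancel_right, mul_pow]
    push_cast
    field_simp
    ring
  have h2 : (d * Real.exp (-d) * Real.exp (d * q) : ℝ) = d * Real.exp (-d * (1 - q)) := by
    rw [mul_assoc, ← Real.exp_add]
    ring_nf
  rw [← h1, h2] at h
  rw [← hasSum_nat_add_iff' 1]
  simpa using h

lemma hasSum_poisson_mul_pow_two (d : ℝ≥0) (q : ℝ) :
    HasSum (fun n : ℕ => (poissonMeasure d).real {n} * (n * (n - 1) * q ^ (n - 2)))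
      (d ^ 2 * Real.exp (-d * (1 - q))) := by
  have h := (hasSum_exp (d * q)).mul_left (d ^ 2 * Real.exp (-d))
  have h1 : (fun n : ℕ => (poissonMeasure d).real {n + 2} *
      (((n + 2 : ℕ) : ℝ) * (((n + 2 : ℕ) : ℝ) - 1) * q ^ (n + 2 - 2))) =
      fun n : ℕ => d ^ 2 * Real.exp (-d) * ((d * q) ^ n / n.factorial) := by
    ext n
    have : ((n + 2).factorial : ℝ) = (n + 2) * ((n + 1) * n.factorial) := by
      rw [Nat.factorial_succ, Nat.factorial_succ]
      push_cast
      ring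
    rw [poissonMeasure_real_singleton, this, add_tsub_cancel_right, mul_pow]
    push_cast
    field_simp
    ring
  have h2 : (d ^ 2 * Real.exp (-d) * Real.exp (d * q) : ℝ) = d ^ 2 * Real.exp (-d * (1 - q)) := by
    rw [mul_assoc, ← Real.exp_add]
    ring_nf
  rw [← h1, h2] at h
  rw [← hasSum_nat_add_iff' 2]
  simpa [Finset.sum_range_succ] using h

lemma iUnion_rootEvent {E : Type*} (b : Bool) :
    ⋃ n, (rootEvent b n : Set (Config E)) = {ω | flipped ω [] = b} := by
  ext ω
  simp [rootEvent]

lemma pairwise_disjoint_rootEvent {E : Type*} (b : Bool) :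
    Pairwise (Function.onFun Disjoint fun n => (rootEvent b n : Set (Config E))) := by
  intro m n hmn
  rw [Function.onFun, Set.disjoint_left]
  intro ω h1 h2
  exact hmn (h1.2.symm.trans h2.2)

variable {E : Type*} [MeasurableSpace E] (d : ℝ≥0) (η : I) (ν : Measure E)
  [IsProbabilityMeasure ν]

/-- If a function of the configuration is bounded by a sum over the children of the root of
products over all the children, so is its expectation. -/
lemma setLIntegral_flipped_le_of_sum_prod (b : Bool) (F : Config E → ENNReal)
    (φ ψ : ℕ → Config E → ENNReal) (hφm : ∀ i, Measurable (φ i)) (hψm : ∀ i, Measurable (ψ i))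
    {a q : ℝ} (ha : 0 ≤ a) (hq : 0 ≤ q)
    (hφ : ∀ i, ∫⁻ ω, φ i ω ∂childLaw d η ν b ≤ ENNReal.ofReal a)
    (hψ : ∀ i, ∫⁻ ω, ψ i ω ∂childLaw d η ν b ≤ ENNReal.ofReal q)
    (hF : ∀ᵐ ω ∂law d η ν, flipped ω [] = b → F ω ≤ ∑ i ∈ Finset.range (offspring ω []),
      φ i (sub i ω) * ∏ j ∈ (Finset.range (offspring ω [])).erase i, ψ j (sub j ω)) :
    ∫⁻ ω in {ω | flipped ω [] = b}, F ω ∂law d η ν ≤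
      ENNReal.ofReal (1 / 2 * a * (d * Real.exp (-d * (1 - q)))) := by
  classical
  have hterm : ∀ n, ∫⁻ ω in rootEvent b n, F ω ∂law d η ν ≤
      ENNReal.ofReal (1 / 2 * a * ((poissonMeasure d).real {n} * (n * q ^ (n - 1)))) := by
    intro n
    -- For each distinguished child `i`, `φ` at `i` and `ψ` elsewhere form one product over all
    -- children, which independence can evaluate.
    let h : ℕ → ℕ → Config E → ENNReal := fun i j => if j = i then φ i else ψ j
    have hh : ∀ i j, Measurable (h i j) := by
      intro i j
      simp only [h]
      split_ifs
      exacts [hφm i, hψm j]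
    have hprod : ∀ i ∈ Finset.range n, ∀ ω : Config E,
        φ i (sub i ω) * ∏ j ∈ (Finset.range n).erase i, ψ j (sub j ω) =
        ∏ j ∈ Finset.range n, h i j (sub j ω) := by
      intro i hi ω
      rw [← Finset.mul_prod_erase _ _ hi]
      congr 1
      · simp [h]
      · refine Finset.prod_congr rfl fun j hj => ?_
        simp [h, Finset.ne_of_mem_erase hj]
    calc ∫⁻ ω in rootEvent b n, F ω ∂law d η ν
        ≤ ∫⁻ ω in rootEvent b n, ∑ i ∈ Finset.range n, ∏ j ∈ Finset.range n, h i j (sub j ω)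
            ∂law d η ν := by
          refine setLIntegral_mono_ae' (measurableSet_rootEvent b n) ?_
          filter_upwards [hF] with ω hω hωn
          refine (hω hωn.1).trans (le_of_eq ?_)
          rw [hωn.2]
          exact Finset.sum_congr rfl fun i hi => hprod i hi ω
      _ = ∑ i ∈ Finset.range n, ∫⁻ ω in rootEvent b n, ∏ j ∈ Finset.range n, h i j (sub j ω)
            ∂law d η ν :=
          lintegral_finsetSum _ fun i _ => Finset.measurable_prod _ fun j _ =>
            (hh i j).comp (measurable_sub j)
      _ ≤ ∑ i ∈ Finset.range n, ENNReal.ofReal (1 / 2) * poissonMeasure d {n} *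
            (ENNReal.ofReal a * ENNReal.ofReal q ^ (n - 1)) := by
          refine Finset.sum_le_sum fun i hi => ?_
          rw [setLIntegral_rootEvent_prod d η ν b n _ _ (hh i)]
          refine mul_le_mul_right ?_ _
          rw [← Finset.mul_prod_erase _ _ hi]
          refine mul_le_mul' (by simpa [h] using hφ i) ?_
          calc ∏ j ∈ (Finset.range n).erase i, ∫⁻ ω, h i j ω ∂childLaw d η ν b
              ≤ ∏ j ∈ (Finset.range n).erase i, ENNReal.ofReal q := by
                refine Finset.prod_le_prod' fun j hj => ?_
                simpa [h, Finset.ne_of_mem_erase hj] using hψ j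
            _ = ENNReal.ofReal q ^ (n - 1) := by
                rw [Finset.prod_const, Finset.card_erase_of_mem hi, Finset.card_range]
      _ = _ := by
          rw [Finset.sum_const, Finset.card_range, nsmul_eq_mul,
            ← ofReal_measureReal (μ := poissonMeasure d) (s := {n}) (by finiteness),
            ← ENNReal.ofReal_pow hq, ← ENNReal.ofReal_mul ha, ← ENNReal.ofReal_mul (by norm_num),
            ← ENNReal.ofReal_mul (by positivity), ← ENNReal.ofReal_natCast,
            ← ENNReal.ofReal_mul (by positivity)]
          congr 1
          ring
  have hsum := (hasSum_poisson_mul_pow d q).mul_left (1 / 2 * a)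
  rw [← iUnion_rootEvent, lintegral_iUnion (measurableSet_rootEvent b)
    (pairwise_disjoint_rootEvent b), ← hsum.tsum_eq,
    ENNReal.ofReal_tsum_of_nonneg (fun n => by positivity) hsum.summable]
  exact ENNReal.tsum_le_tsum hterm

lemma lintegral_le_of_sum_prod (F : Config E → ENNReal) (φ ψ : Bool → ℕ → Config E → ENNReal)
    (hφm : ∀ b i, Measurable (φ b i)) (hψm : ∀ b i, Measurable (ψ b i))
    {a q : ℝ} (ha : 0 ≤ a) (hq : 0 ≤ q)
    (hφ : ∀ b i, ∫⁻ ω, φ b i ω ∂childLaw d η ν b ≤ ENNReal.ofReal a)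
    (hψ : ∀ b i, ∫⁻ ω, ψ b i ω ∂childLaw d η ν b ≤ ENNReal.ofReal q)
    (hF : ∀ b, ∀ᵐ ω ∂law d η ν, flipped ω [] = b → F ω ≤ ∑ i ∈ Finset.range (offspring ω []),
      φ b i (sub i ω) * ∏ j ∈ (Finset.range (offspring ω [])).erase i, ψ b j (sub j ω)) :
    ∫⁻ ω, F ω ∂law d η ν ≤ ENNReal.ofReal (a * (d * Real.exp (-d * (1 - q)))) := by
  have key := fun b => setLIntegral_flipped_le_of_sum_prod d η ν b F (φ b) (ψ b) (hφm b) (hψm b)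
    ha hq (hφ b) (hψ b) (hF b)
  rw [lintegral_eq_add_flipped]
  refine (add_le_add (key true) (key false)).trans (le_of_eq ?_)
  rw [← ENNReal.ofReal_add (by positivity) (by positivity)]
  congr 1
  ring

/-- The label of a child that is more likely when the label of its parent is `sgn b`. -/
def likely (η : I) (b : Bool) : Bool := if 0 ≤ theta η then b else !b

lemma sgn_mul_theta (b : Bool) : sgn b * theta η = |theta η| * sgn (likely η b) := by
  unfold likely
  split_ifs with h
  · rw [abs_of_nonneg h, mul_comm]
  · rw [abs_of_neg (not_le.1 h), sgn_not]; ring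

lemma abs_theta_eq : |theta η| = 1 - 2 * min (η : ℝ) (1 - η) := by
  unfold theta
  rcases le_total (η : ℝ) (1 - η) with h | h
  · rw [min_eq_left h, abs_of_nonneg (by linarith)]
  · rw [min_eq_right h, abs_of_nonpos (by linarith)]; ring

lemma childLaw_eq_add (b : Bool) {A : Set (Config E)} (hA : MeasurableSet A) :
    (childLaw d η ν b).real A = ∑ b', (1 + sgn b * theta η * sgn b') *
      (law d η ν).real ({ω | flipped ω [] = b'} ∩ A) := by
  have h0 : ∀ b', 0 ≤ 1 + sgn b * theta η * sgn b' := fun b' => by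
    rw [mul_assoc]
    exact sgn_mul_le (by rw [abs_mul, abs_sgn, mul_one]; exact abs_theta_le η)
  have h : childLaw d η ν b A = ENNReal.ofReal (∑ b', (1 + sgn b * theta η * sgn b') *
      (law d η ν).real ({ω | flipped ω [] = b'} ∩ A)) := by
    rw [childLaw, withDensity_apply _ hA, lintegral_eq_add_flipped, Fintype.sum_bool,
      ENNReal.ofReal_add (mul_nonneg (h0 _) measureReal_nonneg)
        (mul_nonneg (h0 _) measureReal_nonneg)]
    have h1 : ∀ b', ∫⁻ ω in {ω | flipped ω [] = b'},
        ENNReal.ofReal (1 + sgn b * theta η * label ω []) ∂(law d η ν).restrict A =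
        ENNReal.ofReal ((1 + sgn b * theta η * sgn b') *
          (law d η ν).real ({ω | flipped ω [] = b'} ∩ A)) := by
      intro b'
      have h2 : ∀ ω ∈ {ω : Config E | flipped ω [] = b'},
          ENNReal.ofReal (1 + sgn b * theta η * label ω []) =
            ENNReal.ofReal (1 + sgn b * theta η * sgn b') := by
        intro ω hω
        rw [label_nil]
        simp only [Set.mem_ofPred_eq, flipped] at hω
        rw [hω]
      rw [setLIntegral_congr_fun (measurableSet_flipped b') h2, lintegral_const,
        Measure.restrict_apply .univ, Set.univ_inter,
        Measure.restrict_apply (measurableSet_flipped b'), ENNReal.ofReal_mul (h0 b'),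
        ofReal_measureReal (by finiteness)]
    rw [h1, h1]
  rw [measureReal_def, h, ENNReal.toReal_ofReal]
  exact Finset.sum_nonneg fun b' _ => mul_nonneg (h0 _) measureReal_nonneg

/-- The likely label has density `1 + |θ| ≤ 2`. The other one has density `1 - |θ| = 2 min(η, 1-η)`
and probability at most 1/2. -/
lemma childLaw_real_le (b : Bool) {A : Set (Config E)} (hA : MeasurableSet A) :
    (childLaw d η ν b).real A ≤
      2 * (law d η ν).real ({ω | flipped ω [] = likely η b} ∩ A) + min (η : ℝ) (1 - η) := by
  have h0 := η.2.1
  have h1 := η.2.2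
  have hmin : 0 ≤ min (η : ℝ) (1 - η) := le_min h0 (by linarith)
  have h2 : ∀ b', (law d η ν).real ({ω | flipped ω [] = b'} ∩ A) ≤ 1 / 2 := fun b' => by
    rw [← law_real_flipped d η ν b']
    exact measureReal_mono Set.inter_subset_left
  have h3 := h2 (!likely η b)
  have h4 : 0 ≤ (law d η ν).real ({ω | flipped ω [] = likely η b} ∩ A) := measureReal_nonneg
  rw [childLaw_eq_add d η ν b hA, Fintype.sum_bool, sgn_mul_theta, abs_theta_eq]
  cases hl : likely η b
  · rw [hl] at h3 h4
    simp only [Bool.not_false, sgn_true, sgn_false] at h3 ⊢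
    nlinarith
  · rw [hl] at h3 h4
    simp only [Bool.not_true, sgn_true, sgn_false] at h3 ⊢
    nlinarith

/-- A child message that points to the correct label with nearly full confidence is likely. -/
lemma childLaw_real_message_le (b : Bool) {z : Config E → ℝ} (hz : Measurable z)
    (hz1 : ∀ ω, |z ω| ≤ 1) {r : ℝ}
    (h : ∀ b', (law d η ν).real
      ({ω | flipped ω [] = b'} ∩ {ω | min (η : ℝ) (1 - η) < 1 - sgn b' * z ω}) ≤ r) :
    (childLaw d η ν b).real {ω | 3 * min (η : ℝ) (1 - η) < 1 - sgn b * (theta η * z ω)} ≤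
      2 * r + min (η : ℝ) (1 - η) := by
  have h0 := η.2.1
  have h1 := η.2.2
  have hmin : 0 ≤ min (η : ℝ) (1 - η) := le_min h0 (by linarith)
  have hA : MeasurableSet {ω | 3 * min (η : ℝ) (1 - η) < 1 - sgn b * (theta η * z ω)} :=
    measurableSet_lt measurable_const (measurable_const.sub ((hz.const_mul _).const_mul _))
  refine (childLaw_real_le d η ν b hA).trans ?_
  gcongr
  refine le_trans (measureReal_mono ?_) (h (likely η b))
  refine Set.inter_subset_inter_right _ fun ω hω => ?_
  simp only [Set.mem_ofPred_eq] at hω ⊢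
  rw [← mul_assoc, sgn_mul_theta, abs_theta_eq, mul_assoc] at hω
  have h2 : sgn (likely η b) * z ω ≤ 1 := by
    refine (le_abs_self _).trans ?_
    rw [abs_mul, abs_sgn, one_mul]
    exact hz1 ω
  -- With `w = sgn (likely η b) * z ω ≤ 1` and `s = min(η, 1-η)`, the bound `1 - w ≤ s` would give
  -- `1 - (1 - 2s)w = (1 - w) + 2sw ≤ 3s`.
  nlinarith

end

/-! ### The noiseless regime. -/

section

lemma indicator_le_sum_prod {E : Type*} {A : Set (Config E)} {S T : ℕ → Set (Config E)} {n : ℕ}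
    {ω : Config E}
    (h : ω ∈ A → ∃ i < n, sub i ω ∈ S i ∧ ∀ j < n, j ≠ i → sub j ω ∈ T j) :
    A.indicator (1 : Config E → ENNReal) ω ≤ ∑ i ∈ Finset.range n,
      (S i).indicator 1 (sub i ω) *
        ∏ j ∈ (Finset.range n).erase i, (T j).indicator 1 (sub j ω) := by
  by_cases hω : ω ∈ A
  · obtain ⟨i, hi, hS, hT⟩ := h hω
    refine le_trans (le_of_eq ?_) (Finset.single_le_sum (fun _ _ => zero_le)
      (Finset.mem_range.2 hi))
    rw [Set.indicator_of_mem hω, Set.indicator_of_mem hS, Finset.prod_eq_one]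
    · simp
    · intro j hj
      rw [Set.indicator_of_mem (hT j (Finset.mem_range.1 (Finset.mem_of_mem_erase hj))
        (Finset.ne_of_mem_erase hj))]
      rfl
  · simp [hω]

lemma gmap_eq_one {n : ℕ} {t : ℕ → ℝ} (h : ∀ i < n, t i ≠ -1) {j : ℕ} (hj : j < n)
    (h1 : t j = 1) : gmap n t = 1 := by
  have hB : ∏ i ∈ Finset.range n, (1 - t i) = 0 :=
    Finset.prod_eq_zero (Finset.mem_range.2 hj) (by rw [h1, sub_self])
  have hA : ∏ i ∈ Finset.range n, (1 + t i) ≠ 0 := Finset.prod_ne_zero_iff.2 fun i hi h0 =>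
    h i (Finset.mem_range.1 hi) (by linarith)
  rw [gmap, hB, sub_zero, add_zero, div_self hA]

lemma exists_of_gmap_eq_neg_one {n : ℕ} {t : ℕ → ℝ} (h : gmap n t = -1) :
    (∃ i < n, t i = -1) ∧ ∀ j < n, t j ≠ 1 := by
  unfold gmap at h
  set A := ∏ i ∈ Finset.range n, (1 + t i) with hA
  set B := ∏ i ∈ Finset.range n, (1 - t i) with hB
  have h0 : A + B ≠ 0 := fun h0 => by simp [h0] at h
  have hA0 : A = 0 := by
    rw [div_eq_iff h0] at h
    linarith
  have hB0 : B ≠ 0 := by rwa [hA0, zero_add] at h0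
  constructor
  · obtain ⟨i, hi, h1⟩ := Finset.prod_eq_zero_iff.1 hA0
    exact ⟨i, Finset.mem_range.1 hi, by linarith⟩
  · intro j hj h1
    exact Finset.prod_ne_zero_iff.1 hB0 j (Finset.mem_range.2 hj) (by rw [h1, sub_self])

/-- In the absence of messages `-1`, a single child with both messages equal to 1 forces both
outputs to be 1. So if the outputs differ, no child is certain in both families. -/
lemma exists_of_gmap_ne {n : ℕ} {t τ : ℕ → ℝ} (h : gmap n t ≠ gmap n τ) (ht : ∀ i < n, t i ≠ -1)
    (hτ : ∀ i < n, τ i ≠ -1) :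
    ∃ i < n, t i ≠ τ i ∧ ∀ j < n, j ≠ i → ¬(t j = 1 ∧ τ j = 1) := by
  obtain ⟨i, hi, hne⟩ : ∃ i < n, t i ≠ τ i := by
    by_contra! h1
    exact h (gmap_congr h1)
  refine ⟨i, hi, hne, fun j hj _ h1 => h ?_⟩
  rw [gmap_eq_one ht hj h1.1, gmap_eq_one hτ hj h1.2]

variable {E : Type*} [MeasurableSpace E]

/-- A union bound over the exceptional child, the other children being independent of it; `a` is its
cost and `q` the damping by each of the others. -/
lemma law_real_le_of_exists (d : ℝ≥0) (η : I) (ν : Measure E)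
    [IsProbabilityMeasure ν] (b : Bool) {A : Set (Config E)} (hA : MeasurableSet A)
    {S T : ℕ → Set (Config E)} (hS : ∀ i, MeasurableSet (S i)) (hT : ∀ i, MeasurableSet (T i))
    {a q : ℝ} (ha : 0 ≤ a) (hq : 0 ≤ q) (hSa : ∀ i, (childLaw d η ν b).real (S i) ≤ a)
    (hTq : ∀ i, (childLaw d η ν b).real (T i) ≤ q)
    (h : ∀ᵐ ω ∂law d η ν, flipped ω [] = b → ω ∈ A → ∃ i < offspring ω [], sub i ω ∈ S i ∧
      ∀ j < offspring ω [], j ≠ i → sub j ω ∈ T j) :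
    (law d η ν).real ({ω | flipped ω [] = b} ∩ A) ≤
      1 / 2 * a * (d * Real.exp (-d * (1 - q))) := by
  have h1 := setLIntegral_flipped_le_of_sum_prod d η ν b (A.indicator 1)
    (fun i => (S i).indicator 1) (fun i => (T i).indicator 1)
    (fun i => measurable_one.indicator (hS i)) (fun i => measurable_one.indicator (hT i)) ha hq
    (fun i => by
      rw [lintegral_indicator_one (hS i), ← ofReal_measureReal]
      exact ENNReal.ofReal_le_ofReal (hSa i))
    (fun i => by
      rw [lintegral_indicator_one (hT i), ← ofReal_measureReal]
      exact ENNReal.ofReal_le_ofReal (hTq i))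
    (by filter_upwards [h] with ω hω hb using indicator_le_sum_prod (hω hb))
  rw [lintegral_indicator_one hA, Measure.restrict_apply hA, Set.inter_comm] at h1
  exact ENNReal.toReal_le_of_le_ofReal (by positivity) h1

variable {d : ℝ≥0} {η : I} {ν : Measure E} [IsProbabilityMeasure ν]
  {c ε : ℝ} {K : ℕ} {y : List ℕ → ℕ → Config E → ℝ}

/-- The posterior is never certain of a false label: under `childLaw` the density `1 + t` of the
message `t` vanishes at `t = -1`. For `Y` this can fail, which is why `law_real_wrong_le` is needed.
-/
lemma ae_message_ne_neg_one (k : ℕ) (b : Bool) :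
    ∀ᵐ ω ∂law d η ν, flipped ω [] = b → ∀ i < offspring ω [],
      sgn b * (theta η * bp (theta η) k (sub i ω)) ≠ -1 := by
  have hm : Measurable fun ω : Config E => sgn b * (theta η * bp (theta η) k ω) :=
    ((measurable_bp _ k).const_mul _).const_mul _
  set S : Set (Config E) := {ω | sgn b * (theta η * bp (theta η) k ω) = -1} with hS
  have hSm : MeasurableSet S := hm (measurableSet_singleton (-1))
  have h0 : childLaw d η ν b S = 0 := by
    rw [← lintegral_indicator_one hSm, lintegral_childLaw_eq d η ν b
      (measurable_one.indicator hSm) (k := k)]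
    · refine (lintegral_congr fun ω => ?_).trans lintegral_zero
      by_cases hω : ω ∈ S
      · rw [show sgn b * (theta η * bp (theta η) k ω) = -1 from hω]
        simp
      · simp [hω]
    · intro ω
      have : view k ω ∈ S ↔ ω ∈ S := by simp only [hS, Set.mem_ofPred_eq, bp_view _ le_rfl]
      by_cases hω : ω ∈ S <;> simp [this, hω]
  have hA : MeasurableSet {ω : Config E | ∃ i < offspring ω [], sub i ω ∈ S} := by
    have : {ω : Config E | ∃ i < offspring ω [], sub i ω ∈ S} =
        ⋃ i, {ω | i < offspring ω []} ∩ sub i ⁻¹' S := by ext; simp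
    rw [this]
    exact .iUnion fun i => (measurableSet_lt measurable_const (measurable_offspring [])).inter
      (measurable_sub i hSm)
  have h1 := law_real_le_of_exists d η ν b hA (S := fun _ => S) (T := fun _ => Set.univ)
    (fun _ => hSm) (fun _ => .univ) le_rfl zero_le_one (fun _ => by simp [measureReal_def, h0])
    (fun _ => by simp) (ae_of_all _ fun ω _ ⟨i, hi, h⟩ => ⟨i, hi, h, by simp⟩)
  simp only [mul_zero, zero_mul] at h1
  have h2 := (measureReal_eq_zero_iff).1 (le_antisymm h1 measureReal_nonneg)
  rw [← compl_mem_ae_iff] at h2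
  filter_upwards [h2] with ω hω hb i hi h3
  exact hω ⟨hb, i, hi, h3⟩

lemma sgn_mul_theta_mul (hη : min (η : ℝ) (1 - η) = 0) (b : Bool) (z : ℝ) :
    sgn b * (theta η * z) = sgn (likely η b) * z := by
  rw [← mul_assoc, sgn_mul_theta, abs_theta_eq, hη]
  ring

lemma childLaw_real_le_of_min_eq_zero (hη : min (η : ℝ) (1 - η) = 0) (b : Bool)
    {A : Set (Config E)} (hA : MeasurableSet A) {a : ℝ}
    (h : (law d η ν).real ({ω | flipped ω [] = likely η b} ∩ A) ≤ a) :
    (childLaw d η ν b).real A ≤ 2 * a := by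
  refine (childLaw_real_le d η ν b hA).trans ?_
  rw [hη, add_zero]
  gcongr

namespace IsEstimator

variable (hy : IsEstimator d η ν c ε K y) (hη : min (η : ℝ) (1 - η) = 0) {r : ℝ} (hr : 0 ≤ r)
  (hε : ε = r * min (η : ℝ) (1 - η)) (hκ : r + ε / 2 + 3 * Real.exp (-c * d) ≤ 1 / 8)
  (hd : d * Real.exp (-d * (1 - 1 / 2)) ≤ 1 / 4)

include hy hη hr hε hκ

/-- For `s = 0` also `ε = 0`, so the confidence bounds hold with threshold 0 and most messages are
exactly 1. -/
lemma childLaw_real_ne_one_le (u : List ℕ) {k : ℕ} (hk : K ≤ k) (b : Bool) :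
    (childLaw d η ν b).real {ω | sgn b * (theta η * y u k ω) ≠ 1} ≤ 1 / 4 ∧
    (childLaw d η ν b).real {ω | sgn b * (theta η * bp (theta η) k ω) ≠ 1} ≤ 1 / 4 := by
  have hε' : ε = 0 := by rw [hε, hη, mul_zero]
  have hexp := Real.exp_pos (-c * d)
  have h1 := hy.law_real_estimator_le u hk le_rfl hr (by rw [hε, hη]) (likely η b)
  have h2 := hy.law_real_bp_le u hk le_rfl hr (by rw [hε, hη]) (likely η b)
  have hset : ∀ z : Config E → ℝ, (∀ ω, |z ω| ≤ 1) →
      {ω | sgn b * (theta η * z ω) ≠ 1} = {ω | 0 < 1 - sgn (likely η b) * z ω} := by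
    intro z hz
    ext ω
    have : sgn (likely η b) * z ω ≤ 1 := (le_abs_self _).trans (by
      rw [abs_mul, abs_sgn, one_mul]; exact hz ω)
    simp only [Set.mem_ofPred_eq, sgn_mul_theta_mul hη, sub_pos, this.lt_iff_ne]
  rw [hset _ (hy.abs_le u k hk), hset _ (abs_bp_le (abs_theta_le η) k)]
  have hm : ∀ z : Config E → ℝ, Measurable z →
      MeasurableSet {ω | 0 < 1 - sgn (likely η b) * z ω} := fun z hz =>
    measurableSet_lt measurable_const (measurable_const.sub (hz.const_mul _))
  constructor
  · have := childLaw_real_le_of_min_eq_zero hη b (hm _ (hy.measurable u hk)) h1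
    linarith
  · have := childLaw_real_le_of_min_eq_zero hη b (hm _ (measurable_bp _ k)) h2
    linarith

include hd

/-- Certainty of the wrong label needs one child with message `-1` and no child with message 1. The
factor from one level to the next is `d e^(-d/2) ≤ 1/4`. -/
lemma law_real_wrong_le (n : ℕ) (u : List ℕ) (b : Bool) :
    (law d η ν).real ({ω | flipped ω [] = b} ∩ {ω | sgn b * y u (K + n) ω = -1}) ≤
      (1 / 4) ^ n := by
  induction n generalizing u b with
  | zero => simp
  | succ n ih =>
    have hk : K ≤ K + n := Nat.le_add_right _ _
    have hm : ∀ u n b, Measurable fun ω => sgn b * (theta η * y u (K + n) ω) := fun u n b =>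
      ((hy.measurable u (Nat.le_add_right _ _)).const_mul _).const_mul _
    have hA : ∀ u n, MeasurableSet {ω | sgn b * y u (K + n) ω = -1} := fun u n =>
      ((hy.measurable u (Nat.le_add_right _ _)).const_mul _) (measurableSet_singleton (-1))
    refine (law_real_le_of_exists d η ν b (hA u (n + 1))
      (S := fun i => {ω | sgn b * (theta η * y (u ++ [i]) (K + n) ω) = -1})
      (T := fun i => {ω | sgn b * (theta η * y (u ++ [i]) (K + n) ω) ≠ 1})
      (fun i => hm _ _ _ (measurableSet_singleton (-1)))
      (fun i => hm _ _ _ (measurableSet_singleton 1).compl)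
      (a := 2 * (1 / 4) ^ n) (q := 1 / 2) (by positivity) (by norm_num) ?_ ?_ ?_).trans ?_
    · intro i
      refine childLaw_real_le_of_min_eq_zero hη b (hm _ _ _ (measurableSet_singleton (-1))) ?_
      simp only [sgn_mul_theta_mul hη]
      exact ih _ _
    · intro i
      have := (hy.childLaw_real_ne_one_le hη hr hε hκ (u ++ [i]) hk b).1
      linarith
    · filter_upwards [hy.recursion u (K + n) hk] with ω hω _ h
      rw [← add_assoc, hω, ← gmap_sgn] at h
      obtain ⟨⟨i, hi, h1⟩, h2⟩ := exists_of_gmap_eq_neg_one h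
      exact ⟨i, hi, h1, fun j hj _ => h2 j hj⟩
    · rw [pow_succ]
      have : (0 : ℝ) < (1 / 4) ^ n := by positivity
      nlinarith

/-- Either some child is certain of the wrong label, which costs `d (1/4)^n`, or some child has `X ≠
Y` while no other child has both messages equal to 1, which contracts by 1/4. The factor `1 + 4d`
closes the recursion: `d + (1 + 4d)/4 ≤ (1 + 4d)/2`. -/
lemma law_real_ne_le (n : ℕ) (u : List ℕ) (b : Bool) :
    (law d η ν).real ({ω | flipped ω [] = b} ∩ {ω | bp (theta η) (K + n) ω ≠ y u (K + n) ω}) ≤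
      (1 / 2) ^ n * (1 + 4 * d) := by
  induction n generalizing u b with
  | zero =>
    have : (0 : ℝ) ≤ d := d.2
    refine measureReal_le_one.trans ?_
    rw [pow_zero]
    linarith
  | succ n ih =>
    have hk : K ≤ K + n := Nat.le_add_right _ _
    have hm : ∀ u, Measurable fun ω => sgn b * (theta η * y u (K + n) ω) := fun u =>
      ((hy.measurable u hk).const_mul _).const_mul _
    have hm' : Measurable fun ω : Config E => sgn b * (theta η * bp (theta η) (K + n) ω) :=
      ((measurable_bp _ _).const_mul _).const_mul _
    have hne : ∀ u n, MeasurableSet {ω | bp (theta η) (K + n) ω ≠ y u (K + n) ω} := fun u n =>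
      (measurableSet_eq_fun (measurable_bp _ _) (hy.measurable u (Nat.le_add_right _ _))).compl
    have hW : ∀ i, MeasurableSet {ω | sgn b * (theta η * y (u ++ [i]) (K + n) ω) = -1} :=
      fun i => hm _ (measurableSet_singleton (-1))
    have hWa : ∀ i, (childLaw d η ν b).real
        {ω | sgn b * (theta η * y (u ++ [i]) (K + n) ω) = -1} ≤ 2 * (1 / 4) ^ n := fun i => by
      refine childLaw_real_le_of_min_eq_zero hη b (hW i) ?_
      simp only [sgn_mul_theta_mul hη]
      exact hy.law_real_wrong_le hη hr hε hκ hd n _ _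
    set B : Set (Config E) := {ω | ∃ i < offspring ω [],
      sgn b * (theta η * y (u ++ [i]) (K + n) (sub i ω)) = -1} with hB
    have hBm : MeasurableSet B := by
      have : B = ⋃ i, {ω | i < offspring ω []} ∩
          sub i ⁻¹' {ω | sgn b * (theta η * y (u ++ [i]) (K + n) ω) = -1} := by ext; simp [hB]
      rw [this]
      exact .iUnion fun i => (measurableSet_lt measurable_const (measurable_offspring [])).inter
        (measurable_sub i (hW i))
    have h1 := law_real_le_of_exists d η ν b hBm
      (S := fun i => {ω | sgn b * (theta η * y (u ++ [i]) (K + n) ω) = -1})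
      (T := fun _ => Set.univ) hW (fun _ => .univ) (a := 2 * (1 / 4) ^ n) (q := 1)
      (by positivity) zero_le_one hWa (fun _ => by simp)
      (ae_of_all _ fun ω _ ⟨i, hi, h⟩ => ⟨i, hi, h, by simp⟩)
    have h2 := law_real_le_of_exists d η ν b ((hne u (n + 1)).inter hBm.compl)
      (S := fun i => {ω | bp (theta η) (K + n) ω ≠ y (u ++ [i]) (K + n) ω})
      (T := fun i => {ω | sgn b * (theta η * bp (theta η) (K + n) ω) ≠ 1} ∪
        {ω | sgn b * (theta η * y (u ++ [i]) (K + n) ω) ≠ 1})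
      (fun i => hne _ n) (fun i => (hm' (measurableSet_singleton 1).compl).union
        (hm _ (measurableSet_singleton 1).compl))
      (a := 2 * ((1 / 2) ^ n * (1 + 4 * d))) (q := 1 / 2) (by positivity) (by norm_num)
      (fun i => childLaw_real_le_of_min_eq_zero hη b (hne _ n) (ih _ _))
      (fun i => by
        obtain ⟨h3, h4⟩ := hy.childLaw_real_ne_one_le hη hr hε hκ (u ++ [i]) hk b
        refine (measureReal_union_le _ _).trans ?_
        linarith)
      (by
        filter_upwards [hy.recursion u (K + n) hk, ae_message_ne_neg_one (ν := ν) (d := d)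
          (η := η) (K + n) b] with ω hω h3 hb h
        obtain ⟨h4, h5⟩ := h
        simp only [hB, Set.mem_compl_iff, Set.mem_ofPred_eq, not_exists, not_and] at h5
        rw [Set.mem_ofPred_eq, ← add_assoc, hω] at h4
        have h6 : gmap (offspring ω [])
              (fun i => sgn b * (theta η * bp (theta η) (K + n) (sub i ω))) ≠
            gmap (offspring ω [])
              (fun i => sgn b * (theta η * y (u ++ [i]) (K + n) (sub i ω))) := by
          rw [gmap_sgn, gmap_sgn]
          intro h7
          refine h4 (mul_left_cancel₀ ?_ h7)
          cases b <;> simp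
        obtain ⟨i, hi, h7, h8⟩ := exists_of_gmap_ne h6 (h3 hb) h5
        refine ⟨i, hi, fun h9 => h7 (by rw [h9]), fun j hj hji => ?_⟩
        have := h8 j hj hji
        simp only [Set.mem_union, Set.mem_ofPred_eq]
        tauto)
    have h3 : (law d η ν).real ({ω | flipped ω [] = b} ∩
        {ω | bp (theta η) (K + (n + 1)) ω ≠ y u (K + (n + 1)) ω}) ≤
        (law d η ν).real ({ω | flipped ω [] = b} ∩ B) + (law d η ν).real ({ω | flipped ω [] = b} ∩
        ({ω | bp (theta η) (K + (n + 1)) ω ≠ y u (K + (n + 1)) ω} ∩ Bᶜ)) := by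
      refine (measureReal_mono fun ω hω => ?_).trans (measureReal_union_le _ _)
      by_cases hωB : ω ∈ B
      · exact Or.inl ⟨hω.1, hωB⟩
      · exact Or.inr ⟨hω.1, hω.2, hωB⟩
    have h4 : (1 / 4 : ℝ) ^ n ≤ (1 / 2) ^ n := by gcongr; norm_num
    have h5 : (0 : ℝ) ≤ d := d.2
    have h6 : (0 : ℝ) < (1 / 2) ^ n := by positivity
    simp only [sub_self, mul_zero, Real.exp_zero, mul_one] at h1
    have h7 : 1 / 2 * (2 * (1 / 4 : ℝ) ^ n) * d ≤ (1 / 2) ^ n * d := by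
      rw [← mul_assoc]
      norm_num only
      rw [one_mul]
      gcongr
    have h8 : 1 / 2 * (2 * ((1 / 2 : ℝ) ^ n * (1 + 4 * d))) *
        (d * Real.exp (-d * (1 - 1 / 2))) ≤ (1 / 2) ^ n * (1 + 4 * d) * (1 / 4) := by
      rw [← mul_assoc (1 / 2 : ℝ)]
      norm_num only
      rw [one_mul]
      norm_num only at hd
      gcongr
    rw [pow_succ]
    nlinarith

lemma tendsto_integral_abs_sub_of_min_eq_zero :
    Tendsto (fun n => ∫ ω, |bp (theta η) (K + n) ω - y [] (K + n) ω| ∂law d η ν) atTop (𝓝 0) := by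
  have hlim : Tendsto (fun n : ℕ => 4 * ((1 / 2 : ℝ) ^ n * (1 + 4 * d))) atTop (𝓝 0) := by
    have := ((tendsto_pow_atTop_nhds_zero_of_lt_one (r := (1 / 2 : ℝ)) (by norm_num)
      (by norm_num)).mul_const (1 + 4 * (d : ℝ))).const_mul 4
    simpa using this
  refine squeeze_zero (fun n => integral_nonneg fun ω => abs_nonneg _) (fun n => ?_) hlim
  have hk : K ≤ K + n := Nat.le_add_right _ _
  set A : Set (Config E) := {ω | bp (theta η) (K + n) ω ≠ y [] (K + n) ω} with hA
  have hAm : MeasurableSet A :=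
    (measurableSet_eq_fun (measurable_bp _ _) (hy.measurable [] hk)).compl
  have h1 : (law d η ν).real A ≤ 2 * ((1 / 2) ^ n * (1 + 4 * d)) := by
    have h2 := hy.law_real_ne_le hη hr hε hκ hd n [] true
    have h3 := hy.law_real_ne_le hη hr hε hκ hd n [] false
    have h4 : (law d η ν).real A ≤ (law d η ν).real ({ω | flipped ω [] = true} ∩ A) +
        (law d η ν).real ({ω | flipped ω [] = false} ∩ A) := by
      refine (measureReal_mono fun ω hω => ?_).trans (measureReal_union_le _ _)
      cases hb : flipped ω []
      · exact Or.inr ⟨hb, hω⟩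
      · exact Or.inl ⟨hb, hω⟩
    linarith
  calc ∫ ω, |bp (theta η) (K + n) ω - y [] (K + n) ω| ∂law d η ν
      ≤ ∫ ω, A.indicator (fun _ => (2 : ℝ)) ω ∂law d η ν := by
        refine integral_mono ?_ ((integrable_const _).indicator hAm) fun ω => ?_
        · exact ((integrable_bp η _).sub (hy.integrable [] hk)).abs
        · by_cases hω : ω ∈ A
          · rw [Set.indicator_of_mem hω]
            have h2 := abs_bp_le (abs_theta_le η) (K + n) ω
            have h3 := hy.abs_le [] _ hk ω
            exact (abs_sub _ _).trans (by linarith)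
          · simp only [hA, Set.mem_ofPred_eq, not_not] at hω
            rw [hω]
            simp [Set.indicator_nonneg]
    _ = (law d η ν).real A * 2 := by
        rw [integral_indicator hAm, setIntegral_const, smul_eq_mul]
    _ ≤ _ := by linarith

end IsEstimator

end

/-! ### Small positive noise: deterministic inequalities. -/

section

/-- The odds against `+` of a message. -/
def odds (t : ℝ) : ℝ := (1 - t) / (1 + t)

lemma odds_pos {t : ℝ} (h : |t| < 1) : 0 < odds t := by
  have := abs_lt.1 h
  exact div_pos (by linarith) (by linarith)

lemma gmap_eq_odds {n : ℕ} {t : ℕ → ℝ} (h : ∀ i < n, |t i| < 1) :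
    gmap n t = (1 - ∏ i ∈ Finset.range n, odds (t i)) / (1 + ∏ i ∈ Finset.range n, odds (t i)) := by
  have h1 : 0 < ∏ i ∈ Finset.range n, (1 + t i) := Finset.prod_pos fun i hi => by
    have := abs_lt.1 (h i (Finset.mem_range.1 hi)); linarith
  have h2 : 0 < ∏ i ∈ Finset.range n, (1 - t i) := Finset.prod_pos fun i hi => by
    have := abs_lt.1 (h i (Finset.mem_range.1 hi)); linarith
  simp only [gmap, odds, Finset.prod_div_distrib]
  field_simp

lemma abs_gmap_sub_le {n : ℕ} {t τ : ℕ → ℝ} (ht : ∀ i < n, |t i| < 1) (hτ : ∀ i < n, |τ i| < 1) :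
    |gmap n t - gmap n τ| ≤
      2 * |∏ i ∈ Finset.range n, odds (t i) - ∏ i ∈ Finset.range n, odds (τ i)| := by
  have h1 : 0 < ∏ i ∈ Finset.range n, odds (t i) :=
    Finset.prod_pos fun i hi => odds_pos (ht i (Finset.mem_range.1 hi))
  have h2 : 0 < ∏ i ∈ Finset.range n, odds (τ i) :=
    Finset.prod_pos fun i hi => odds_pos (hτ i (Finset.mem_range.1 hi))
  rw [gmap_eq_odds ht, gmap_eq_odds hτ]
  set A := ∏ i ∈ Finset.range n, odds (t i)
  set B := ∏ i ∈ Finset.range n, odds (τ i)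
  have h3 : (1 - A) / (1 + A) - (1 - B) / (1 + B) = 2 * (B - A) / ((1 + A) * (1 + B)) := by
    field_simp
    ring
  rw [h3, abs_div, abs_mul, abs_two, abs_sub_comm,
    abs_of_pos (by positivity : 0 < (1 + A) * (1 + B))]
  exact div_le_self (by positivity) (by nlinarith)

lemma sqrt_add_le {x y : ℝ} (hx : 0 ≤ x) (hy : 0 ≤ y) : √(x + y) ≤ √x + √y := by
  rw [Real.sqrt_le_left (by positivity)]
  nlinarith [Real.sq_sqrt hx, Real.sq_sqrt hy, Real.sqrt_nonneg x, Real.sqrt_nonneg y,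
    mul_nonneg (Real.sqrt_nonneg x) (Real.sqrt_nonneg y)]

/-- Telescope the difference of products one factor at a time; the square root is subadditive and
multiplicative. -/
lemma sqrt_abs_prod_sub_prod_le {ι : Type*} [DecidableEq ι] (s : Finset ι) {a b m : ι → ℝ}
    (ha : ∀ i ∈ s, 0 ≤ a i) (hb : ∀ i ∈ s, 0 ≤ b i) (ham : ∀ i ∈ s, a i ≤ m i)
    (hbm : ∀ i ∈ s, b i ≤ m i) :
    √|∏ i ∈ s, a i - ∏ i ∈ s, b i| ≤ ∑ i ∈ s, √|a i - b i| * ∏ j ∈ s.erase i, √(m j) := by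
  induction s using Finset.induction_on with
  | empty => simp
  | insert x s hx ih =>
    have ih := ih (fun i hi => ha i (Finset.mem_insert_of_mem hi))
      (fun i hi => hb i (Finset.mem_insert_of_mem hi))
      (fun i hi => ham i (Finset.mem_insert_of_mem hi))
      (fun i hi => hbm i (Finset.mem_insert_of_mem hi))
    have hM : ∏ i ∈ s, a i ≤ ∏ i ∈ s, m i := Finset.prod_le_prod
      (fun i hi => ha i (Finset.mem_insert_of_mem hi))
      (fun i hi => ham i (Finset.mem_insert_of_mem hi))
    have hA : 0 ≤ ∏ i ∈ s, a i := Finset.prod_nonneg fun i hi => ha i (Finset.mem_insert_of_mem hi)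
    have hbx := hb x (Finset.mem_insert_self _ _)
    have hbmx := hbm x (Finset.mem_insert_self _ _)
    have h1 : |a x * ∏ i ∈ s, a i - b x * ∏ i ∈ s, b i| ≤
        |a x - b x| * ∏ i ∈ s, m i + m x * |∏ i ∈ s, a i - ∏ i ∈ s, b i| := by
      calc _ = |(a x - b x) * ∏ i ∈ s, a i + b x * (∏ i ∈ s, a i - ∏ i ∈ s, b i)| := by ring_nf
        _ ≤ |a x - b x| * ∏ i ∈ s, a i + b x * |∏ i ∈ s, a i - ∏ i ∈ s, b i| := by
          refine (abs_add_le _ _).trans (le_of_eq ?_)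
          rw [abs_mul, abs_mul, abs_of_nonneg hA, abs_of_nonneg hbx]
        _ ≤ _ := by gcongr
    have hm : ∀ i ∈ s, 0 ≤ m i := fun i hi =>
      (ha i (Finset.mem_insert_of_mem hi)).trans (ham i (Finset.mem_insert_of_mem hi))
    have hmx : 0 ≤ m x := hbx.trans hbmx
    rw [Finset.prod_insert hx, Finset.prod_insert hx, Finset.sum_insert hx, Finset.erase_insert hx]
    refine (Real.sqrt_le_sqrt h1).trans ((sqrt_add_le (mul_nonneg (abs_nonneg _)
      (Finset.prod_nonneg hm)) (mul_nonneg hmx (abs_nonneg _))).trans ?_)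
    rw [Real.sqrt_mul (abs_nonneg _), Real.sqrt_mul hmx, Real.sqrt_prod _ hm]
    refine add_le_add le_rfl ((mul_le_mul_of_nonneg_left ih (Real.sqrt_nonneg _)).trans
      (le_of_eq ?_))
    rw [Finset.mul_sum]
    refine Finset.sum_congr rfl fun i hi => ?_
    have hxi : x ≠ i := fun h => hx (h ▸ hi)
    rw [Finset.erase_insert_of_ne hxi, Finset.prod_insert (fun h => hx (Finset.mem_of_mem_erase h))]
    ring

/-- The contribution of the child at which two families of messages are compared. -/
def discrepancy (A t τ : ℝ) : ℝ :=
  √2 * if (1 + t) / 2 ≤ 1 + τ then √|odds t - odds τ| else A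

/-- The damping by a child at which two families of messages are not compared. -/
def damping (p t τ : ℝ) : ℝ :=
  √(2 * (2 - t - τ) / (1 + t)) + max (odds t) (odds τ) ^ p

lemma discrepancy_nonneg {A : ℝ} (hA : 0 ≤ A) (t τ : ℝ) : 0 ≤ discrepancy A t τ := by
  unfold discrepancy
  split_ifs <;> positivity

lemma damping_nonneg {p t τ : ℝ} (ht : |t| < 1) : 0 ≤ damping p t τ := by
  have := odds_pos ht
  have : 0 < max (odds t) (odds τ) := lt_max_of_lt_left this
  unfold damping
  positivity

/-- Both numerators are at most `2 - t - τ`, and both denominators are at least `(1 + t)/2`. The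
bound is singular only at `t = -1`, where the density `1 + t` of the posterior message helps. -/
lemma odds_le_of_half_le {t τ : ℝ} (ht : |t| < 1) (hτ : |τ| < 1) (h : (1 + t) / 2 ≤ 1 + τ) :
    odds t ≤ 2 * (2 - t - τ) / (1 + t) ∧ odds τ ≤ 2 * (2 - t - τ) / (1 + t) := by
  obtain ⟨h1, h2⟩ := abs_lt.1 ht
  obtain ⟨h3, h4⟩ := abs_lt.1 hτ
  have h5 : 0 < 1 + t := by linarith
  have h6 : 0 < 1 + τ := by linarith
  unfold odds
  constructor
  · gcongr
    linarith
  · rw [div_le_div_iff₀ h6 h5]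
    nlinarith

/-- If no `τ i` lies far below `t i`, the products of odds are compared by telescoping. Otherwise
one such child `i` is singled out: the difference is bounded by a small power of the product of the
larger odds, the factor of `i` is at most `A`, and the others damp. -/
lemma sqrt_abs_gmap_sub_le {n : ℕ} {t τ : ℕ → ℝ} {A p : ℝ} (hA0 : 0 ≤ A)
    (ht : ∀ i < n, |t i| < 1) (hτ : ∀ i < n, |τ i| < 1) (hp0 : 0 ≤ p) (hp : p ≤ 1 / 2)
    (hA : ∀ i < n, max (odds (t i)) (odds (τ i)) ^ p ≤ A) :
    √|gmap n t - gmap n τ| ≤ ∑ i ∈ Finset.range n, discrepancy A (t i) (τ i) *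
      ∏ j ∈ (Finset.range n).erase i, damping p (t j) (τ j) := by
  have hmem : ∀ {i}, i ∈ Finset.range n → i < n := fun hi => Finset.mem_range.1 hi
  have hD : ∀ i < n, 0 ≤ damping p (t i) (τ i) := fun i hi => damping_nonneg (ht i hi)
  have hs := (Real.sqrt_le_sqrt (abs_gmap_sub_le ht hτ))
  rw [Real.sqrt_mul zero_le_two] at hs
  by_cases hc : ∀ i < n, (1 + t i) / 2 ≤ 1 + τ i
  · have h1 := sqrt_abs_prod_sub_prod_le (Finset.range n)
      (a := fun i => odds (t i)) (b := fun i => odds (τ i))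
      (m := fun i => 2 * (2 - t i - τ i) / (1 + t i))
      (fun i hi => (odds_pos (ht i (hmem hi))).le) (fun i hi => (odds_pos (hτ i (hmem hi))).le)
      (fun i hi => (odds_le_of_half_le (ht i (hmem hi)) (hτ i (hmem hi)) (hc i (hmem hi))).1)
      (fun i hi => (odds_le_of_half_le (ht i (hmem hi)) (hτ i (hmem hi)) (hc i (hmem hi))).2)
    refine hs.trans ((mul_le_mul_of_nonneg_left h1 (Real.sqrt_nonneg 2)).trans ?_)
    rw [Finset.mul_sum]
    refine Finset.sum_le_sum fun i hi => ?_
    rw [discrepancy, if_pos (hc i (hmem hi)), mul_assoc]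
    gcongr with j hj
    rw [damping]
    have := odds_pos (ht j (hmem (Finset.mem_of_mem_erase hj)))
    have : 0 < max (odds (t j)) (odds (τ j)) := lt_max_of_lt_left this
    exact le_add_of_nonneg_right (by positivity)
  · push Not at hc
    obtain ⟨i, hi, hlt⟩ := hc
    set M := fun i => max (odds (t i)) (odds (τ i)) with hMdef
    have hM : ∀ i ∈ Finset.range n, 0 < M i := fun i hi =>
      lt_max_of_lt_left (odds_pos (ht i (hmem hi)))
    have h1 : |gmap n t - gmap n τ| ≤ 2 := by
      have h2 := abs_gmap_le fun i hi => (ht i hi).le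
      have h3 := abs_gmap_le fun i hi => (hτ i hi).le
      exact (abs_sub _ _).trans (by linarith)
    have hP : 0 < ∏ i ∈ Finset.range n, M i := Finset.prod_pos hM
    have h2 : |∏ i ∈ Finset.range n, odds (t i) - ∏ i ∈ Finset.range n, odds (τ i)| ≤
        ∏ i ∈ Finset.range n, M i := by
      have h3 : ∏ i ∈ Finset.range n, odds (t i) ≤ ∏ i ∈ Finset.range n, M i :=
        Finset.prod_le_prod (fun i hi => (odds_pos (ht i (hmem hi))).le)
          fun i _ => le_max_left _ _
      have h4 : ∏ i ∈ Finset.range n, odds (τ i) ≤ ∏ i ∈ Finset.range n, M i :=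
        Finset.prod_le_prod (fun i hi => (odds_pos (hτ i (hmem hi))).le)
          fun i _ => le_max_right _ _
      have h5 : 0 ≤ ∏ i ∈ Finset.range n, odds (t i) :=
        Finset.prod_nonneg fun i hi => (odds_pos (ht i (hmem hi))).le
      have h6 : 0 ≤ ∏ i ∈ Finset.range n, odds (τ i) :=
        Finset.prod_nonneg fun i hi => (odds_pos (hτ i (hmem hi))).le
      rw [abs_le]
      constructor <;> linarith
    -- Two crude bounds meet here: 2 for the difference of the outputs when the product is at least
    -- 1, and the product itself below 1, where `p ≤ 1/2` only enlarges the power.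
    have h3 : √|gmap n t - gmap n τ| ≤ √2 * (∏ i ∈ Finset.range n, M i) ^ p := by
      rcases le_total 1 (∏ i ∈ Finset.range n, M i) with h4 | h4
      · exact (Real.sqrt_le_sqrt h1).trans
          (le_mul_of_one_le_right (Real.sqrt_nonneg _) (Real.one_le_rpow h4 hp0))
      · refine hs.trans ?_
        gcongr
        refine (Real.sqrt_le_sqrt h2).trans ?_
        rw [Real.sqrt_eq_rpow]
        exact Real.rpow_le_rpow_of_exponent_ge hP h4 hp
    refine h3.trans (le_trans ?_ (Finset.single_le_sum (f := fun i => discrepancy A (t i) (τ i) *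
      ∏ j ∈ (Finset.range n).erase i, damping p (t j) (τ j)) (fun j hj =>
        mul_nonneg (discrepancy_nonneg hA0 _ _) (Finset.prod_nonneg fun l hl =>
          hD l (hmem (Finset.mem_of_mem_erase hl)))) (Finset.mem_range.2 hi)))
    rw [← Real.finsetProd_rpow _ _ fun i hi => (hM i hi).le,
      ← Finset.mul_prod_erase _ _ (Finset.mem_range.2 hi)]
    simp only [discrepancy]
    rw [if_neg (not_le.2 hlt), ← mul_assoc]
    have h7 : ∀ j ∈ (Finset.range n).erase i, 0 < M j := fun j hj =>
      hM j (Finset.mem_of_mem_erase hj)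
    gcongr with j hj
    · exact Finset.prod_nonneg fun j hj => (Real.rpow_pos_of_pos (h7 j hj) _).le
    · exact hA i hi
    · intro j hj
      exact (Real.rpow_pos_of_pos (h7 j hj) _).le
    · exact le_add_of_nonneg_left (Real.sqrt_nonneg _)

/-- The weight `1 + t` is the density of `childLaw`. In the near case `|odds t - odds τ| ≤ 4|t - τ|
/ (1 + t)^2`, and the root of the denominator cancels. In the far case `(1 + t)/2 < t - τ`, so `1 +
t ≤ 2 √|t - τ|` pays for the constant 16. -/
lemma mul_discrepancy_le {t τ : ℝ} (ht : |t| < 1) (hτ : |τ| < 1) :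
    (1 + t) * discrepancy 16 t τ ≤ 49 * √|t - τ| := by
  obtain ⟨h1, h2⟩ := abs_lt.1 ht
  obtain ⟨h3, h4⟩ := abs_lt.1 hτ
  have h5 : 0 < 1 + t := by linarith
  have h6 : 0 < 1 + τ := by linarith
  have h2 : √2 ≤ 3 / 2 := by
    rw [Real.sqrt_le_left (by norm_num)]; norm_num
  have hs := Real.sqrt_nonneg |t - τ|
  unfold discrepancy
  split_ifs with h
  · have h7 : |odds t - odds τ| ≤ 4 * |t - τ| / (1 + t) ^ 2 := by
      have h8 : odds t - odds τ = -2 * (t - τ) / ((1 + t) * (1 + τ)) := by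
        unfold odds; field_simp; ring
      rw [h8, abs_div, abs_mul, abs_of_pos (by positivity : 0 < (1 + t) * (1 + τ)),
        div_le_div_iff₀ (by positivity) (by positivity)]
      norm_num
      have := abs_nonneg (t - τ)
      nlinarith [mul_nonneg (mul_nonneg this h5.le) (by linarith : 0 ≤ 2 * (1 + τ) - (1 + t))]
    have h8 : √|odds t - odds τ| ≤ 2 * √|t - τ| / (1 + t) := by
      refine (Real.sqrt_le_sqrt h7).trans (le_of_eq ?_)
      rw [Real.sqrt_div (by positivity), Real.sqrt_sq h5.le, Real.sqrt_mul (by norm_num)]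
      norm_num
    rw [le_div_iff₀ h5] at h8
    nlinarith [Real.sqrt_nonneg 2, Real.sqrt_nonneg |odds t - odds τ|]
  · have h7 : (1 + t) ≤ 2 * √|t - τ| := by
      have h8 : ((1 + t) / 2) ^ 2 ≤ |t - τ| := by
        have := le_abs_self (t - τ)
        nlinarith
      have := Real.le_sqrt_of_sq_le h8
      linarith
    nlinarith [Real.sqrt_nonneg 2]

lemma odds_le {t s : ℝ} (hs : 0 < s) (ht : |t| ≤ 1 - 2 * s) : odds t ≤ 1 / s := by
  obtain ⟨h1, h2⟩ := abs_le.1 ht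
  rw [odds, div_le_div_iff₀ (by linarith) hs]
  nlinarith

lemma odds_le_of_le {t s : ℝ} (hs : s ≤ 1 / 4) (ht : 1 - t ≤ 3 * s)
    (ht' : |t| ≤ 1) : odds t ≤ 3 * s := by
  obtain ⟨h1, h2⟩ := abs_le.1 ht'
  rw [odds, div_le_iff₀ (by linarith)]
  nlinarith

/-- Off the rare set `B` both `1 - z` and the odds are at most `3s`, so the power is at most `3^p/16
≤ 1/8`; on `B` the odds are at most `1/s`, so the power is at most 16. The term `(1 + t)⁻¹` remains
because its mean is exactly 1. -/
lemma damping_le {p s t τ : ℝ} (hs : 0 < s) (hs' : s ≤ 1 / 1024) (hp0 : 0 ≤ p) (hp : p ≤ 1 / 2)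
    (hps : s ^ p = 1 / 16) (ht : |t| ≤ 1 - 2 * s) (hτ : |τ| ≤ 1 - 2 * s) :
    damping p t τ ≤ 24 * s + 1 / 8 + 24 * ({z | 3 * s < 1 - z}.indicator 1 t : ℝ) +
      24 * ({z | 3 * s < 1 - z}.indicator 1 τ : ℝ) + 1 / 8 * (1 + t)⁻¹ := by
  obtain ⟨h1, h2⟩ := abs_le.1 ht
  obtain ⟨h3, h4⟩ := abs_le.1 hτ
  set B := {z : ℝ | 3 * s < 1 - z} with hB
  have hlin : ∀ z : ℝ, |z| ≤ 1 - 2 * s → 1 - z ≤ 3 * s + 2 * B.indicator 1 z := by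
    intro z hz
    by_cases h : z ∈ B
    · rw [Set.indicator_of_mem h, Pi.one_apply]
      linarith [(abs_le.1 hz).1]
    · rw [Set.indicator_of_notMem h]
      simp only [hB, Set.mem_ofPred_eq, not_lt] at h
      linarith
  have hodd : ∀ z : ℝ, |z| ≤ 1 - 2 * s → odds z ^ p ≤ 1 / 8 + 16 * B.indicator 1 z := by
    intro z hz
    have hz0 := odds_pos (t := z) (hz.trans_lt (by linarith))
    by_cases h : z ∈ B
    · rw [Set.indicator_of_mem h, Pi.one_apply]
      have h5 : odds z ^ p ≤ (1 / s) ^ p := by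
        gcongr
        exact odds_le hs hz
      rw [Real.div_rpow zero_le_one hs.le, hps, Real.one_rpow] at h5
      linarith
    · rw [Set.indicator_of_notMem h]
      simp only [hB, Set.mem_ofPred_eq, not_lt] at h
      have h5 : odds z ^ p ≤ (3 * s) ^ p := by
        gcongr
        exact odds_le_of_le (by linarith) h (hz.trans (by linarith))
      rw [Real.mul_rpow (by norm_num) hs.le, hps] at h5
      have h6 : (3 : ℝ) ^ p ≤ 2 := by
        calc (3 : ℝ) ^ p ≤ 4 ^ p := by gcongr; norm_num
          _ ≤ 4 ^ (1 / 2 : ℝ) := by gcongr; norm_num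
          _ = 2 := by
            rw [← Real.sqrt_eq_rpow, show (4 : ℝ) = 2 ^ 2 by norm_num, Real.sqrt_sq zero_le_two]
      linarith
  have hmax : max (odds t) (odds τ) ^ p ≤ 1 / 8 + 16 * B.indicator 1 t + 16 * B.indicator 1 τ := by
    have h5 : (0 : ℝ) ≤ B.indicator 1 t := Set.indicator_nonneg (by simp) _
    have h6 : (0 : ℝ) ≤ B.indicator 1 τ := Set.indicator_nonneg (by simp) _
    rcases max_choice (odds t) (odds τ) with h | h <;> rw [h]
    · linarith [hodd t ht]
    · linarith [hodd τ hτ]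
  have h5 : 0 < 1 + t := by linarith
  have hsq : √(2 * (2 - t - τ) / (1 + t)) ≤ 4 * (2 - t - τ) + 1 / 8 * (1 + t)⁻¹ := by
    rw [Real.sqrt_le_left]
    · have h6 : 2 * (2 - t - τ) / (1 + t) = 4 * (4 * (2 - t - τ)) * (1 / 8 * (1 + t)⁻¹) := by
        field_simp
        ring
      rw [h6]
      nlinarith [sq_nonneg (4 * (2 - t - τ) - 1 / 8 * (1 + t)⁻¹)]
    · have : 0 < (1 + t)⁻¹ := by positivity
      linarith
  have h7 := hlin t ht
  have h8 := hlin τ hτ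
  unfold damping
  linarith

end

/-! ### Small positive noise: the contraction. -/

section

/-- The exponent is chosen so that the extreme odds `1/s` are flattened to 16 uniformly in `s`; `s ≤
16^(-2)` keeps it below 1/2. -/
lemma exists_rpow_eq {s : ℝ} (hs : 0 < s) (hs' : s ≤ 1 / 1024) :
    ∃ p : ℝ, 0 ≤ p ∧ p ≤ 1 / 2 ∧ s ^ p = 1 / 16 := by
  have h1 : Real.log s ≤ -(2 * Real.log 16) := by
    have h2 : Real.log s ≤ Real.log ((16 ^ 2)⁻¹) := Real.log_le_log hs (hs'.trans (by norm_num))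
    rwa [Real.log_inv, Real.log_pow] at h2
  have h2 : 0 < Real.log 16 := Real.log_pos (by norm_num)
  have h3 : Real.log s < 0 := by linarith
  refine ⟨-Real.log 16 / Real.log s, ?_, ?_, ?_⟩
  · exact div_nonneg_of_nonpos (by linarith) h3.le
  · rw [div_le_iff_of_neg h3]
    linarith
  · rw [Real.rpow_def_of_pos hs, mul_div_cancel₀ _ h3.ne, Real.exp_neg, Real.exp_log (by norm_num)]
    norm_num

lemma measurable_discrepancy (A : ℝ) : Measurable fun z : ℝ × ℝ => discrepancy A z.1 z.2 := by
  unfold discrepancy odds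
  refine Measurable.const_mul (Measurable.ite (measurableSet_le (by fun_prop) (by fun_prop))
    ?_ measurable_const) _
  fun_prop

lemma measurable_damping (p : ℝ) : Measurable fun z : ℝ × ℝ => damping p z.1 z.2 := by
  unfold damping odds
  fun_prop

variable {E : Type*} [MeasurableSpace E]

lemma abs_sgn_mul_theta_mul_le (η : I) (b : Bool) {z : ℝ} (hz : |z| ≤ 1) :
    |sgn b * (theta η * z)| ≤ 1 - 2 * min (η : ℝ) (1 - η) := by
  rw [abs_mul, abs_sgn, one_mul, abs_mul, abs_theta_eq]
  refine mul_le_of_le_one_right ?_ hz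
  rw [← abs_theta_eq]
  exact abs_nonneg _

lemma abs_sgn_mul_theta_mul_sub_le (η : I) (b : Bool) (x y : ℝ) :
    |sgn b * (theta η * x) - sgn b * (theta η * y)| ≤ |x - y| := by
  rw [← mul_sub, ← mul_sub, abs_mul, abs_sgn, one_mul, abs_mul]
  exact mul_le_of_le_one_left (abs_nonneg _) (abs_theta_le η)

/-- The density of `childLaw` for functions of the level-`k` observation is exactly the reciprocal
of the integrand. -/
lemma integral_inv_childLaw (d : ℝ≥0) {η : I} (ν : Measure E) [IsProbabilityMeasure ν]
    (k : ℕ) (hη0 : 0 < min (η : ℝ) (1 - η)) (b : Bool) :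
    Integrable (fun ω => (1 + sgn b * (theta η * bp (theta η) k ω))⁻¹) (childLaw d η ν b) ∧
    ∫ ω, (1 + sgn b * (theta η * bp (theta η) k ω))⁻¹ ∂childLaw d η ν b = 1 := by
  have hpos : ∀ ω : Config E, 2 * min (η : ℝ) (1 - η) ≤
      1 + sgn b * (theta η * bp (theta η) k ω) := fun ω => by
    have := (abs_le.1 (abs_sgn_mul_theta_mul_le η b
      (abs_bp_le (abs_theta_le η) k ω))).1
    linarith
  have hm : Measurable fun ω : Config E => (1 + sgn b * (theta η * bp (theta η) k ω))⁻¹ :=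
    ((((measurable_bp _ k).const_mul _).const_mul _).const_add _).inv
  constructor
  · refine integrable_of_abs_le hm (M := (2 * min (η : ℝ) (1 - η))⁻¹) fun ω => ?_
    rw [abs_inv, abs_of_pos ((by positivity : (0 : ℝ) < 2 * min (η : ℝ) (1 - η)).trans_le (hpos ω))]
    exact inv_anti₀ (by positivity) (hpos ω)
  · rw [integral_childLaw_eq d η ν b hm (k := k) fun ω => by rw [bp_view _ le_rfl]]
    rw [integral_congr_ae (g := fun _ => (1 : ℝ)) (ae_of_all _ fun ω => ?_)]
    · simp
    · exact mul_inv_cancel₀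
        ((by positivity : (0 : ℝ) < 2 * min (η : ℝ) (1 - η)).trans_le (hpos ω)).ne'

namespace IsEstimator

variable {d : ℝ≥0} {η : I} {ν : Measure E} [IsProbabilityMeasure ν]
  {c ε : ℝ} {K : ℕ} {y : List ℕ → ℕ → Config E → ℝ}
  (hy : IsEstimator d η ν c ε K y) {r : ℝ} (hr : 0 ≤ r)
  (hε : ε = r * min (η : ℝ) (1 - η)) (hκ : r + ε / 2 + 3 * Real.exp (-c * d) ≤ 1 / 1024)
  (hη0 : 0 < min (η : ℝ) (1 - η)) (hη : min (η : ℝ) (1 - η) ≤ 1 / 1024)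
  (hd : d * Real.exp (-d * (1 - 1 / 2)) ≤ 1 / 98)

include hy

lemma childLaw_message_le (hr : 0 ≤ r) (hε : ε = r * min (η : ℝ) (1 - η)) (u : List ℕ) {k : ℕ}
    (hk : K ≤ k) (b : Bool) :
    (childLaw d η ν b).real {ω | 3 * min (η : ℝ) (1 - η) < 1 - sgn b * (theta η * y u k ω)} ≤
      2 * (r + ε / 2 + 3 * Real.exp (-c * d)) + min (η : ℝ) (1 - η) ∧
    (childLaw d η ν b).real
        {ω | 3 * min (η : ℝ) (1 - η) < 1 - sgn b * (theta η * bp (theta η) k ω)} ≤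
      2 * (r + ε / 2 + 3 * Real.exp (-c * d)) + min (η : ℝ) (1 - η) := by
  have h0 := η.2.1
  have h1 := η.2.2
  have hmin : 0 ≤ min (η : ℝ) (1 - η) := le_min h0 (by linarith)
  have hexp := Real.exp_pos (-c * d)
  have hε0 : 0 ≤ ε := by rw [hε]; positivity
  refine ⟨childLaw_real_message_le d η ν b (hy.measurable u hk) (hy.abs_le u k hk) fun b' => ?_,
    childLaw_real_message_le d η ν b (measurable_bp _ k) (abs_bp_le (abs_theta_le η) k) fun b' =>
      hy.law_real_bp_le u hk hmin hr hε b'⟩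
  refine (hy.law_real_estimator_le u hk hmin hr hε b').trans ?_
  linarith

include hr hε hκ hη0 hη

/-- Each bad set has probability at most `2/1024 + s ≤ 3/1024`, so the mean is at most `24/1024 +
1/8 + 48 * 3/1024 + 1/8 < 1/2`. -/
lemma lintegral_damping_le {p : ℝ} (hp0 : 0 ≤ p) (hp : p ≤ 1 / 2)
    (hps : min (η : ℝ) (1 - η) ^ p = 1 / 16) (u : List ℕ) {k : ℕ} (hk : K ≤ k) (b : Bool) :
    ∫⁻ ω, ENNReal.ofReal (damping p (sgn b * (theta η * bp (theta η) k ω))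
      (sgn b * (theta η * y u k ω))) ∂childLaw d η ν b ≤ ENNReal.ofReal (1 / 2) := by
  set s := min (η : ℝ) (1 - η) with hs
  set B := {z : ℝ | 3 * s < 1 - z} with hB
  have hBm : MeasurableSet B :=
    measurableSet_lt measurable_const (measurable_const.sub measurable_id)
  have hxm : Measurable fun ω : Config E => sgn b * (theta η * bp (theta η) k ω) :=
    ((measurable_bp _ k).const_mul _).const_mul _
  have hym : Measurable fun ω => sgn b * (theta η * y u k ω) :=
    ((hy.measurable u hk).const_mul _).const_mul _
  have hx1 := fun ω : Config E => abs_sgn_mul_theta_mul_le η b (abs_bp_le (abs_theta_le η) k ω)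
  have hy1 := fun ω => abs_sgn_mul_theta_mul_le η b (hy.abs_le u k hk ω)
  obtain ⟨hinv, hinv1⟩ := integral_inv_childLaw d ν k hη0 b
  obtain ⟨hyB, hxB⟩ := hy.childLaw_message_le hr hε u hk b
  have hind : ∀ {f : Config E → ℝ}, Measurable f →
      Integrable (fun ω => (B.indicator 1 (f ω) : ℝ)) (childLaw d η ν b) ∧
      ∫ ω, (B.indicator 1 (f ω) : ℝ) ∂childLaw d η ν b =
        (childLaw d η ν b).real {ω | 3 * s < 1 - f ω} := by
    intro f hf
    have h : (fun ω => (B.indicator 1 (f ω) : ℝ)) = (f ⁻¹' B).indicator 1 := by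
      ext ω
      by_cases hω : f ω ∈ B <;> simp [hω]
    rw [h, integral_indicator_one (hf hBm)]
    exact ⟨(integrable_const 1).indicator (hf hBm), rfl⟩
  obtain ⟨hx2, hx3⟩ := hind hxm
  obtain ⟨hy2, hy3⟩ := hind hym
  have hI : Integrable (fun ω => 24 * s + 1 / 8 +
      24 * (B.indicator 1 (sgn b * (theta η * bp (theta η) k ω)) : ℝ) +
      24 * (B.indicator 1 (sgn b * (theta η * y u k ω)) : ℝ) +
      1 / 8 * (1 + sgn b * (theta η * bp (theta η) k ω))⁻¹) (childLaw d η ν b) :=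
    (((integrable_const (24 * s + 1 / 8)).add
      (hx2.const_mul 24)).add (hy2.const_mul 24)).add (hinv.const_mul (1 / 8))
  refine (lintegral_mono fun ω => ENNReal.ofReal_le_ofReal
    (damping_le hη0 hη hp0 hp hps (hx1 ω) (hy1 ω))).trans ?_
  refine (ofReal_integral_eq_lintegral_ofReal hI (ae_of_all _ fun ω => ?_)).symm.le.trans ?_
  swap
  · refine ENNReal.ofReal_le_ofReal ?_
    rw [integral_add, integral_add, integral_add]
    · simp only [integral_const_mul, hinv1, hx3, hy3, integral_const, probReal_univ, smul_eq_mul]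
      linarith
    · exact integrable_const _
    · exact hx2.const_mul 24
    · exact (integrable_const _).add (hx2.const_mul 24)
    · exact hy2.const_mul 24
    · exact ((integrable_const _).add (hx2.const_mul 24)).add (hy2.const_mul 24)
    · exact hinv.const_mul _
  · have h1 := (_root_.abs_le.1 (hx1 ω)).1
    have h2 : 0 < (1 + sgn b * (theta η * bp (theta η) k ω))⁻¹ := inv_pos.2 (by linarith)
    have h3 : ∀ z, (0 : ℝ) ≤ B.indicator 1 z := fun z => Set.indicator_nonneg (by simp) _
    have h4 := h3 (sgn b * (theta η * bp (theta η) k ω))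
    have h5 := h3 (sgn b * (theta η * y u k ω))
    simp only [Pi.zero_apply]
    positivity

include hd

/-- One level costs the factor 49 of `mul_discrepancy_le` times the Poisson sum `d e^(-d/2) ≤ 1/98`,
which makes 1/2. -/
lemma lintegral_sqrt_abs_sub_le (n : ℕ) (u : List ℕ) :
    ∫⁻ ω, ENNReal.ofReal √|bp (theta η) (K + n) ω - y u (K + n) ω| ∂law d η ν ≤
      ENNReal.ofReal (2 * (1 / 2) ^ n) := by
  induction n generalizing u with
  | zero =>
    calc _ ≤ ∫⁻ _, ENNReal.ofReal 2 ∂law d η ν := by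
          refine lintegral_mono fun ω => ENNReal.ofReal_le_ofReal ?_
          rw [Real.sqrt_le_left zero_le_two]
          have h2 := abs_bp_le (abs_theta_le η) (K + 0) ω
          have h3 := hy.abs_le u (K + 0) le_rfl ω
          exact (abs_sub _ _).trans (by linarith)
      _ = _ := by simp
  | succ n ih =>
    obtain ⟨p, hp0, hp, hps⟩ := exists_rpow_eq hη0 hη
    have hk : K ≤ K + n := Nat.le_add_right _ _
    have hm : ∀ b u, Measurable fun ω => (sgn b * (theta η * bp (theta η) (K + n) ω),
        sgn b * (theta η * y u (K + n) ω)) := fun b u =>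
      (((measurable_bp _ _).const_mul _).const_mul _).prodMk
        (((hy.measurable u hk).const_mul _).const_mul _)
    have hφm : ∀ b u, Measurable fun ω => ENNReal.ofReal
        (discrepancy 16 (sgn b * (theta η * bp (theta η) (K + n) ω))
          (sgn b * (theta η * y u (K + n) ω))) := fun b u =>
      ((measurable_discrepancy 16).comp (hm b u)).ennreal_ofReal
    have hx1 := fun b (ω : Config E) =>
      abs_sgn_mul_theta_mul_le η b (abs_bp_le (abs_theta_le η) (K + n) ω)
    have hy1 := fun b u ω => abs_sgn_mul_theta_mul_le η b (hy.abs_le u _ hk ω)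
    refine (lintegral_le_of_sum_prod d η ν _
      (fun b i ω => ENNReal.ofReal (discrepancy 16 (sgn b * (theta η * bp (theta η) (K + n) ω))
        (sgn b * (theta η * y (u ++ [i]) (K + n) ω))))
      (fun b i ω => ENNReal.ofReal (damping p (sgn b * (theta η * bp (theta η) (K + n) ω))
        (sgn b * (theta η * y (u ++ [i]) (K + n) ω))))
      (fun b i => hφm b _)
      (fun b i => ((measurable_damping p).comp (hm b _)).ennreal_ofReal)
      (a := 49 * (2 * (1 / 2) ^ n)) (q := 1 / 2) (by positivity) (by norm_num) ?_ ?_ ?_).trans ?_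
    · intro b i
      rw [lintegral_childLaw_eq d η ν b (k := K + n) (hφm b _)
        fun ω => by
          rw [bp_view _ le_rfl, hy.comp_view _ hk]]
      calc _ ≤ ∫⁻ ω, ENNReal.ofReal 49 * ENNReal.ofReal
            √|bp (theta η) (K + n) ω - y (u ++ [i]) (K + n) ω| ∂law d η ν := by
            refine lintegral_mono fun ω => ?_
            rw [← ENNReal.ofReal_mul (childDensity_nonneg η _ b ω),
              ← ENNReal.ofReal_mul (by norm_num)]
            refine ENNReal.ofReal_le_ofReal ((mul_discrepancy_le
              ((hx1 b ω).trans_lt (by linarith)) ((hy1 b _ ω).trans_lt (by linarith))).trans ?_)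
            exact mul_le_mul_of_nonneg_left
              (Real.sqrt_le_sqrt (abs_sgn_mul_theta_mul_sub_le η b _ _)) (by norm_num)
        _ ≤ _ := by
            rw [lintegral_const_mul' _ _ (by finiteness), ENNReal.ofReal_mul (by norm_num)]
            gcongr
            exact ih _
    · exact fun b i => hy.lintegral_damping_le hr hε hκ hη0 hη hp0 hp hps _ hk b
    · intro b
      filter_upwards [hy.recursion u (K + n) hk] with ω hω _
      have hD : ∀ i, 0 ≤ damping p (sgn b * (theta η * bp (theta η) (K + n) (sub i ω)))
          (sgn b * (theta η * y (u ++ [i]) (K + n) (sub i ω))) := fun i =>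
        damping_nonneg ((hx1 b _).trans_lt (by linarith))
      simp only [← ENNReal.ofReal_prod_of_nonneg fun i _ => hD i]
      have hS : ∀ i, 0 ≤ discrepancy 16 (sgn b * (theta η * bp (theta η) (K + n) (sub i ω)))
          (sgn b * (theta η * y (u ++ [i]) (K + n) (sub i ω))) := fun i =>
        discrepancy_nonneg (by norm_num) _ _
      simp only [← ENNReal.ofReal_mul (hS _)]
      rw [← ENNReal.ofReal_sum_of_nonneg fun i _ =>
        mul_nonneg (hS i) (Finset.prod_nonneg fun j _ => hD j)]
      refine ENNReal.ofReal_le_ofReal (le_trans (le_of_eq ?_) (sqrt_abs_gmap_sub_le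
        (n := offspring ω []) (A := 16) (p := p) (by norm_num)
        (fun i _ => (hx1 b (sub i ω)).trans_lt (by linarith))
        (fun i _ => (hy1 b (u ++ [i]) (sub i ω)).trans_lt (by linarith)) hp0 hp fun i _ => ?_))
      · rw [gmap_sgn, gmap_sgn, ← mul_sub, abs_mul, abs_sgn, one_mul, ← add_assoc, hω]
        rfl
      · have h1 := odds_pos ((hx1 b (sub i ω)).trans_lt (by linarith))
        calc _ ≤ (1 / min (η : ℝ) (1 - η)) ^ p := by
              gcongr
              exact max_le (odds_le hη0 (hx1 b _)) (odds_le hη0 (hy1 b _ _))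
          _ = 16 := by
              rw [Real.div_rpow zero_le_one hη0.le, hps, Real.one_rpow]
              norm_num
    · refine ENNReal.ofReal_le_ofReal ?_
      have : (0 : ℝ) < (1 / 2) ^ n := by positivity
      rw [pow_succ]
      nlinarith

lemma tendsto_integral_abs_sub_of_min_le :
    Tendsto (fun n => ∫ ω, |bp (theta η) (K + n) ω - y [] (K + n) ω| ∂law d η ν) atTop (𝓝 0) := by
  have hlim : Tendsto (fun n : ℕ => 2 * (2 * (1 / 2 : ℝ) ^ n)) atTop (𝓝 0) := by
    have := ((tendsto_pow_atTop_nhds_zero_of_lt_one (r := (1 / 2 : ℝ)) (by norm_num)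
      (by norm_num)).const_mul 2).const_mul 2
    simpa using this
  refine squeeze_zero (fun n => integral_nonneg fun ω => abs_nonneg _) (fun n => ?_) hlim
  have hk : K ≤ K + n := Nat.le_add_right _ _
  have hm : Measurable fun ω => √|bp (theta η) (K + n) ω - y [] (K + n) ω| :=
    (continuous_abs.measurable.comp ((measurable_bp _ _).sub (hy.measurable [] hk))).sqrt
  have hle : ∀ ω, |bp (theta η) (K + n) ω - y [] (K + n) ω| ≤ 4 := fun ω => by
    have h2 := abs_bp_le (abs_theta_le η) (K + n) ω
    have h3 := hy.abs_le [] _ hk ω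
    exact (abs_sub _ _).trans (by linarith)
  have hsq : ∀ ω, √|bp (theta η) (K + n) ω - y [] (K + n) ω| ≤ 2 := fun ω => by
    rw [Real.sqrt_le_left zero_le_two]
    linarith [hle ω]
  have hint : Integrable (fun ω => √|bp (theta η) (K + n) ω - y [] (K + n) ω|) (law d η ν) :=
    integrable_of_abs_le hm fun ω => by
      rw [abs_of_nonneg (Real.sqrt_nonneg _)]; exact hsq ω
  have h1 : ∫ ω, √|bp (theta η) (K + n) ω - y [] (K + n) ω| ∂law d η ν ≤ 2 * (1 / 2) ^ n := by
    have h2 := hy.lintegral_sqrt_abs_sub_le hr hε hκ hη0 hη hd n []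
    rw [← ofReal_integral_eq_lintegral_ofReal hint (ae_of_all _ fun ω => Real.sqrt_nonneg _)] at h2
    exact (ENNReal.ofReal_le_ofReal_iff (by positivity)).1 h2
  refine le_trans ?_ (mul_le_mul_of_nonneg_left h1 zero_le_two)
  rw [← integral_const_mul]
  refine integral_mono ((integrable_bp η _).sub (hy.integrable [] hk)).abs (hint.const_mul 2)
    fun ω => ?_
  have h2 := hsq ω
  have h3 := Real.sqrt_nonneg |bp (theta η) (K + n) ω - y [] (K + n) ω|
  have h4 := Real.mul_self_sqrt (abs_nonneg (bp (theta η) (K + n) ω - y [] (K + n) ω))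
  simp only
  nlinarith

end IsEstimator

end

/-! ### Moderate noise: fourth roots of odds and differences of products. -/

section

/-- The fourth root of the odds of a message in `(-1, 1)`. -/
def rootOdds (t : ℝ) : ℝ := Real.exp ((Real.log (1 - t) - Real.log (1 + t)) / 4)

lemma rootOdds_pos (t : ℝ) : 0 < rootOdds t := Real.exp_pos _

lemma rootOdds_zero : rootOdds 0 = 1 := by simp [rootOdds]

lemma measurable_rootOdds : Measurable rootOdds := by
  unfold rootOdds
  fun_prop

lemma rootOdds_pow_four {t : ℝ} (h : |t| < 1) : rootOdds t ^ 4 = odds t := by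
  obtain ⟨h1, h2⟩ := abs_lt.1 h
  rw [rootOdds, ← Real.exp_nat_mul, odds]
  push_cast
  rw [mul_div_cancel₀ _ (by norm_num), Real.exp_sub, Real.exp_log (by linarith),
    Real.exp_log (by linarith)]

/-- This is why fourth roots are used. Squaring leaves the square root of the odds, whose mean under
`childLaw` is a Hellinger affinity `E √(1 - t^2)`, strictly below 1. -/
lemma rootOdds_sq {t : ℝ} (h : |t| < 1) : (1 + t) * rootOdds t ^ 2 = √(1 - t ^ 2) := by
  obtain ⟨h1, h2⟩ := abs_lt.1 h
  have h3 : (1 + t) ≠ 0 := by linarith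
  have key : 1 - t ^ 2 = ((1 + t) * rootOdds t ^ 2) * ((1 + t) * rootOdds t ^ 2) := by
    calc _ = (1 + t) ^ 2 * odds t := by
          rw [odds]
          field_simp
          ring
      _ = _ := by
          rw [← rootOdds_pow_four h]
          ring
  rw [key, Real.sqrt_mul_self (mul_nonneg (by linarith) (sq_nonneg _))]

lemma hasDerivAt_rootOdds {t : ℝ} (h : |t| < 1) :
    HasDerivAt rootOdds (-rootOdds t / (2 * (1 - t ^ 2))) t := by
  obtain ⟨h1, h2⟩ := abs_lt.1 h
  have h3 : 1 - t ≠ 0 := by linarith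
  have h4 : 1 + t ≠ 0 := by linarith
  have h5 : 1 - t ^ 2 ≠ 0 := by
    rw [show 1 - t ^ 2 = (1 - t) * (1 + t) by ring]
    exact mul_ne_zero h3 h4
  have h6 : HasDerivAt (fun t => 1 - t) (-1) t := by
    simpa using (hasDerivAt_id t).const_sub 1
  have h7 : HasDerivAt (fun t => 1 + t) 1 t := by
    simpa using (hasDerivAt_id t).const_add 1
  refine HasDerivAt.congr_deriv (((h6.log h3).sub (h7.log h4)).div_const 4).exp ?_
  simp only [Pi.sub_apply]
  rw [← rootOdds]
  field_simp
  ring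

lemma hasDerivAt_deriv_rootOdds {t : ℝ} (h : |t| < 1) :
    HasDerivAt (fun t => -rootOdds t / (2 * (1 - t ^ 2)))
      (rootOdds t * (1 / 4 - t) / (1 - t ^ 2) ^ 2) t := by
  obtain ⟨h1, h2⟩ := abs_lt.1 h
  have h5 : 1 - t ^ 2 ≠ 0 := by nlinarith
  have h6 : HasDerivAt (fun t => 2 * (1 - t ^ 2)) (2 * -(2 * t)) t := by
    simpa using (((hasDerivAt_id t).pow 2).const_sub 1).const_mul 2
  refine ((hasDerivAt_rootOdds h).neg.div h6 (mul_ne_zero two_ne_zero h5)).congr_deriv ?_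
  simp only [Pi.neg_apply]
  field_simp
  ring

/-- The derivatives are continuous on a compact interval inside `(-1, 1)`. Since the derivative at 0
is `-1/2`, subtracting the linear part leaves an error of second order. -/
lemma exists_rootOdds_bounds {s : ℝ} (hs : 0 < s) : ∃ M : ℝ, 0 ≤ M ∧ ∀ t τ : ℝ, |t| ≤ 1 - s →
    |τ| ≤ 1 - s → rootOdds t ≤ M ∧ |rootOdds t - rootOdds τ| ≤ M * |t - τ| ∧
      |rootOdds t - rootOdds τ + (t - τ) / 2| ≤ M * (|t| + |τ|) * |t - τ| := by
  set D := Set.Icc (-(1 - s)) (1 - s) with hD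
  have hlt : ∀ t ∈ D, |t| < 1 := fun t ht => (abs_le.2 ht).trans_lt (by linarith)
  have hcF : ContinuousOn rootOdds D := fun t ht =>
    (hasDerivAt_rootOdds (hlt t ht)).continuousAt.continuousWithinAt
  have hc1 : ContinuousOn (fun t => -rootOdds t / (2 * (1 - t ^ 2))) D := fun t ht =>
    (hasDerivAt_deriv_rootOdds (hlt t ht)).continuousAt.continuousWithinAt
  have hc2 : ContinuousOn (fun t => rootOdds t * (1 / 4 - t) / (1 - t ^ 2) ^ 2) D := by
    refine ContinuousOn.div (hcF.mul (by fun_prop)) (by fun_prop) fun t ht => ?_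
    obtain ⟨h1, h2⟩ := abs_lt.1 (hlt t ht)
    exact pow_ne_zero 2 (by nlinarith)
  obtain ⟨M0, hM0⟩ := isCompact_Icc.exists_bound_of_continuousOn hcF
  obtain ⟨M1, hM1⟩ := isCompact_Icc.exists_bound_of_continuousOn hc1
  obtain ⟨M2, hM2⟩ := isCompact_Icc.exists_bound_of_continuousOn hc2
  have hconv : Convex ℝ D := convex_Icc _ _
  refine ⟨max 0 (max M0 (max M1 M2)), le_max_left _ _, fun t τ ht hτ => ?_⟩
  set M := max 0 (max M0 (max M1 M2)) with hM
  have hM0' : M0 ≤ M := (le_max_left _ _).trans (le_max_right _ _)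
  have hM1' : M1 ≤ M := (le_max_left _ _).trans ((le_max_right _ _).trans (le_max_right _ _))
  have hM2' : M2 ≤ M := (le_max_right _ _).trans ((le_max_right _ _).trans (le_max_right _ _))
  have htD : t ∈ D := abs_le.1 ht
  have hτD : τ ∈ D := abs_le.1 hτ
  refine ⟨(le_abs_self _).trans ((hM0 t htD).trans hM0'), ?_, ?_⟩
  · exact hconv.norm_image_sub_le_of_norm_hasDerivWithin_le
      (fun z hz => (hasDerivAt_rootOdds (hlt z hz)).hasDerivWithinAt)
      (fun z hz => (hM1 z hz).trans hM1') hτD htD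
  · have hseg : Set.uIcc τ t ⊆ D := Set.uIcc_subset_Icc hτD htD
    have h0D : (0 : ℝ) ∈ D := by
      have := (abs_nonneg t).trans ht
      exact ⟨by linarith, this⟩
    have hd : ∀ z ∈ D, |-rootOdds z / (2 * (1 - z ^ 2)) + 1 / 2| ≤ M * |z| := by
      intro z hz
      have := hconv.norm_image_sub_le_of_norm_hasDerivWithin_le
        (fun z hz => (hasDerivAt_deriv_rootOdds (hlt z hz)).hasDerivWithinAt)
        (fun z hz => (hM2 z hz).trans hM2') h0D hz
      simpa [rootOdds_zero, neg_div] using this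
    have h1 := (convex_uIcc τ t).norm_image_sub_le_of_norm_hasDerivWithin_le
      (f := fun z => rootOdds z + z / 2)
      (C := M * (|t| + |τ|))
      (fun z hz => ((hasDerivAt_rootOdds (hlt z (hseg hz))).add
        ((hasDerivAt_id z).div_const 2)).hasDerivWithinAt)
      (fun z hz => by
        refine (hd z (hseg hz)).trans ?_
        refine mul_le_mul_of_nonneg_left ?_ (le_max_left _ _)
        rcases Set.mem_uIcc.1 hz with h | h <;> rw [abs_le] <;> constructor <;>
          linarith [abs_nonneg t, abs_nonneg τ, le_abs_self t, le_abs_self τ, neg_abs_le t,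
            neg_abs_le τ])
      Set.left_mem_uIcc Set.right_mem_uIcc
    simp only [Real.norm_eq_abs] at h1
    refine le_trans (le_of_eq ?_) h1
    congr 1
    ring

/-- The function `(1 - A^4)/(1 + A^4)` is Lipschitz on `A > 0`: each of the four monomials in its
difference quotient is at most `(1 + A^4)(1 + B^4)`. -/
lemma abs_gmap_sub_le_prod_rootOdds {n : ℕ} {t τ : ℕ → ℝ} (ht : ∀ i < n, |t i| < 1)
    (hτ : ∀ i < n, |τ i| < 1) :
    |gmap n t - gmap n τ| ≤
      8 * |∏ i ∈ Finset.range n, rootOdds (t i) - ∏ i ∈ Finset.range n, rootOdds (τ i)| := by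
  have key : ∀ t : ℕ → ℝ, (∀ i < n, |t i| < 1) → ∏ i ∈ Finset.range n, odds (t i) =
      (∏ i ∈ Finset.range n, rootOdds (t i)) ^ 4 := by
    intro t ht
    rw [← Finset.prod_pow]
    exact Finset.prod_congr rfl fun i hi => (rootOdds_pow_four (ht i (Finset.mem_range.1 hi))).symm
  rw [gmap_eq_odds ht, gmap_eq_odds hτ, key t ht, key τ hτ]
  have hA : 0 < ∏ i ∈ Finset.range n, rootOdds (t i) := Finset.prod_pos fun i _ => rootOdds_pos _
  have hB : 0 < ∏ i ∈ Finset.range n, rootOdds (τ i) := Finset.prod_pos fun i _ => rootOdds_pos _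
  set A := ∏ i ∈ Finset.range n, rootOdds (t i)
  set B := ∏ i ∈ Finset.range n, rootOdds (τ i)
  have h3 : (1 - A ^ 4) / (1 + A ^ 4) - (1 - B ^ 4) / (1 + B ^ 4) =
      (A - B) * (-(2 * (A ^ 3 + A ^ 2 * B + A * B ^ 2 + B ^ 3)) /
        ((1 + A ^ 4) * (1 + B ^ 4))) := by
    field_simp
    ring
  have hp : ∀ z : ℝ, 0 < z → z ≤ 1 + z ^ 4 ∧ z ^ 2 ≤ 1 + z ^ 4 ∧ z ^ 3 ≤ 1 + z ^ 4 := by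
    intro z hz
    rcases le_total z 1 with h | h
    · exact ⟨by nlinarith [pow_pos hz 4], by nlinarith [pow_pos hz 4],
        by nlinarith [pow_pos hz 4, pow_le_one₀ hz.le h (n := 3)]⟩
    · have h1 : z ≤ z ^ 4 := le_self_pow₀ h (by norm_num)
      have h2 : z ^ 2 ≤ z ^ 4 := pow_le_pow_right₀ h (by norm_num)
      have h3 : z ^ 3 ≤ z ^ 4 := pow_le_pow_right₀ h (by norm_num)
      exact ⟨by linarith, by linarith, by linarith⟩
  obtain ⟨a1, a2, a3⟩ := hp A hA
  obtain ⟨b1, b2, b3⟩ := hp B hB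
  rw [h3, abs_mul, mul_comm]
  refine mul_le_mul_of_nonneg_right ?_ (abs_nonneg _)
  rw [abs_div, abs_neg, abs_of_pos (by positivity), abs_of_pos (by positivity),
    div_le_iff₀ (by positivity)]
  have c1 : A ^ 2 * B ≤ (1 + A ^ 4) * (1 + B ^ 4) := by gcongr
  have c2 : A * B ^ 2 ≤ (1 + A ^ 4) * (1 + B ^ 4) := by gcongr
  have c3 : A ^ 3 ≤ (1 + A ^ 4) * (1 + B ^ 4) := by nlinarith [pow_pos hA 4, pow_pos hB 4]
  have c4 : B ^ 3 ≤ (1 + A ^ 4) * (1 + B ^ 4) := by nlinarith [pow_pos hA 4, pow_pos hB 4]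
  linarith

lemma prod_sub_prod_le {n : ℕ} {a b : ℕ → ℝ} {q β : ℝ}
    (ha0 : ∀ i, 0 ≤ a i) (hb0 : ∀ i, 0 ≤ b i) (haq : ∀ i, a i ≤ q) (hbq : ∀ i, b i ≤ q)
    (hβ : ∀ i, |a i - b i| ≤ β) :
    |∏ i ∈ Finset.range n, a i - ∏ i ∈ Finset.range n, b i| ≤ n * q ^ (n - 1) * β := by
  have hq : 0 ≤ q := (ha0 0).trans (haq 0)
  have hβ0 : 0 ≤ β := (abs_nonneg _).trans (hβ 0)
  induction n with
  | zero => simp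
  | succ n ih =>
    have hA : |∏ i ∈ Finset.range n, a i| ≤ q ^ n := by
      rw [abs_of_nonneg (Finset.prod_nonneg fun i _ => ha0 i)]
      simpa using Finset.prod_le_prod (s := Finset.range n) (fun i _ => ha0 i) fun i _ => haq i
    rw [Finset.prod_range_succ, Finset.prod_range_succ, add_tsub_cancel_right]
    calc _ = |(∏ i ∈ Finset.range n, a i) * (a n - b n) +
          (∏ i ∈ Finset.range n, a i - ∏ i ∈ Finset.range n, b i) * b n| := by ring_nf
      _ ≤ q ^ n * β + (n * q ^ (n - 1) * β) * q := by
          refine (abs_add_le _ _).trans ?_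
          rw [abs_mul, abs_mul, abs_of_nonneg (hb0 n)]
          gcongr
          · exact hβ n
          · exact hb0 n
          · exact hbq n
      _ = _ := by
          rcases n with _ | n
          · simp
          · rw [add_tsub_cancel_right]
            push_cast
            ring

/-- A discrete second derivative of a product: either one factor is differenced twice, of size `α`,
or two factors once each, of size `β^2`. The induction step is the Leibniz identity in the
calculation below. -/
lemma prod_sub_two_prod_add_prod_le {n : ℕ} {a b c : ℕ → ℝ} {q α β : ℝ}
    (ha0 : ∀ i, 0 ≤ a i) (hb0 : ∀ i, 0 ≤ b i) (hc0 : ∀ i, 0 ≤ c i) (haq : ∀ i, a i ≤ q)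
    (hbq : ∀ i, b i ≤ q) (hcq : ∀ i, c i ≤ q) (hα0 : 0 ≤ α)
    (hα : ∀ i, a i - 2 * b i + c i ≤ α) (hab : ∀ i, |a i - b i| ≤ β)
    (hcb : ∀ i, |c i - b i| ≤ β) :
    ∏ i ∈ Finset.range n, a i - 2 * ∏ i ∈ Finset.range n, b i + ∏ i ∈ Finset.range n, c i ≤
      n * q ^ (n - 1) * α + n * (n - 1) * q ^ (n - 2) * β ^ 2 := by
  have hq : 0 ≤ q := (ha0 0).trans (haq 0)
  have hβ0 : 0 ≤ β := (abs_nonneg _).trans (hab 0)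
  induction n with
  | zero => norm_num
  | succ n ih =>
    have h1 := prod_sub_prod_le (n := n) ha0 hb0 haq hbq hab
    have h2 := prod_sub_prod_le (n := n) hc0 hb0 hcq hbq hcb
    have hB : ∏ i ∈ Finset.range n, b i ≤ q ^ n := by
      simpa using Finset.prod_le_prod (s := Finset.range n) (fun i _ => hb0 i) fun i _ => hbq i
    have hB0 : 0 ≤ ∏ i ∈ Finset.range n, b i := Finset.prod_nonneg fun i _ => hb0 i
    simp only [Finset.prod_range_succ, add_tsub_cancel_right]
    set A := ∏ i ∈ Finset.range n, a i
    set B := ∏ i ∈ Finset.range n, b i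
    set C := ∏ i ∈ Finset.range n, c i
    have hn : (0 : ℝ) ≤ n * (n - 1) := by
      rcases n with _ | n
      · simp
      · push_cast
        rw [add_sub_cancel_right]
        positivity
    have h3 : b n * (A - 2 * B + C) ≤
        q * (n * q ^ (n - 1) * α + n * (n - 1) * q ^ (n - 2) * β ^ 2) :=
      (mul_le_mul_of_nonneg_left ih (hb0 n)).trans
        (mul_le_mul_of_nonneg_right (hbq n) (by positivity))
    have h4 : (a n - 2 * b n + c n) * B ≤ α * q ^ n := mul_le_mul (hα n) hB hB0 hα0
    have h5 : (a n - b n) * (A - B) ≤ β * (n * q ^ (n - 1) * β) := by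
      refine (le_abs_self _).trans ?_
      rw [abs_mul]
      exact mul_le_mul (hab n) h1 (abs_nonneg _) hβ0
    have h6 : (c n - b n) * (C - B) ≤ β * (n * q ^ (n - 1) * β) := by
      refine (le_abs_self _).trans ?_
      rw [abs_mul]
      exact mul_le_mul (hcb n) h2 (abs_nonneg _) hβ0
    calc A * a n - 2 * (B * b n) + C * c n
        = b n * (A - 2 * B + C) + (a n - 2 * b n + c n) * B + (a n - b n) * (A - B) +
          (c n - b n) * (C - B) := by ring
      _ ≤ q * (n * q ^ (n - 1) * α + n * (n - 1) * q ^ (n - 2) * β ^ 2) + α * q ^ n +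
          β * (n * q ^ (n - 1) * β) + β * (n * q ^ (n - 1) * β) := by linarith
      _ = _ := by
          rcases n with _ | _ | n
          · simp
          · norm_num
            ring
          · simp only [show n + 1 + 1 - 2 = n by omega, show n + 1 + 1 - 1 = n + 1 by omega,
              show n + 1 + 1 + 1 - 2 = n + 1 by omega]
            push_cast
            ring

end

/-! ### Moderate noise: moments of the root odds. -/

section

/-- To first order `(1 + t) * rootOdds z` is 1 and the difference of root odds is `-(t - τ)/2`; this
holds for `z = t` and for `z = τ`. -/
lemma abs_mul_rootOdds_mul_sub_le {M s t τ : ℝ} (hM : 0 ≤ M)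
    (h : ∀ t τ : ℝ, |t| ≤ 1 - s → |τ| ≤ 1 - s → rootOdds t ≤ M ∧
      |rootOdds t - rootOdds τ| ≤ M * |t - τ| ∧
      |rootOdds t - rootOdds τ + (t - τ) / 2| ≤ M * (|t| + |τ|) * |t - τ|)
    (ht : |t| ≤ 1 - s) (hτ : |τ| ≤ 1 - s) :
    |(1 + t) * (rootOdds t * (rootOdds t - rootOdds τ)) + (t - τ) / 2| ≤
      (M + 2 * M ^ 2) * ((|t| + |τ|) * |t - τ|) ∧
    |(1 + t) * (rootOdds τ * (rootOdds t - rootOdds τ)) + (t - τ) / 2| ≤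
      (M + 2 * M ^ 2) * ((|t| + |τ|) * |t - τ|) := by
  have h0 : |(0 : ℝ)| ≤ 1 - s := by
    rw [abs_zero]
    exact (abs_nonneg t).trans ht
  obtain ⟨-, h1, h2⟩ := h t τ ht hτ
  have key : ∀ z, |z| ≤ 1 - s → |z| ≤ |t| + |τ| →
      |(1 + t) * (rootOdds z * (rootOdds t - rootOdds τ)) + (t - τ) / 2| ≤
      (M + 2 * M ^ 2) * ((|t| + |τ|) * |t - τ|) := by
    intro z hz hzt
    obtain ⟨h3, h4, -⟩ := h z 0 hz h0
    rw [rootOdds_zero, sub_zero] at h4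
    have h5 : |(1 + t) * rootOdds z - 1| ≤ 2 * M * (|t| + |τ|) := by
      calc _ = |(rootOdds z - 1) + t * rootOdds z| := by ring_nf
        _ ≤ M * |z| + |t| * M := by
          refine (abs_add_le _ _).trans ?_
          rw [abs_mul, abs_of_pos (rootOdds_pos z)]
          gcongr
        _ ≤ M * (|t| + |τ|) + (|t| + |τ|) * M := by
          gcongr
          linarith [abs_nonneg τ]
        _ = _ := by ring
    calc _ = |(rootOdds t - rootOdds τ + (t - τ) / 2) +
          ((1 + t) * rootOdds z - 1) * (rootOdds t - rootOdds τ)| := by ring_nf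
      _ ≤ M * (|t| + |τ|) * |t - τ| + 2 * M * (|t| + |τ|) * (M * |t - τ|) := by
        refine (abs_add_le _ _).trans ?_
        rw [abs_mul]
        gcongr
      _ = _ := by ring
  exact ⟨key t ht (le_add_of_nonneg_right (abs_nonneg _)),
    key τ hτ (le_add_of_nonneg_left (abs_nonneg _))⟩

/-- With `w = √(1 - a^2 z^2)` and `v = √(1 - a^2) ≤ w` the left side is `2(v^2 + a^2(1 - z))/w`.
Here `v^2/w ≤ v ≤ 1 - a^2/2`, and `w ≥ 1/32` gives the constant 64. -/
lemma rootOdds_sq_add_le {a z : ℝ} (ha : 1 / 1024 ≤ 1 - a ^ 2) (hz : |z| ≤ 1) :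
    (1 + a) * rootOdds (a * z) ^ 2 + (1 - a) * rootOdds (a * -z) ^ 2 ≤
      2 - a ^ 2 + 64 * a ^ 2 * (1 - z) := by
  have ha1 : |a| < 1 := by
    rw [← sq_lt_one_iff_abs_lt_one]
    linarith
  obtain ⟨hz0, hz1⟩ := abs_le.1 hz
  have hz2 : z ^ 2 ≤ 1 := by rwa [sq_le_one_iff_abs_le_one]
  have hτ : |a * z| < 1 := by
    rw [abs_mul]
    exact (mul_le_of_le_one_right (abs_nonneg _) hz).trans_lt ha1
  have h1 := rootOdds_sq hτ
  have h2 := rootOdds_sq (t := a * -z) (by rwa [mul_neg, abs_neg])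
  obtain ⟨h3, h4⟩ := abs_lt.1 hτ
  set w := √(1 - (a * z) ^ 2) with hw
  set v := √(1 - a ^ 2) with hv
  have hv0 : 1 / 32 ≤ v := Real.le_sqrt_of_sq_le (by norm_num; linarith)
  have hv2 : v ^ 2 = 1 - a ^ 2 := Real.sq_sqrt (by linarith)
  have hvw : v ≤ w := Real.sqrt_le_sqrt (by nlinarith [sq_nonneg a])
  have hw0 : 0 < w := by linarith
  have hw2 : w ^ 2 = 1 - (a * z) ^ 2 := Real.sq_sqrt (by nlinarith [sq_nonneg a])
  have hv1 : v ≤ 1 - a ^ 2 / 2 := by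
    rw [hv, Real.sqrt_le_left (by linarith [sq_nonneg a])]
    nlinarith [sq_nonneg (a ^ 2)]
  have h5 : rootOdds (a * z) ^ 2 = (1 - a * z) / w := by
    rw [eq_div_iff hw0.ne']
    have : (1 + a * z) ≠ 0 := by linarith
    apply mul_left_cancel₀ this
    linear_combination w * h1 + hw2
  have h6 : rootOdds (a * -z) ^ 2 = (1 + a * z) / w := by
    rw [mul_neg, neg_sq, ← hw] at h2
    rw [mul_neg, eq_div_iff hw0.ne']
    have : (1 + -(a * z)) ≠ 0 := by linarith
    apply mul_left_cancel₀ this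
    linear_combination w * h2 + hw2
  have h7 : (1 + a) * rootOdds (a * z) ^ 2 + (1 - a) * rootOdds (a * -z) ^ 2 =
      2 * (v ^ 2 + a ^ 2 * (1 - z)) / w := by
    rw [h5, h6, hv2]
    field_simp
    ring
  rw [h7, div_le_iff₀ hw0]
  have h8 : 0 ≤ a ^ 2 * (1 - z) := mul_nonneg (sq_nonneg _) (by linarith)
  have h9 : 1 ≤ 32 * w := by linarith
  have h10 : a ^ 2 * (1 - z) ≤ 32 * (a ^ 2 * (1 - z)) * w := by nlinarith
  have h11 : v ^ 2 ≤ (1 - a ^ 2 / 2) * w := by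
    rw [sq]
    exact mul_le_mul hv1 hvw (by linarith) (by linarith)
  nlinarith

variable {E : Type*} [MeasurableSpace E]

lemma sgn_sq (b : Bool) : sgn b ^ 2 = 1 := by
  rw [sq, sgn_mul_self]

lemma abs_message_le {η : I} (hη : 1 / 1024 ≤ min (η : ℝ) (1 - η)) (b : Bool) {z : ℝ}
    (hz : |z| ≤ 1) : |sgn b * (theta η * z)| ≤ 1 - 1 / 512 := by
  have := abs_sgn_mul_theta_mul_le η b hz
  linarith

lemma setIntegral_flipped_le_of_hasSum (d : ℝ≥0) (η : I) (ν : Measure E)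
    [IsProbabilityMeasure ν] (b : Bool) {f : Config E → ℝ} (hf : Integrable f (law d η ν))
    {g : ℕ → ℝ} {G : ℝ} (hg : HasSum g G) (h : ∀ n, ∫ ω in rootEvent b n, f ω ∂law d η ν ≤ g n) :
    ∫ ω in {ω | flipped ω [] = b}, f ω ∂law d η ν ≤ G := by
  rw [← iUnion_rootEvent]
  exact hasSum_le h (hasSum_integral_iUnion (measurableSet_rootEvent b)
    (pairwise_disjoint_rootEvent b) hf.integrableOn) hg

lemma integral_bp (d : ℝ≥0) (η : I) (ν : Measure E) [IsProbabilityMeasure ν] (k : ℕ) :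
    ∫ ω, bp (theta η) k ω ∂law d η ν = 0 := by
  have h := integral_bp_mul d η ν (k := k) (f := fun _ => 1) measurable_const (M := 1) (by simp)
    (by simp)
  simpa [law_real_flipped] using h

lemma sq_integral_abs_le {μ : Measure (Config E)} [IsProbabilityMeasure μ] {f : Config E → ℝ}
    (hf : Integrable f μ) (hf2 : Integrable (fun ω => f ω ^ 2) μ) :
    (∫ ω, |f ω| ∂μ) ^ 2 ≤ ∫ ω, f ω ^ 2 ∂μ := by
  set m := ∫ ω, |f ω| ∂μ with hm
  have h1 : 0 ≤ ∫ ω, (|f ω| - m) ^ 2 ∂μ := integral_nonneg fun ω => sq_nonneg _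
  have h2 : ∀ ω, (|f ω| - m) ^ 2 = f ω ^ 2 - 2 * m * |f ω| + m ^ 2 := fun ω => by
    rw [sub_sq, sq_abs]
    ring
  simp only [h2] at h1
  have h3 : Integrable (fun ω => f ω ^ 2 - 2 * m * |f ω|) μ := hf2.sub (hf.abs.const_mul _)
  rw [integral_add h3 (integrable_const _), integral_sub hf2 (hf.abs.const_mul _),
    integral_const_mul, ← hm] at h1
  simp only [integral_const, probReal_univ, smul_eq_mul] at h1
  linarith

namespace IsEstimator

variable {d : ℝ≥0} {η : I} {ν : Measure E} [IsProbabilityMeasure ν]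
  {c ε : ℝ} {K : ℕ} {y : List ℕ → ℕ → Config E → ℝ}
  (hy : IsEstimator d η ν c ε K y) (hκ : ε / 2 + 2 * Real.exp (-c * d) ≤ 1 / 1024)
  (hη : 1 / 1024 ≤ min (η : ℝ) (1 - η))

include hy hκ

/-- The bound `X^2 ≥ 2Xy - 1` and `E[Xy] = E[σy]`, which is close to 1, make `X` informative. -/
lemma half_le_integral_bp_sq (u : List ℕ) {k : ℕ} (hk : K ≤ k) :
    1 / 2 ≤ ∫ ω, bp (theta η) k ω ^ 2 ∂law d η ν := by
  have hI := (hy.setIntegral_one_sub_le u hk).trans hκ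
  have hm := hy.measurable u hk
  have h1 := integral_bp_mul d η ν hm (hy.abs_le u k hk) (hy.comp_view u hk)
  have h2 := hy.setIntegral_flipped_true u hk measurable_id
  simp only [id] at h2
  rw [h2, integral_neg, sub_neg_eq_add] at h1
  rw [integral_sub (integrable_const _) (hy.integrable u hk)] at hI
  simp only [setIntegral_const, law_real_flipped, smul_eq_mul] at hI
  have hbp2 : Integrable (fun ω => bp (theta η) k ω ^ 2) (law d η ν) :=
    integrable_of_abs_le ((measurable_bp _ k).pow_const 2) (M := 1) fun ω => by
      rw [abs_pow]
      exact pow_le_one₀ (abs_nonneg _) (abs_bp_le (abs_theta_le η) k ω)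
  have hxy : Integrable (fun ω => bp (theta η) k ω * y u k ω) (law d η ν) :=
    integrable_of_abs_le ((measurable_bp _ k).mul hm) (M := 1) fun ω => by
      rw [abs_mul]
      exact mul_le_one₀ (abs_bp_le (abs_theta_le η) k ω) (abs_nonneg _) (hy.abs_le u k hk ω)
  have h3 : ∫ ω, (2 * (bp (theta η) k ω * y u k ω) - 1) ∂law d η ν ≤
      ∫ ω, bp (theta η) k ω ^ 2 ∂law d η ν := by
    refine integral_mono ((hxy.const_mul 2).sub (integrable_const _)) hbp2 fun ω => ?_
    have h4 : y u k ω ^ 2 ≤ 1 := (sq_le_one_iff_abs_le_one _).2 (hy.abs_le u k hk ω)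
    simp only
    nlinarith [sq_nonneg (bp (theta η) k ω - y u k ω)]
  rw [integral_sub (hxy.const_mul 2) (integrable_const _), integral_const_mul, h1] at h3
  simp only [integral_const, probReal_univ, smul_eq_mul] at h3
  linarith

include hη

/-- The mean is `E √(1 - θ^2 X^2) ≤ 1 - θ^2 E[X^2]/2`, and `E[X^2] ≥ 1/2`. -/
lemma integral_rootOdds_bp_sq_le (u : List ℕ) {k : ℕ} (hk : K ≤ k) (b : Bool) :
    ∫ ω, rootOdds (sgn b * (theta η * bp (theta η) k ω)) ^ 2 ∂childLaw d η ν b ≤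
      1 - theta η ^ 2 / 4 := by
  have hm : Measurable fun ω : Config E => sgn b * (theta η * bp (theta η) k ω) :=
    ((measurable_bp _ k).const_mul _).const_mul _
  have h1 := hy.half_le_integral_bp_sq hκ u hk
  have hbp2 : Integrable (fun ω => bp (theta η) k ω ^ 2) (law d η ν) :=
    integrable_of_abs_le ((measurable_bp _ k).pow_const 2) (M := 1) fun ω => by
      rw [abs_pow]
      exact pow_le_one₀ (abs_nonneg _) (abs_bp_le (abs_theta_le η) k ω)
  have ht := fun ω : Config E => abs_message_le hη b (abs_bp_le (abs_theta_le η) k ω)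
  have hm2 : Measurable fun ω : Config E =>
      rootOdds (sgn b * (theta η * bp (theta η) k ω)) ^ 2 :=
    (measurable_rootOdds.comp hm).pow_const 2
  rw [integral_childLaw_eq d η ν b (k := k) hm2 fun ω => by rw [bp_view _ le_rfl]]
  calc _ ≤ ∫ ω, (1 - theta η ^ 2 / 2 * bp (theta η) k ω ^ 2) ∂law d η ν := by
        have hle : ∀ ω : Config E, (1 + sgn b * (theta η * bp (theta η) k ω)) *
            rootOdds (sgn b * (theta η * bp (theta η) k ω)) ^ 2 ≤
            1 - theta η ^ 2 / 2 * bp (theta η) k ω ^ 2 := by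
          intro ω
          rw [rootOdds_sq ((ht ω).trans_lt (by norm_num)), mul_pow, sgn_sq, one_mul, mul_pow]
          have h2 : theta η ^ 2 * bp (theta η) k ω ^ 2 ≤ 1 := by
            rw [← mul_pow, sq_le_one_iff_abs_le_one]
            exact abs_theta_mul_bp_le η k ω
          rw [Real.sqrt_le_left (by linarith)]
          nlinarith [sq_nonneg (theta η ^ 2 * bp (theta η) k ω ^ 2)]
        refine integral_mono (integrable_of_abs_le (M := 1) ?_ fun ω => ?_)
          ((integrable_const _).sub (hbp2.const_mul _)) hle
        · exact (hm.const_add 1).mul hm2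
        · have h3 : 0 ≤ (1 + sgn b * (theta η * bp (theta η) k ω)) *
            rootOdds (sgn b * (theta η * bp (theta η) k ω)) ^ 2 :=
            mul_nonneg (childDensity_nonneg η k b ω) (sq_nonneg _)
          have h4 : 0 ≤ theta η ^ 2 / 2 * bp (theta η) k ω ^ 2 := by positivity
          rw [abs_of_nonneg h3]
          linarith [hle ω]
    _ ≤ _ := by
        rw [integral_sub (integrable_const _) (hbp2.const_mul _), integral_const_mul]
        simp only [integral_const, probReal_univ, smul_eq_mul]
        nlinarith [sq_nonneg (theta η)]

/-- As `y` is not a posterior mean, the density does not cancel. The sign symmetry instead folds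
both labels onto `+`, where `rootOdds_sq_add_le` applies; the loss `64 a^2 / 1024` uses only part of
the gain `a^2/2`. -/
lemma integral_rootOdds_estimator_sq_le (u : List ℕ) {k : ℕ} (hk : K ≤ k) (b : Bool) :
    ∫ ω, rootOdds (sgn b * (theta η * y u k ω)) ^ 2 ∂childLaw d η ν b ≤
      1 - theta η ^ 2 / 4 := by
  have hI := (hy.setIntegral_one_sub_le u hk).trans hκ
  have hym := hy.measurable u hk
  obtain ⟨M, hM, hMb⟩ := exists_rootOdds_bounds (s := 1 / 512) (by norm_num)
  set a := sgn b * theta η with ha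
  have ha2 : a ^ 2 = theta η ^ 2 := by rw [ha, mul_pow, sgn_sq, one_mul]
  have ha1 : 1 / 1024 ≤ 1 - a ^ 2 := by
    rw [ha2, ← sq_abs, abs_theta_eq]
    have h0 := η.2.1
    have h1 := η.2.2
    have : min (η : ℝ) (1 - η) ≤ 1 / 2 := by
      rcases le_total (η : ℝ) (1 / 2) with h | h
      · exact (min_le_left _ _).trans h
      · exact (min_le_right _ _).trans (by linarith)
    nlinarith
  let h : ℝ → ℝ := fun z => rootOdds (a * z) ^ 2
  have hh : Measurable h := (measurable_rootOdds.comp (measurable_const_mul a)).pow_const 2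
  have hbd : ∀ z, |z| ≤ 1 → |h z| ≤ M ^ 2 := by
    intro z hz
    have h1 := abs_message_le hη b hz
    rw [← mul_assoc, ← ha] at h1
    simp only [h]
    rw [abs_pow, abs_of_pos (rootOdds_pos _)]
    exact pow_le_pow_left₀ (rootOdds_pos _).le (hMb _ _ h1 h1).1 2
  have hint : ∀ {f : Config E → ℝ}, Measurable f → (∀ ω, |f ω| ≤ 1) → ∀ {μ : Measure (Config E)},
      IsFiniteMeasure μ → Integrable (fun ω => h (f ω)) μ := fun hf hf1 _ _ =>
    integrable_of_abs_le (hh.comp hf) fun ω => hbd _ (hf1 ω)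
  have hbpm : Integrable (fun ω => bp (theta η) k ω * h (y u k ω)) (law d η ν) := by
    refine integrable_of_abs_le (M := 1 * M ^ 2) ((measurable_bp _ k).mul (hh.comp hym)) fun ω => ?_
    rw [abs_mul]
    exact mul_le_mul (abs_bp_le (abs_theta_le η) k ω) (hbd _ (hy.abs_le u k hk ω))
      (abs_nonneg _) zero_le_one
  have hyint := fun {μ : Measure (Config E)} (hμ : IsFiniteMeasure μ) =>
    hint hym (hy.abs_le u k hk) hμ
  have hynint : ∀ {μ : Measure (Config E)}, IsFiniteMeasure μ →
      Integrable (fun ω => h (-y u k ω)) μ := fun hμ =>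
    hint hym.neg (fun ω => (abs_neg (y u k ω)).trans_le (hy.abs_le u k hk ω)) hμ
  have h1 := integral_childLaw_eq d η ν b (k := k) (hh.comp hym) fun ω => by
    simp only [Function.comp, hy.comp_view u hk]
  have h2 := integral_bp_mul d η ν (k := k) (hh.comp hym) (fun ω => hbd _ (hy.abs_le u k hk ω))
    fun ω => by simp only [Function.comp, hy.comp_view u hk]
  have h3 := hy.setIntegral_flipped_true u hk hh
  have h4 := integral_add_compl (measurableSet_flipped true) (hyint (μ := law d η ν) inferInstance)
  rw [compl_flipped_true] at h4
  simp only [Function.comp] at h1 h2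
  have h5 : ∫ ω, (1 + sgn b * (theta η * bp (theta η) k ω)) * h (y u k ω) ∂law d η ν =
      ∫ ω, h (y u k ω) ∂law d η ν + a * ∫ ω, bp (theta η) k ω * h (y u k ω) ∂law d η ν := by
    rw [← integral_const_mul, ← integral_add (hyint inferInstance) (hbpm.const_mul a)]
    refine integral_congr_ae (ae_of_all _ fun ω => ?_)
    simp only [ha]
    ring
  have hone : Integrable (fun ω => 1 - y u k ω)
      ((law d η ν).restrict {ω | flipped ω [] = false}) :=
    (integrable_const _).sub (hy.integrable u hk)
  have h6 : ∫ ω in {ω | flipped ω [] = false}, ((1 + a) * h (y u k ω) + (1 - a) * h (-y u k ω))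
      ∂law d η ν ≤ ∫ ω in {ω | flipped ω [] = false},
        (2 - a ^ 2 + 64 * a ^ 2 * (1 - y u k ω)) ∂law d η ν := by
    refine integral_mono (((hyint inferInstance).const_mul _).add
      ((hynint inferInstance).const_mul _)) ((integrable_const _).add
        (hone.const_mul _)) fun ω => ?_
    exact rootOdds_sq_add_le ha1 (hy.abs_le u k hk ω)
  rw [integral_add ((hyint inferInstance).const_mul _) ((hynint inferInstance).const_mul _),
    integral_const_mul, integral_const_mul, integral_add (integrable_const _) (hone.const_mul _),
    integral_const_mul,
    setIntegral_const, law_real_flipped, smul_eq_mul, ← h3] at h6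
  have h7 : ∫ ω, rootOdds (sgn b * (theta η * y u k ω)) ^ 2 ∂childLaw d η ν b =
      ∫ ω, h (y u k ω) ∂childLaw d η ν b := by
    simp only [h, ha, mul_assoc]
  rw [h7, h1, h5, h2, ← h4]
  have h8 : 64 * a ^ 2 * ∫ ω in {ω | flipped ω [] = false}, (1 - y u k ω) ∂law d η ν ≤
      64 * a ^ 2 * (1 / 1024) := mul_le_mul_of_nonneg_left hI (by positivity)
  rw [← ha2]
  nlinarith [sq_nonneg a]

end IsEstimator

end

/-! ### Moderate noise: the contraction in mean square. -/

section

variable {E : Type*} [MeasurableSpace E]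

lemma abs_theta_mul_sub_le (η : I) (b : Bool) {x y : ℝ} (hx : |x| ≤ 1) (hy : |y| ≤ 1) :
    (|sgn b * (theta η * x)| + |sgn b * (theta η * y)|) *
      |sgn b * (theta η * x) - sgn b * (theta η * y)| ≤ 2 * theta η ^ 2 * |x - y| := by
  rw [← mul_sub, ← mul_sub]
  simp only [abs_mul, abs_sgn, one_mul]
  rw [← sq_abs (theta η)]
  have h1 : 0 ≤ |theta η| ^ 2 * |x - y| := by positivity
  calc _ = (|x| + |y|) * (|theta η| ^ 2 * |x - y|) := by ring
    _ ≤ 2 * (|theta η| ^ 2 * |x - y|) := by gcongr; linarith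
    _ = _ := by ring

namespace IsEstimator

variable {d : ℝ≥0} {η : I} {ν : Measure E} [IsProbabilityMeasure ν]
  {c ε : ℝ} {K : ℕ} {y : List ℕ → ℕ → Config E → ℝ}
  (hy : IsEstimator d η ν c ε K y)

include hy

/-- Under the change of measure the linear part of the integrand is a multiple of `X - y`, and both
have mean zero. The remainder is quadratic in the messages, hence the gain of `θ^2` instead of
`|θ|`, which small `θ` requires. -/
lemma abs_integral_childLaw_le (u : List ℕ) {k : ℕ} (hk : K ≤ k) (b : Bool) {N B : ℝ}
    (hN : 0 ≤ N) {φ : Config E → ℝ} (hφ : Measurable φ) (hφB : ∀ ω, |φ ω| ≤ B)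
    (hφv : ∀ ω, φ (view k ω) = φ ω)
    (h : ∀ ω, |(1 + sgn b * (theta η * bp (theta η) k ω)) * φ ω +
      (sgn b * (theta η * bp (theta η) k ω) - sgn b * (theta η * y u k ω)) / 2| ≤
      N * ((|sgn b * (theta η * bp (theta η) k ω)| + |sgn b * (theta η * y u k ω)|) *
        |sgn b * (theta η * bp (theta η) k ω) - sgn b * (theta η * y u k ω)|)) :
    |∫ ω, φ ω ∂childLaw d η ν b| ≤
      2 * N * theta η ^ 2 * ∫ ω, |bp (theta η) k ω - y u k ω| ∂law d η ν := by
  have hxm : Measurable fun ω : Config E => sgn b * (theta η * bp (theta η) k ω) :=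
    ((measurable_bp _ k).const_mul _).const_mul _
  have hd : Integrable (fun ω => bp (theta η) k ω - y u k ω) (law d η ν) :=
    (integrable_bp η k).sub (hy.integrable u hk)
  have h1 : ∫ ω, (sgn b * (theta η * bp (theta η) k ω) - sgn b * (theta η * y u k ω)) / 2
      ∂law d η ν = 0 := by
    have h2 : ∀ ω, (sgn b * (theta η * bp (theta η) k ω) - sgn b * (theta η * y u k ω)) / 2 =
        sgn b * theta η / 2 * (bp (theta η) k ω - y u k ω) := fun ω => by ring
    simp only [h2]
    rw [integral_const_mul, integral_sub (integrable_bp η k) (hy.integrable u hk), integral_bp,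
      hy.integral_eq_zero u hk, sub_zero, mul_zero]
  have hI1 : Integrable (fun ω => (1 + sgn b * (theta η * bp (theta η) k ω)) * φ ω)
      (law d η ν) := by
    refine integrable_of_abs_le (M := 2 * B) ((hxm.const_add 1).mul hφ) fun ω => ?_
    rw [abs_mul]
    refine mul_le_mul ?_ (hφB ω) (abs_nonneg _) zero_le_two
    have h3 : |sgn b * (theta η * bp (theta η) k ω)| ≤ 1 := by
      rw [abs_mul, abs_sgn, one_mul]
      exact abs_theta_mul_bp_le η k ω
    refine (abs_add_le _ _).trans ?_
    rw [abs_one]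
    linarith
  have hI2 : Integrable (fun ω => (sgn b * (theta η * bp (theta η) k ω) -
      sgn b * (theta η * y u k ω)) / 2) (law d η ν) :=
    ((((integrable_bp η k).const_mul _).const_mul _).sub
      (((hy.integrable u hk).const_mul _).const_mul _)).div_const 2
  have h2 : ∫ ω, φ ω ∂childLaw d η ν b =
      ∫ ω, ((1 + sgn b * (theta η * bp (theta η) k ω)) * φ ω +
        (sgn b * (theta η * bp (theta η) k ω) - sgn b * (theta η * y u k ω)) / 2) ∂law d η ν := by
    rw [integral_add hI1 hI2, h1, add_zero, integral_childLaw_eq d η ν b hφ hφv]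
  rw [h2, ← integral_const_mul]
  refine (abs_integral_le_integral_abs).trans
    (integral_mono (hI1.add hI2).abs (hd.abs.const_mul _) fun ω => (h ω).trans ?_)
  have h4 := abs_theta_mul_sub_le η b (abs_bp_le (abs_theta_le η) k ω) (hy.abs_le u k hk ω)
  calc _ ≤ N * (2 * theta η ^ 2 * |bp (theta η) k ω - y u k ω|) := by gcongr
    _ = _ := by ring

variable (hη : 1 / 1024 ≤ min (η : ℝ) (1 - η)) {M : ℝ} (hM : 0 ≤ M)
  (hMb : ∀ t τ : ℝ, |t| ≤ 1 - 1 / 512 → |τ| ≤ 1 - 1 / 512 → rootOdds t ≤ M ∧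
    |rootOdds t - rootOdds τ| ≤ M * |t - τ| ∧
    |rootOdds t - rootOdds τ + (t - τ) / 2| ≤ M * (|t| + |τ|) * |t - τ|)

include hη hM hMb

lemma integral_rootOdds_cross (u : List ℕ) {k : ℕ} (hk : K ≤ k) (b : Bool) :
    ∫ ω, rootOdds (sgn b * (theta η * bp (theta η) k ω)) ^ 2 ∂childLaw d η ν b -
      2 * ∫ ω, rootOdds (sgn b * (theta η * bp (theta η) k ω)) *
        rootOdds (sgn b * (theta η * y u k ω)) ∂childLaw d η ν b +
      ∫ ω, rootOdds (sgn b * (theta η * y u k ω)) ^ 2 ∂childLaw d η ν b ≤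
        2 * M ^ 2 * theta η ^ 2 * ∫ ω, (bp (theta η) k ω - y u k ω) ^ 2 ∂law d η ν ∧
    |∫ ω, rootOdds (sgn b * (theta η * bp (theta η) k ω)) ^ 2 ∂childLaw d η ν b -
      ∫ ω, rootOdds (sgn b * (theta η * bp (theta η) k ω)) *
        rootOdds (sgn b * (theta η * y u k ω)) ∂childLaw d η ν b| ≤
        2 * (M + 2 * M ^ 2) * theta η ^ 2 * ∫ ω, |bp (theta η) k ω - y u k ω| ∂law d η ν ∧
    |∫ ω, rootOdds (sgn b * (theta η * y u k ω)) ^ 2 ∂childLaw d η ν b -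
      ∫ ω, rootOdds (sgn b * (theta η * bp (theta η) k ω)) *
        rootOdds (sgn b * (theta η * y u k ω)) ∂childLaw d η ν b| ≤
        2 * (M + 2 * M ^ 2) * theta η ^ 2 * ∫ ω, |bp (theta η) k ω - y u k ω| ∂law d η ν := by
  let t : Config E → ℝ := fun ω => sgn b * (theta η * bp (theta η) k ω)
  let τ : Config E → ℝ := fun ω => sgn b * (theta η * y u k ω)
  have htm : Measurable t := ((measurable_bp _ k).const_mul _).const_mul _
  have hτm : Measurable τ := ((hy.measurable u hk).const_mul _).const_mul _
  have ht := fun ω : Config E => abs_message_le hη b (abs_bp_le (abs_theta_le η) k ω)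
  have hτ := fun ω => abs_message_le hη b (hy.abs_le u k hk ω)
  have htv : ∀ ω, t (view k ω) = t ω := fun ω => by simp only [t, bp_view _ le_rfl]
  have hτv : ∀ ω, τ (view k ω) = τ ω := fun ω => by simp only [τ, hy.comp_view u hk]
  have hF : ∀ z, |z| ≤ 1 - 1 / 512 → |rootOdds z| ≤ M := fun z hz => by
    rw [abs_of_pos (rootOdds_pos _)]
    exact (hMb z z hz hz).1
  have hFt : Measurable fun ω => rootOdds (t ω) := measurable_rootOdds.comp htm
  have hFτ : Measurable fun ω => rootOdds (τ ω) := measurable_rootOdds.comp hτm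
  have hmul : ∀ z w : Config E → ℝ, Measurable (fun ω => rootOdds (z ω)) →
      Measurable (fun ω => rootOdds (w ω)) → (∀ ω, |z ω| ≤ 1 - 1 / 512) →
      (∀ ω, |w ω| ≤ 1 - 1 / 512) →
      Integrable (fun ω => rootOdds (z ω) * rootOdds (w ω)) (childLaw d η ν b) :=
    fun z w hz hw hz1 hw1 => integrable_of_abs_le (hz.mul hw) (M := M * M) fun ω => by
      rw [abs_mul]
      exact mul_le_mul (hF _ (hz1 ω)) (hF _ (hw1 ω)) (abs_nonneg _) hM
  have htt := hmul t t hFt hFt ht ht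
  have htτ := hmul t τ hFt hFτ ht hτ
  have hττ := hmul τ τ hFτ hFτ hτ hτ
  simp only [← pow_two] at htt hττ
  have hφB : ∀ z : Config E → ℝ, (∀ ω, |z ω| ≤ 1 - 1 / 512) → ∀ ω,
      |rootOdds (z ω) * (rootOdds (t ω) - rootOdds (τ ω))| ≤ M * (2 * M) := fun z hz ω => by
    rw [abs_mul]
    refine mul_le_mul (hF _ (hz ω)) ?_ (abs_nonneg _) hM
    exact (abs_sub _ _).trans (by linarith [hF _ (ht ω), hF _ (hτ ω)])
  have hN : 0 ≤ M + 2 * M ^ 2 := by positivity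
  have hpt := fun ω => abs_mul_rootOdds_mul_sub_le hM hMb (ht ω) (hτ ω)
  refine ⟨?_, ?_, ?_⟩
  · have hd2 : Integrable (fun ω => (bp (theta η) k ω - y u k ω) ^ 2) (law d η ν) := by
      refine integrable_of_abs_le (M := 4) (((measurable_bp _ k).sub
        (hy.measurable u hk)).pow_const 2) fun ω => ?_
      have h1 := _root_.abs_le.1 (abs_bp_le (abs_theta_le η) k ω)
      have h2 := _root_.abs_le.1 (hy.abs_le u k hk ω)
      rw [_root_.abs_le]
      constructor <;> nlinarith
    have h1 : ∫ ω, (rootOdds (t ω) - rootOdds (τ ω)) ^ 2 ∂childLaw d η ν b =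
        ∫ ω, rootOdds (t ω) ^ 2 ∂childLaw d η ν b -
        2 * ∫ ω, rootOdds (t ω) * rootOdds (τ ω) ∂childLaw d η ν b +
        ∫ ω, rootOdds (τ ω) ^ 2 ∂childLaw d η ν b := by
      have h2 : Integrable (fun ω => rootOdds (t ω) ^ 2 - 2 * (rootOdds (t ω) * rootOdds (τ ω)))
        (childLaw d η ν b) := htt.sub (htτ.const_mul 2)
      rw [← integral_const_mul, ← integral_sub htt (htτ.const_mul 2), ← integral_add h2 hττ]
      refine integral_congr_ae (ae_of_all _ fun ω => ?_)
      simp only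
      ring
    have hm : Measurable fun ω => (rootOdds (t ω) - rootOdds (τ ω)) ^ 2 :=
      (hFt.sub hFτ).pow_const 2
    refine h1.symm.trans_le ?_
    rw [integral_childLaw_eq d η ν b (k := k) hm fun ω => by rw [htv, hτv], ← integral_const_mul]
    have hle : ∀ ω, (1 + sgn b * (theta η * bp (theta η) k ω)) *
        (rootOdds (t ω) - rootOdds (τ ω)) ^ 2 ≤
        2 * M ^ 2 * theta η ^ 2 * (bp (theta η) k ω - y u k ω) ^ 2 := by
      intro ω
      have h3 : (rootOdds (t ω) - rootOdds (τ ω)) ^ 2 ≤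
          M ^ 2 * theta η ^ 2 * (bp (theta η) k ω - y u k ω) ^ 2 := by
        have h4 := (hMb _ _ (ht ω) (hτ ω)).2.1
        have h5 := pow_le_pow_left₀ (abs_nonneg _) h4 2
        rw [sq_abs, mul_pow, sq_abs] at h5
        refine h5.trans (le_of_eq ?_)
        rw [← mul_sub, ← mul_sub, mul_pow, mul_pow, sgn_sq]
        ring
      have h4 : 1 + sgn b * (theta η * bp (theta η) k ω) ≤ 2 := by
        linarith [(_root_.abs_le.1 (ht ω)).2]
      calc _ ≤ 2 * (M ^ 2 * theta η ^ 2 * (bp (theta η) k ω - y u k ω) ^ 2) :=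
            mul_le_mul h4 h3 (sq_nonneg _) zero_le_two
        _ = _ := by ring
    refine integral_mono_of_nonneg (ae_of_all _ fun ω =>
      mul_nonneg (childDensity_nonneg η k b ω) (sq_nonneg _)) (hd2.const_mul _)
      (ae_of_all _ hle)
  · rw [← integral_sub htt htτ]
    have := hy.abs_integral_childLaw_le u hk b hN
      (φ := fun ω => rootOdds (t ω) * (rootOdds (t ω) - rootOdds (τ ω)))
      (hFt.mul (hFt.sub hFτ)) (hφB t ht) (fun ω => by simp only [htv, hτv])
      (fun ω => (hpt ω).1)
    refine le_trans (le_of_eq ?_) this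
    congr 1
    refine integral_congr_ae (ae_of_all _ fun ω => ?_)
    simp only [t, τ]
    ring
  · rw [← integral_sub hττ htτ, ← abs_neg, ← integral_neg]
    have := hy.abs_integral_childLaw_le u hk b hN
      (φ := fun ω => rootOdds (τ ω) * (rootOdds (t ω) - rootOdds (τ ω)))
      (hFτ.mul (hFt.sub hFτ)) (hφB τ hτ) (fun ω => by simp only [htv, hτv])
      (fun ω => (hpt ω).2)
    refine le_trans (le_of_eq ?_) this
    congr 1
    refine integral_congr_ae (ae_of_all _ fun ω => ?_)
    simp only [t, τ]
    ring

variable (hκ : ε / 2 + 2 * Real.exp (-c * d) ≤ 1 / 1024)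

include hκ

lemma setIntegral_sq_sub_succ_le {k : ℕ} (hk : K ≤ k) {δ : ℝ}
    (hδ : ∀ u, ∫ ω, (bp (theta η) k ω - y u k ω) ^ 2 ∂law d η ν ≤ δ) (u : List ℕ) (b : Bool) :
    ∫ ω in {ω | flipped ω [] = b}, (bp (theta η) (k + 1) ω - y u (k + 1) ω) ^ 2 ∂law d η ν ≤
      32 * ((2 * M ^ 2 * theta η ^ 2 * δ) * (d * Real.exp (-d * (1 - (1 - theta η ^ 2 / 4)))) +
        (2 * (M + 2 * M ^ 2) * theta η ^ 2 * √δ) ^ 2 *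
          (d ^ 2 * Real.exp (-d * (1 - (1 - theta η ^ 2 / 4))))) := by
  have hδ0 : 0 ≤ δ := (integral_nonneg fun ω => sq_nonneg _).trans (hδ [])
  have hN : 0 ≤ M + 2 * M ^ 2 := by positivity
  have hsq : ∀ v j, K ≤ j → Integrable (fun ω => (bp (theta η) j ω - y v j ω) ^ 2)
      (law d η ν) := by
    intro v j hj
    refine integrable_of_abs_le (M := 4) (((measurable_bp _ j).sub
      (hy.measurable v hj)).pow_const 2) fun ω => ?_
    have h1 := _root_.abs_le.1 (abs_bp_le (abs_theta_le η) j ω)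
    have h2 := _root_.abs_le.1 (hy.abs_le v j hj ω)
    rw [_root_.abs_le]
    constructor <;> nlinarith
  have he : ∀ v, ∫ ω, |bp (theta η) k ω - y v k ω| ∂law d η ν ≤ √δ := fun v =>
    Real.le_sqrt_of_sq_le ((sq_integral_abs_le ((integrable_bp η k).sub
      (hy.integrable v hk)) (hsq v k hk)).trans (hδ v))
  let t : Config E → ℝ := fun ω => sgn b * (theta η * bp (theta η) k ω)
  let τ : ℕ → Config E → ℝ := fun i ω => sgn b * (theta η * y (u ++ [i]) k ω)
  have ht : ∀ ω, |t ω| ≤ 1 - 1 / 512 := fun ω =>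
    abs_message_le hη b (abs_bp_le (abs_theta_le η) k ω)
  have hτ : ∀ i ω, |τ i ω| ≤ 1 - 1 / 512 := fun i ω => abs_message_le hη b (hy.abs_le _ k hk ω)
  have hFt : Measurable fun ω => rootOdds (t ω) :=
    measurable_rootOdds.comp (((measurable_bp _ k).const_mul _).const_mul _)
  have hFτ : ∀ i, Measurable fun ω => rootOdds (τ i ω) := fun i =>
    measurable_rootOdds.comp (((hy.measurable _ hk).const_mul _).const_mul _)
  have hFM : ∀ z, |z| ≤ 1 - 1 / 512 → |rootOdds z| ≤ M := fun z hz => by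
    rw [abs_of_pos (rootOdds_pos _)]
    exact (hMb z z hz hz).1
  have hbM : ∀ z w, |z| ≤ 1 - 1 / 512 → |w| ≤ 1 - 1 / 512 →
      |rootOdds z * rootOdds w| ≤ M * M := fun z w hz hw => by
    rw [abs_mul]
    exact mul_le_mul (hFM z hz) (hFM w hw) (abs_nonneg _) hM
  set a : ℕ → ℝ := fun _ => ∫ ω, rootOdds (t ω) ^ 2 ∂childLaw d η ν b with ha
  set m : ℕ → ℝ := fun i => ∫ ω, rootOdds (t ω) * rootOdds (τ i ω) ∂childLaw d η ν b with hm
  set e : ℕ → ℝ := fun i => ∫ ω, rootOdds (τ i ω) ^ 2 ∂childLaw d η ν b with hE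
  have hcross := fun i => hy.integral_rootOdds_cross hη hM hMb (u ++ [i]) hk b
  have haq : ∀ i, a i ≤ 1 - theta η ^ 2 / 4 := fun i =>
    hy.integral_rootOdds_bp_sq_le hκ hη u hk b
  have heq : ∀ i, e i ≤ 1 - theta η ^ 2 / 4 := fun i =>
    hy.integral_rootOdds_estimator_sq_le hκ hη (u ++ [i]) hk b
  have hI : ∀ z w : Config E → ℝ, Measurable (fun ω => rootOdds (z ω)) →
      Measurable (fun ω => rootOdds (w ω)) → (∀ ω, |z ω| ≤ 1 - 1 / 512) →
      (∀ ω, |w ω| ≤ 1 - 1 / 512) →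
      Integrable (fun ω => rootOdds (z ω) * rootOdds (w ω)) (childLaw d η ν b) :=
    fun z w hz hw hz1 hw1 => integrable_of_abs_le (hz.mul hw) fun ω => hbM _ _ (hz1 ω) (hw1 ω)
  -- The mixed moment is at most the average of the two pure ones.
  have hmq : ∀ i, m i ≤ 1 - theta η ^ 2 / 4 := by
    intro i
    have h1 : m i ≤ (a i + e i) / 2 := by
      have h2 : Integrable (fun ω => rootOdds (t ω) ^ 2) (childLaw d η ν b) := by
        simpa only [pow_two] using hI t t hFt hFt ht ht
      have h3 : Integrable (fun ω => rootOdds (τ i ω) ^ 2) (childLaw d η ν b) := by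
        simpa only [pow_two] using hI (τ i) (τ i) (hFτ i) (hFτ i) (hτ i) (hτ i)
      simp only [hm, ha, hE]
      rw [← integral_add h2 h3, ← integral_div]
      refine integral_mono (hI t (τ i) hFt (hFτ i) ht (hτ i)) ((h2.add h3).div_const 2)
        fun ω => ?_
      have := sq_nonneg (rootOdds (t ω) - rootOdds (τ i ω))
      simp only
      nlinarith
    linarith [haq i, heq i]
  have hprod := fun n => prod_sub_two_prod_add_prod_le (n := n) (a := a) (b := m) (c := e)
    (q := 1 - theta η ^ 2 / 4) (α := 2 * M ^ 2 * theta η ^ 2 * δ)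
    (β := 2 * (M + 2 * M ^ 2) * theta η ^ 2 * √δ)
    (fun i => integral_nonneg fun ω => sq_nonneg _)
    (fun i => integral_nonneg fun ω => mul_nonneg (rootOdds_pos _).le (rootOdds_pos _).le)
    (fun i => integral_nonneg fun ω => sq_nonneg _) haq hmq heq (by positivity)
    (fun i => (hcross i).1.trans (mul_le_mul_of_nonneg_left (hδ _) (by positivity)))
    (fun i => (hcross i).2.1.trans (mul_le_mul_of_nonneg_left (he _) (by positivity)))
    (fun i => (hcross i).2.2.trans (mul_le_mul_of_nonneg_left (he _) (by positivity)))
  have hsum := (((hasSum_poisson_mul_pow d (1 - theta η ^ 2 / 4)).mul_left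
    (2 * M ^ 2 * theta η ^ 2 * δ)).add ((hasSum_poisson_mul_pow_two d
      (1 - theta η ^ 2 / 4)).mul_left
        ((2 * (M + 2 * M ^ 2) * theta η ^ 2 * √δ) ^ 2))).mul_left 32
  refine setIntegral_flipped_le_of_hasSum d η ν b (hsq u (k + 1) (hk.trans k.le_succ)) hsum
    fun n => ?_
  have hPI : ∀ z w : ℕ → Config E → ℝ, (∀ i, Measurable fun ω => rootOdds (z i ω)) →
      (∀ i, Measurable fun ω => rootOdds (w i ω)) → (∀ i ω, |z i ω| ≤ 1 - 1 / 512) →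
      (∀ i ω, |w i ω| ≤ 1 - 1 / 512) →
      IntegrableOn (fun ω => ∏ i ∈ Finset.range n,
        rootOdds (z i (sub i ω)) * rootOdds (w i (sub i ω))) (rootEvent b n) (law d η ν) := by
    intro z w hz hw hz1 hw1
    refine integrable_of_abs_le (M := (M * M) ^ n) (Finset.measurable_prod _ fun i _ =>
      ((hz i).mul (hw i)).comp (measurable_sub i)) fun ω => ?_
    rw [Finset.abs_prod]
    simpa using Finset.prod_le_prod (s := Finset.range n) (fun i _ => abs_nonneg _)
      fun i _ => hbM _ _ (hz1 i (sub i ω)) (hw1 i (sub i ω))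
  have hA := hPI (fun _ => t) (fun _ => t) (fun _ => hFt) (fun _ => hFt) (fun _ => ht) fun _ => ht
  have hB := hPI (fun _ => t) τ (fun _ => hFt) hFτ (fun _ => ht) hτ
  have hC := hPI τ τ hFτ hFτ hτ hτ
  simp only [← pow_two] at hA hC
  have hD : IntegrableOn (fun ω => ∏ i ∈ Finset.range n, rootOdds (t (sub i ω)) ^ 2 -
      2 * ∏ i ∈ Finset.range n, rootOdds (t (sub i ω)) * rootOdds (τ i (sub i ω)))
      (rootEvent b n) (law d η ν) := hA.sub (hB.const_mul 2)
  -- Expanding the square of the difference of products leaves three products over independent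
  -- children. The constant is `64 = 8^2`, and the probability 1/2 of the root label turns it into
  -- 32.
  calc ∫ ω in rootEvent b n, (bp (theta η) (k + 1) ω - y u (k + 1) ω) ^ 2 ∂law d η ν
      ≤ ∫ ω in rootEvent b n, 64 * (∏ i ∈ Finset.range n, rootOdds (t (sub i ω)) ^ 2 -
          2 * ∏ i ∈ Finset.range n, rootOdds (t (sub i ω)) * rootOdds (τ i (sub i ω)) +
          ∏ i ∈ Finset.range n, rootOdds (τ i (sub i ω)) ^ 2) ∂law d η ν := by
        refine setIntegral_mono_on_ae (hsq u (k + 1) (hk.trans k.le_succ)).integrableOn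
          ((hD.add hC).const_mul 64) (measurableSet_rootEvent b n) ?_
        filter_upwards [hy.recursion u k hk] with ω hω hωn
        have h1 := abs_gmap_sub_le_prod_rootOdds (n := n) (t := fun i => t (sub i ω))
          (τ := fun i => τ i (sub i ω)) (fun i _ => (ht (sub i ω)).trans_lt (by norm_num))
          (fun i _ => (hτ i (sub i ω)).trans_lt (by norm_num))
        simp only [t, τ] at h1
        rw [gmap_sgn, gmap_sgn, ← mul_sub, abs_mul, abs_sgn, one_mul] at h1
        have h2 := pow_le_pow_left₀ (abs_nonneg _) h1 2
        rw [sq_abs, mul_pow, sq_abs] at h2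
        rw [hω, hωn.2]
        simp only [bp, hωn.2]
        refine h2.trans (le_of_eq ?_)
        simp only [t, τ, Finset.prod_pow, Finset.prod_mul_distrib]
        ring
    _ = 32 * (poissonMeasure d).real {n} * (∏ i ∈ Finset.range n, a i -
          2 * ∏ i ∈ Finset.range n, m i + ∏ i ∈ Finset.range n, e i) := by
        rw [integral_const_mul, integral_add hD hC, integral_sub hA (hB.const_mul 2),
          integral_const_mul,
          setIntegral_rootEvent_prod d η ν b n (fun _ ω => rootOdds (t ω) ^ 2)
            (fun _ => hFt.pow_const 2),
          setIntegral_rootEvent_prod d η ν b n (fun i ω => rootOdds (t ω) * rootOdds (τ i ω))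
            (fun i => hFt.mul (hFτ i)),
          setIntegral_rootEvent_prod d η ν b n (fun i ω => rootOdds (τ i ω) ^ 2)
            (fun i => (hFτ i).pow_const 2)]
        ring
    _ ≤ 32 * (poissonMeasure d).real {n} * _ :=
        mul_le_mul_of_nonneg_left (hprod n) (by positivity)
    _ = _ := by ring

end IsEstimator

end

/-! ### Convergence with moderate noise, and passage to the limit. -/

section

lemma tendsto_pow_mul_exp_neg_mul (n : ℕ) {b : ℝ} (hb : 0 < b) :
    Tendsto (fun x : ℝ => x ^ n * Real.exp (-b * x)) atTop (𝓝 0) := by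
  have := tendsto_rpow_mul_exp_neg_mul_atTop_nhds_zero n b hb
  simpa using this

namespace IsEstimator

variable {E : Type*} [MeasurableSpace E] {d : ℝ≥0} {η : I} {ν : Measure E}
  [IsProbabilityMeasure ν] {c ε : ℝ} {K : ℕ} {y : List ℕ → ℕ → Config E → ℝ}
  (hy : IsEstimator d η ν c ε K y)

include hy

lemma tendsto_integral_abs_sub_of_le_min (hη : 1 / 1024 ≤ min (η : ℝ) (1 - η)) {M : ℝ}
    (hM : 0 ≤ M)
    (hMb : ∀ t τ : ℝ, |t| ≤ 1 - 1 / 512 → |τ| ≤ 1 - 1 / 512 → rootOdds t ≤ M ∧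
      |rootOdds t - rootOdds τ| ≤ M * |t - τ| ∧
      |rootOdds t - rootOdds τ + (t - τ) / 2| ≤ M * (|t| + |τ|) * |t - τ|)
    (hκ : ε / 2 + 2 * Real.exp (-c * d) ≤ 1 / 1024)
    (hd : 64 * ((2 * M ^ 2) * ((theta η ^ 2 * d) ^ 1 * Real.exp (-(1 / 4) * (theta η ^ 2 * d))) +
      (4 * (M + 2 * M ^ 2) ^ 2) * ((theta η ^ 2 * d) ^ 2 *
        Real.exp (-(1 / 4) * (theta η ^ 2 * d)))) ≤ 1 / 2) :
    Tendsto (fun n => ∫ ω, |bp (theta η) (K + n) ω - y [] (K + n) ω| ∂law d η ν) atTop (𝓝 0) := by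
  have hsq : ∀ v j, K ≤ j → Integrable (fun ω => (bp (theta η) j ω - y v j ω) ^ 2)
      (law d η ν) ∧ ∫ ω, (bp (theta η) j ω - y v j ω) ^ 2 ∂law d η ν ≤ 4 := by
    intro v j hj
    have hb : ∀ ω, (bp (theta η) j ω - y v j ω) ^ 2 ≤ 4 := fun ω => by
      have h1 := _root_.abs_le.1 (abs_bp_le (abs_theta_le η) j ω)
      have h2 := _root_.abs_le.1 (hy.abs_le v j hj ω)
      nlinarith
    have hI : Integrable (fun ω => (bp (theta η) j ω - y v j ω) ^ 2) (law d η ν) :=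
      integrable_of_abs_le (M := 4) (((measurable_bp _ j).sub
        (hy.measurable v hj)).pow_const 2) fun ω => by
          rw [abs_of_nonneg (sq_nonneg _)]
          exact hb ω
    refine ⟨hI, (integral_mono hI (integrable_const 4) hb).trans (by simp)⟩
  have key : ∀ n u, ∫ ω, (bp (theta η) (K + n) ω - y u (K + n) ω) ^ 2 ∂law d η ν ≤
      4 * (1 / 2) ^ n := by
    intro n
    induction n with
    | zero => exact fun u => by simpa using (hsq u (K + 0) le_rfl).2
    | succ n ih =>
      intro u
      have hk : K ≤ K + n := Nat.le_add_right _ _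
      have h := hy.setIntegral_sq_sub_succ_le hη hM hMb hκ hk ih u
      rw [← add_assoc, ← integral_add_compl (measurableSet_flipped true)
        (hsq u (K + n + 1) (hk.trans (Nat.le_succ _))).1, compl_flipped_true]
      refine (add_le_add (h true) (h false)).trans ?_
      have hδ : (0 : ℝ) ≤ 4 * (1 / 2) ^ n := by positivity
      have h3 : -(d : ℝ) * (1 - (1 - theta η ^ 2 / 4)) = -(1 / 4) * (theta η ^ 2 * d) := by ring
      -- Both error terms are linear in `δ`, as the first moment enters as `(√δ)^2`. Their
      -- coefficients depend on `d` and `θ` only through `θ^2 d`, so `hd` gives the factor 1/2.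
      rw [h3, mul_pow _ (√_) 2, Real.sq_sqrt hδ]
      refine le_trans (le_of_eq ?_) ((mul_le_mul_of_nonneg_right hd hδ).trans (le_of_eq ?_)) <;>
        ring
  have hlim : Tendsto (fun n : ℕ => √(4 * (1 / 2 : ℝ) ^ n)) atTop (𝓝 0) := by
    have := ((tendsto_pow_atTop_nhds_zero_of_lt_one (r := (1 / 2 : ℝ)) (by norm_num)
      (by norm_num)).const_mul 4).sqrt
    simpa using this
  refine squeeze_zero (fun n => integral_nonneg fun ω => abs_nonneg _) (fun n => ?_) hlim
  have hk : K ≤ K + n := Nat.le_add_right _ _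
  exact Real.le_sqrt_of_sq_le ((sq_integral_abs_le ((integrable_bp η _).sub
    (hy.integrable [] hk)) (hsq [] _ hk).1).trans (key n []))

lemma tendsto_integral_abs {L : ℝ}
    (hL : Tendsto (fun k => ∫ ω, |bp (theta η) k ω| ∂law d η ν) atTop (𝓝 L))
    (h : Tendsto (fun n => ∫ ω, |bp (theta η) (K + n) ω - y [] (K + n) ω| ∂law d η ν)
      atTop (𝓝 0)) :
    Tendsto (fun k => ∫ ω, |y [] k ω| ∂law d η ν) atTop (𝓝 L) := by
  rw [← tendsto_add_atTop_iff_nat K] at hL ⊢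
  have h1 : Tendsto (fun n => ∫ ω, |y [] (n + K) ω| ∂law d η ν -
      ∫ ω, |bp (theta η) (n + K) ω| ∂law d η ν) atTop (𝓝 0) := by
    refine squeeze_zero_norm (fun n => ?_) h
    have hk : K ≤ K + n := Nat.le_add_right _ _
    rw [add_comm n K, ← integral_sub (hy.integrable [] hk).abs (integrable_bp η _).abs,
      Real.norm_eq_abs]
    refine abs_integral_le_integral_abs.trans (integral_mono
      ((hy.integrable [] hk).abs.sub (integrable_bp η _).abs).abs
      ((integrable_bp η _).sub (hy.integrable [] hk)).abs fun ω => ?_)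
    simp only
    rw [abs_sub_comm (bp (theta η) (K + n) ω)]
    exact abs_abs_sub_abs_le _ _
  simpa using h1.add hL

end IsEstimator

end

end GWBroadcast

end

theorem theorem4p1 (c C₀ : ℝ) (hc : 0 < c) (hC₀ : 0 < C₀) :
    ∃ C : ℝ, 0 < C ∧
      ∀ (d : ℝ≥0) (η : I) (E : Type*) [MeasurableSpace E] (ν : Measure E)
        [IsProbabilityMeasure ν] (Y : List ℕ → ℕ → GWBroadcast.Config E → ℝ),
        GWBroadcast.Admissible d η ν c C₀ Y →
        C ≤ GWBroadcast.theta η ^ 2 * d →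
        ∃ L : ℝ,
          Tendsto (fun k => ∫ ω, |GWBroadcast.magnetization d η ν [] k ω|
            ∂GWBroadcast.law d η ν) atTop (𝓝 L) ∧
          Tendsto (fun k => ∫ ω, |Y [] k ω| ∂GWBroadcast.law d η ν) atTop (𝓝 L) := by
  -- `M` is fixed before `d` and `η`: noise at least 1/1024 keeps messages within `1 - 1/512`, so
  -- `C` depends only on `c` and `C₀`.
  obtain ⟨M, hM, hMb⟩ := GWBroadcast.exists_rootOdds_bounds (s := 1 / 512) (by norm_num)
  have h1 : Tendsto (fun x : ℝ => 2 * (C₀ / x) + 3 * (x ^ 0 * Real.exp (-c * x))) atTop (𝓝 0) := by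
    simpa using ((tendsto_const_nhds.div_atTop tendsto_id).const_mul 2).add
      ((GWBroadcast.tendsto_pow_mul_exp_neg_mul 0 hc).const_mul 3)
  have h2 := GWBroadcast.tendsto_pow_mul_exp_neg_mul 1 (b := 1 / 2) (by norm_num)
  have h3 : Tendsto (fun x : ℝ => 64 * ((2 * M ^ 2) * (x ^ 1 * Real.exp (-(1 / 4) * x)) +
      (4 * (M + 2 * M ^ 2) ^ 2) * (x ^ 2 * Real.exp (-(1 / 4) * x)))) atTop (𝓝 0) := by
    simpa using (((GWBroadcast.tendsto_pow_mul_exp_neg_mul 1 (b := 1 / 4) (by norm_num)).const_mul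
      (2 * M ^ 2)).add
        ((GWBroadcast.tendsto_pow_mul_exp_neg_mul 2 (b := 1 / 4) (by norm_num)).const_mul
        (4 * (M + 2 * M ^ 2) ^ 2))).const_mul 64
  obtain ⟨C, hC⟩ := eventually_atTop.1 (((h1.eventually_le_const
    (by norm_num : (0 : ℝ) < 1 / 1024)).and (h2.eventually_le_const
      (by norm_num : (0 : ℝ) < 1 / 98))).and (h3.eventually_le_const
        (by norm_num : (0 : ℝ) < 1 / 2)))
  refine ⟨max C 1, by positivity, fun d η E _ ν _ Y hY hd => ?_⟩
  have hw1 : 1 ≤ GWBroadcast.theta η ^ 2 * d := (le_max_right _ _).trans hd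
  have hwC : C ≤ GWBroadcast.theta η ^ 2 * d := (le_max_left _ _).trans hd
  have hw0 : 0 < GWBroadcast.theta η ^ 2 * d := by linarith
  have hwd : GWBroadcast.theta η ^ 2 * d ≤ d :=
    mul_le_of_le_one_left d.2 ((sq_le_one_iff_abs_le_one _).2 (GWBroadcast.abs_theta_le η))
  obtain ⟨K, y, hy, hYy⟩ := GWBroadcast.exists_isEstimator d η ν hC₀ hY hw0
  have hmin0 : 0 ≤ min (η : ℝ) (1 - η) := le_min η.2.1 (by linarith [η.2.2])
  have hmin1 : min (η : ℝ) (1 - η) ≤ 1 := (min_le_left _ _).trans η.2.2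
  have hr : 0 ≤ C₀ / (GWBroadcast.theta η ^ 2 * d) := by positivity
  have hε : C₀ * min (η : ℝ) (1 - η) / (GWBroadcast.theta η ^ 2 * d) =
      C₀ / (GWBroadcast.theta η ^ 2 * d) * min (η : ℝ) (1 - η) := by ring
  obtain ⟨⟨hC1, -⟩, hC3⟩ := hC _ hwC
  -- The small-noise contraction involves `d` itself, and `d ≥ θ^2 d` is beyond the same threshold.
  obtain ⟨⟨-, hC2⟩, -⟩ := hC _ (hwC.trans hwd)
  have hexp : Real.exp (-c * d) ≤ Real.exp (-c * (GWBroadcast.theta η ^ 2 * d)) :=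
    Real.exp_le_exp.2 (by nlinarith)
  have hexp0 := Real.exp_pos (-c * d)
  have hεr : C₀ * min (η : ℝ) (1 - η) / (GWBroadcast.theta η ^ 2 * d) ≤
      C₀ / (GWBroadcast.theta η ^ 2 * d) := by
    rw [hε]
    exact mul_le_of_le_one_right hr hmin1
  have hκ : C₀ / (GWBroadcast.theta η ^ 2 * d) +
      C₀ * min (η : ℝ) (1 - η) / (GWBroadcast.theta η ^ 2 * d) / 2 +
      3 * Real.exp (-c * d) ≤ 1 / 1024 := by
    rw [pow_zero, one_mul] at hC1
    linarith
  have hd2 : d * Real.exp (-d * (1 - 1 / 2)) ≤ 1 / 98 := by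
    rw [pow_one] at hC2
    rwa [show -(d : ℝ) * (1 - 1 / 2) = -(1 / 2) * d by ring]
  have hlim : Tendsto (fun n => ∫ ω,
      |GWBroadcast.bp (GWBroadcast.theta η) (K + n) ω - y [] (K + n) ω| ∂GWBroadcast.law d η ν)
      atTop (𝓝 0) := by
    rcases hmin0.eq_or_lt with h0 | h0
    · exact hy.tendsto_integral_abs_sub_of_min_eq_zero h0.symm hr hε (hκ.trans (by norm_num))
        (hd2.trans (by norm_num))
    · rcases le_total (min (η : ℝ) (1 - η)) (1 / 1024) with hη | hη
      · exact hy.tendsto_integral_abs_sub_of_min_le hr hε hκ h0 hη hd2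
      · exact hy.tendsto_integral_abs_sub_of_le_min hη hM hMb (by linarith) hC3
  obtain ⟨L, hL⟩ := GWBroadcast.exists_tendsto_integral_abs_magnetization d η ν
  refine ⟨L, hL.congr fun k => integral_congr_ae ?_, (hy.tendsto_integral_abs hL hlim).congr' ?_⟩
  · filter_upwards [GWBroadcast.magnetization_ae_eq d η ν k] with ω hω
    rw [hω]
  · filter_upwards [eventually_ge_atTop K] with k hk
    refine integral_congr_ae ?_
    filter_upwards [hYy k hk] with ω hω
    rw [hω]
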